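/- **Exponential decay of dispersion managed solitons.** Let $L>0$ and let $d_0:[0,L]\to\mathbb{R}$ satisfy: (a) $d_0$ is piecewise $W^{1,1}$: there is a finite partition $0=c_0<c_1<\dots<c_N=L$ such that on each open interval $(c_j,c_{j+1})$ the function $d_0$ is integrable and has an integrable weak derivative; (b) $d_0$ is bounded away from zero: $\operatorname{ess\,inf}_{s\in[0,L]}|d_0(s)|>0$. Put $D(s)=\int_0^s d_0(\alpha)\,d\alpha$, let $T_r=e^{ir\partial_x^2}$ be the free Schrödinger group on $L^2(\mathbb{R})$, let $\langle g,f\rangle=\int_{\mathbb{R}}\overline{g(x)}f(x)\,dx$, and for $f_1,\dots,f_4\in L^2(\mathbb{R})$ let $$\mathcal{Q}(f_1,f_2,f_3,f_4)=\frac1L\int_0^L\int_{\mathbb{R}}\overline{T_{D(s)}f_1(x)}\,T_{D(s)}f_2(x)\,\overline{T_{D(s)}f_3(x)}\,T_{D(s)}f_4(x)\,dx\,ds .$$ Let $\omega>0$, and let $f$ be a weak solution of the dispersion management (Gabitov–Turitsyn) equation, that is, either $d_{\mathrm{av}}>0$ and $f\in H^1(\mathbb{R})$ satisfies $$-\omega\langle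 g,f\rangle=d_{\mathrm{av}}\langle g',f'\rangle-\mathcal{Q}(g,f,f,f)\qquad\text{for all } g\in H^1(\mathbb{R}),$$ or $d_{\mathrm{av}}=0$ and $f\in L^2(\mathbb{R})$ satisfies $$-\omega\langle g,f\rangle=-\mathcal{Q}(g,f,f,f)\qquad\text{for all } g\in H^1(\mathbb{R}).$$ Here functions are complex valued. Then $f$ is integrable and agrees almost everywhere with a continuous function, again denoted by $f$, and there are constants $\mu,C>0$ such that $$|f(x)|\le C e^{-\mu|x|}\quad\text{and}\quad|\widehat f(k)|\le Ce^{-\mu|k|}\qquad\text{for all } x,k\in\mathbb{R},$$ where $\widehat f(k)=\frac{1}{\sqrt{2\pi}}\int_{\mathbb{R}}e^{ikx}f(x)\,dx$ is the Fourier transform of $f$. -/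

import Mathlib

open MeasureTheory Set
open scoped ENNReal InnerProductSpace SchwartzMap FourierTransform LineDeriv

namespace DispersionManagement

/-- `L²(ℝ)`, complex valued. Mathlib's inner product `⟪g, f⟫_ℂ` on it is `∫ conj (g x) * f x dx`. -/
abbrev L2 : Type := Lp ℂ 2 (volume : Measure ℝ)

/-! ### Dispersion profiles -/

/-- `u` is integrable on the interval `(a, b)` with an integrable weak derivative there. -/
def IsW11On (a b : ℝ) (u : ℝ → ℝ) : Prop :=
  IntegrableOn u (Ioo a b) ∧ ∃ v : ℝ → ℝ, IntegrableOn v (Ioo a b) ∧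
    ∀ φ : ℝ → ℝ, ContDiff ℝ (⊤ : ℕ∞) φ → HasCompactSupport φ → tsupport φ ⊆ Ioo a b →
      ∫ x in Ioo a b, u x * deriv φ x = - ∫ x in Ioo a b, v x * φ x

/-- `d₀` is piecewise `W^{1,1}` on `[0, L]`: there is a finite partition
`0 = c 0 < c 1 < ⋯ < c N = L` such that `d₀` is `W^{1,1}` on each open piece. -/
def IsPiecewiseW11 (L : ℝ) (d₀ : ℝ → ℝ) : Prop :=
  ∃ (N : ℕ) (c : ℕ → ℝ), c 0 = 0 ∧ c N = L ∧
    ∀ j < N, c j < c (j + 1) ∧ IsW11On (c j) (c (j + 1)) d₀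

/-- `essinf_{s ∈ [0, L]} |d₀ s| > 0` (the essential infimum is taken in `[0, ∞]`). -/
def IsBoundedAwayFromZero (L : ℝ) (d₀ : ℝ → ℝ) : Prop :=
  0 < essInf (fun s => ENNReal.ofReal |d₀ s|) (volume.restrict (Icc 0 L))

/-- `D s = ∫₀ˢ d₀`. -/
noncomputable def accumulated (d₀ : ℝ → ℝ) (s : ℝ) : ℝ := ∫ α in (0 : ℝ)..s, d₀ α

/-! ### The free Schrödinger group on `L²` -/

/-- The symbol of `e^{ir∂ₓ²}`, with respect to Mathlib's Fourier transform
`𝓕 f ξ = ∫ e^{-2πixξ} f x dx`, for which `∂ₓ²` acts as multiplication by `-(2πξ)²`. -/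
noncomputable def schrodingerSymbol (r ξ : ℝ) : ℂ :=
  Complex.exp (-(Complex.I * r * (2 * Real.pi * ξ) ^ 2))

theorem norm_schrodingerSymbol (r ξ : ℝ) : ‖schrodingerSymbol r ξ‖ = 1 := by
  have h : schrodingerSymbol r ξ
      = Complex.exp (((-(r * (2 * Real.pi * ξ) ^ 2) : ℝ) : ℂ) * Complex.I) := by
    unfold schrodingerSymbol
    congr 1
    push_cast
    ring
  rw [h, Complex.norm_exp_ofReal_mul_I]

theorem memLp_schrodingerSymbol_mul (r : ℝ) (u : L2) :
    MemLp (fun ξ => schrodingerSymbol r ξ * u ξ) 2 (volume : Measure ℝ) := by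
  refine (Lp.memLp u).of_le ?_ (Filter.Eventually.of_forall fun ξ => ?_)
  · refine Continuous.aestronglyMeasurable ?_ |>.mul (Lp.aestronglyMeasurable u)
    unfold schrodingerSymbol
    fun_prop
  · rw [norm_mul, norm_schrodingerSymbol, one_mul]

/-- `T_r = e^{ir∂ₓ²}` on `L²(ℝ)`, as the Fourier multiplier with symbol `schrodingerSymbol r`. -/
noncomputable def T (r : ℝ) (f : L2) : L2 :=
  𝓕⁻ (MemLp.toLp _ (memLp_schrodingerSymbol_mul r (𝓕 f)) : L2)

/-! ### The four-linear functional and the weak equation -/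

/-- `𝒬(f₁,f₂,f₃,f₄) = (1/L) ∫₀ᴸ ∫ conj(T_{D(s)}f₁) T_{D(s)}f₂ conj(T_{D(s)}f₃) T_{D(s)}f₄ dx ds`. -/
noncomputable def Q (L : ℝ) (d₀ : ℝ → ℝ) (f₁ f₂ f₃ f₄ : L2) : ℂ :=
  (1 / L : ℝ) * ∫ s in (0 : ℝ)..L, ∫ x : ℝ,
    starRingEnd ℂ (T (accumulated d₀ s) f₁ x) * T (accumulated d₀ s) f₂ x *
      starRingEnd ℂ (T (accumulated d₀ s) f₃ x) * T (accumulated d₀ s) f₄ x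

/-- `f ∈ L²(ℝ)` has the distributional derivative `f' ∈ L²(ℝ)`; thus `f ∈ H¹(ℝ)` iff there is such
an `f'`, which is then unique. -/
def HasH1Deriv (f f' : L2) : Prop := ∂_{(1 : ℝ)} (f : 𝓢'(ℝ, ℂ)) = (f' : 𝓢'(ℝ, ℂ))

/-- Weak solutions of `-ω f = -d_av f'' - Q(f,f,f)`, tested against all `g ∈ H¹(ℝ)`:
for `d_av > 0` the solution `f` is in `H¹(ℝ)`, for `d_av = 0` it is in `L²(ℝ)`. -/
def IsWeakSolution (L : ℝ) (d₀ : ℝ → ℝ) (dav ω : ℝ) (f : L2) : Prop :=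
  (0 < dav ∧ ∃ f' : L2, HasH1Deriv f f' ∧
    ∀ g g' : L2, HasH1Deriv g g' →
      -(ω : ℂ) * ⟪g, f⟫_ℂ = dav * ⟪g', f'⟫_ℂ - Q L d₀ g f f f) ∨
  (dav = 0 ∧
    ∀ g g' : L2, HasH1Deriv g g' →
      -(ω : ℂ) * ⟪g, f⟫_ℂ = - Q L d₀ g f f f)

/-- The Fourier transform `f̂ k = (2π)^{-1/2} ∫ e^{ikx} f x dx` of an integrable function. -/
noncomputable def fourierHat (f : ℝ → ℂ) (k : ℝ) : ℂ :=
  (1 / Real.sqrt (2 * Real.pi) : ℝ) * ∫ x : ℝ, Complex.exp (Complex.I * k * x) * f x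

end DispersionManagement

/-! Let R be the resolvent of ω - d_av ∂ₓ². Tested against Rh, the weak equation becomes ⟨h, f⟩ =
Q(Rh, f, f, f) for every h in L² (`IsWeakSolution.inner_eq`). The decay of f and of its Fourier
transform then follows from one scheme, run once in position and once in frequency.

Write Q as an integral over quadruples with η₁ + η₃ = η₂ + η₄ = s and carry out the time integral
first. In frequency the kernel is ∫ exp(i t D(s)) ds with t a multiple of (η₂ - η₁)(η₁ - η₄). In
position the explicit Gaussian kernel of T_r turns the same product into τ in the kernel ∫ exp(i τ /
D(s)) ds / |D(s)|. Since d₀ is piecewise W^{1,1} and bounded away from zero, integration by parts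
against 1/d₀ bounds an integral in s along D by integrals in r = D(s)
(`exists_norm_integral_accumulated_le`). Both kernels are then bounded by a constant times `kw`:
oscillation gives 1/|t|, and the singularity at 0, at worst logarithmic, is absorbed by |t|^{-1/4}.
Hence Q is dominated by the same positive form `N4` of |f| and of the modulus of its transform
(`Q_bounds`).

The form `N4` has three properties. It is bounded on L², because kw(ab) ≤ kap(a) + kap(b) with `kap`
integrable. It gains R^{-1/4} when the first argument is supported at distance R from the second or
the fourth. It vanishes when the first argument lives in |x| ≥ 3r and the other three in |x| < r,
because η₁ = η₂ + η₄ - η₃. The same relation makes exponential weights submultiplicative along the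
form, even when they are capped at height e^M.

Let A(M) be the L² norm of the capped weighted function over |x| ≥ 4σ. The equation bounds A(M) by a
small linear term, quadratic and cubic terms, and a tail of the resolvent measure. For large σ and a
suitable small a, A(M) ≤ 2a forces A(M) ≤ a. Raising M by log 2 at most doubles A, so the bound
propagates to all M, and Fatou's lemma removes the cap (`exp_decay`). The resolvent acts in position
as convolution with an exponentially decaying positive measure, and in frequency as multiplication
by a bounded function.

Thus f and its transform are square integrable against exponential weights, hence integrable against
smaller ones. Each is the Fourier transform of the other up to reflection, so both have Lipschitz
representatives, and a Lipschitz function with an exponentially weighted integral decays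
exponentially at every point. -/

namespace DispersionManagement

/-! ### The positive four-linear form: kernel bounds and multilinear estimates. -/

/-- The `L²` norm of a nonnegative function. -/
noncomputable def l2 (p : ℝ → ℝ≥0∞) : ℝ≥0∞ := (∫⁻ x, p x ^ (2 : ℝ)) ^ (1 / 2 : ℝ)

/-- The kernel `min (1/|t|) (1/|t|^{1/4})`. -/
noncomputable def kw (t : ℝ) : ℝ≥0∞ := min (‖t‖ₑ⁻¹) (‖t‖ₑ ^ (-(1 / 4) : ℝ))

/-- An integrable majorant. -/
noncomputable def kap (t : ℝ) : ℝ≥0∞ :=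
  if |t| ≤ 1 then ‖t‖ₑ ^ (-(1 / 2) : ℝ) else ‖t‖ₑ ^ (-(7 / 4) : ℝ)

/-- The positive four-linear form with kernel `kw`. -/
noncomputable def N4 (p₁ p₂ p₃ p₄ : ℝ → ℝ≥0∞) : ℝ≥0∞ :=
  ∫⁻ s, ∫⁻ x, ∫⁻ y, kw ((y - x) * (x + y - s)) * (p₁ x * p₃ (s - x) * (p₂ y * p₄ (s - y)))

@[fun_prop]
theorem measurable_kw : Measurable kw := by unfold kw; fun_prop

@[fun_prop]
theorem measurable_kap : Measurable kap := by
  unfold kap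
  refine Measurable.ite ?_ (by fun_prop) (by fun_prop)
  exact measurableSet_le (by fun_prop) (by fun_prop)

theorem kap_neg (t : ℝ) : kap (-t) = kap t := by simp [kap]

theorem kap_zero : kap 0 = ⊤ := by
  simp only [kap, abs_zero, zero_le_one, if_true, enorm_zero]
  exact ENNReal.zero_rpow_of_neg (by norm_num)

theorem kap_of_ne_zero {t : ℝ} (ht : t ≠ 0) : kap t =
    ENNReal.ofReal (if |t| ≤ 1 then |t| ^ (-(1 / 2) : ℝ) else |t| ^ (-(7 / 4) : ℝ)) := by
  have : 0 < |t| := abs_pos.2 ht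
  unfold kap
  split_ifs <;> rw [Real.enorm_eq_ofReal_abs, ENNReal.ofReal_rpow_of_pos this]

/-- For |t| ≤ 1 the exponent 1/4 gives the smallest of these powers, for |t| ≥ 1 the exponent 1
does, and `kw` lies below both. -/
theorem kw_le_rpow {t : ℝ} (ht : t ≠ 0) {θ : ℝ} (h1 : 1 / 4 ≤ θ) (h2 : θ ≤ 1) :
    kw t ≤ ENNReal.ofReal (|t| ^ (-θ)) := by
  have h0 : 0 < |t| := abs_pos.2 ht
  unfold kw
  rw [Real.enorm_eq_ofReal_abs, ENNReal.ofReal_rpow_of_pos h0, ← ENNReal.ofReal_inv_of_pos h0]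
  rcases le_total |t| 1 with h | h
  · exact (min_le_right _ _).trans (ENNReal.ofReal_le_ofReal
      (Real.rpow_le_rpow_of_exponent_ge h0 h (by linarith)))
  · refine (min_le_left _ _).trans (ENNReal.ofReal_le_ofReal ?_)
    rw [← Real.rpow_neg_one]
    exact Real.rpow_le_rpow_of_exponent_le h (by linarith)

/-- For |b| ≤ 1 the exponent 1/2 leaves an integrable singularity in b and a negative power of |a| ≥
R. For |b| > 1 the exponent 1 is used and |a|^{-1/4} split off; what remains, |a|^{-3/4}|b|^{-1}, is
at most the power -7/4 of the smaller of the two moduli. At b = 0 the right side is infinite. -/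
theorem kw_mul_le_of_le {R a b : ℝ} (hR : 1 ≤ R) (ha : R ≤ |a|) :
    kw (a * b) ≤ ENNReal.ofReal (R ^ (-(1 / 4) : ℝ)) * (kap a + kap b) := by
  have hR0 : 0 < R := by linarith
  have ha0 : 0 < |a| := by linarith
  rcases eq_or_ne b 0 with rfl | hb
  · rw [kap_zero, add_top, ENNReal.mul_top]
    · exact le_top
    · simpa using Real.rpow_pos_of_pos hR0 _
  have hb0 : 0 < |b| := abs_pos.2 hb
  have hab : a * b ≠ 0 := mul_ne_zero (abs_pos.1 ha0) hb
  rcases le_or_gt |b| 1 with h | h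
  · refine (kw_le_rpow hab (θ := 1 / 2) (by norm_num) (by norm_num)).trans ?_
    refine le_trans ?_ (mul_le_mul_right le_add_self _)
    rw [kap_of_ne_zero hb, if_pos h, ← ENNReal.ofReal_mul (Real.rpow_nonneg hR0.le _), abs_mul,
      Real.mul_rpow ha0.le hb0.le]
    refine ENNReal.ofReal_le_ofReal (mul_le_mul_of_nonneg_right ?_ (Real.rpow_nonneg hb0.le _))
    calc |a| ^ (-(1 / 2) : ℝ) ≤ R ^ (-(1 / 2) : ℝ) :=
          Real.rpow_le_rpow_of_nonpos hR0 ha (by norm_num)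
      _ ≤ R ^ (-(1 / 4) : ℝ) := Real.rpow_le_rpow_of_exponent_le hR (by norm_num)
  · have h1a : 1 ≤ |a| := hR.trans ha
    refine (kw_le_rpow hab (θ := 1) (by norm_num) (by norm_num)).trans ?_
    have key : |a * b| ^ (-1 : ℝ) ≤ R ^ (-(1 / 4) : ℝ) * (|a| ^ (-(7/4) : ℝ) + |b| ^ (-(7/4) : ℝ)) := by
      have e1 : |a * b| ^ (-1 : ℝ) = |a| ^ (-(1 / 4) : ℝ) * (|a| ^ (-(3 / 4) : ℝ) * |b| ^ (-1 : ℝ)) := by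
        rw [abs_mul, Real.mul_rpow ha0.le hb0.le, ← mul_assoc, ← Real.rpow_add ha0]
        norm_num
      rw [e1]
      refine mul_le_mul (Real.rpow_le_rpow_of_nonpos hR0 ha (by norm_num)) ?_ (by positivity)
        (by positivity)
      rcases le_total |a| |b| with hh | hh
      · calc _ ≤ |a| ^ (-(3 / 4) : ℝ) * |a| ^ (-1 : ℝ) := by
              gcongr ?_ * ?_
              exact Real.rpow_le_rpow_of_nonpos ha0 hh (by norm_num)
          _ = |a| ^ (-(7 / 4) : ℝ) := by rw [← Real.rpow_add ha0]; norm_num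
          _ ≤ _ := le_add_of_nonneg_right (by positivity)
      · calc _ ≤ |b| ^ (-(3 / 4) : ℝ) * |b| ^ (-1 : ℝ) := by
              gcongr ?_ * ?_
              exact Real.rpow_le_rpow_of_nonpos hb0 hh (by norm_num)
          _ = |b| ^ (-(7 / 4) : ℝ) := by rw [← Real.rpow_add hb0]; norm_num
          _ ≤ _ := le_add_of_nonneg_left (by positivity)
    have hka : ENNReal.ofReal (|a| ^ (-(7/4) : ℝ)) ≤ kap a := by
      rw [kap_of_ne_zero (abs_pos.1 ha0)]
      apply ENNReal.ofReal_le_ofReal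
      split_ifs with h'
      · rw [le_antisymm h' h1a, Real.one_rpow, Real.one_rpow]
      · exact le_rfl
    have hkb : ENNReal.ofReal (|b| ^ (-(7/4) : ℝ)) ≤ kap b := by
      rw [kap_of_ne_zero hb, if_neg h.not_ge]
    refine (ENNReal.ofReal_le_ofReal key).trans ?_
    rw [ENNReal.ofReal_mul (by positivity), ENNReal.ofReal_add (by positivity) (by positivity)]
    gcongr

/-- When both moduli are below 1, the exponent 1/4 factorizes and |a|^{-1/4}|b|^{-1/4} ≤ |a|^{-1/2}
+ |b|^{-1/2}. Otherwise one factor has modulus at least R = 1. -/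
theorem kw_mul_le (a b : ℝ) : kw (a * b) ≤ kap a + kap b := by
  rcases le_or_gt 1 |a| with h | h
  · simpa using kw_mul_le_of_le (b := b) le_rfl h
  rcases le_or_gt 1 |b| with h' | h'
  · simpa [mul_comm, add_comm] using kw_mul_le_of_le (b := a) le_rfl h'
  rcases eq_or_ne a 0 with rfl | ha
  · simp [kap_zero]
  rcases eq_or_ne b 0 with rfl | hb
  · simp [kap_zero]
  have ha0 : 0 < |a| := abs_pos.2 ha
  have hb0 : 0 < |b| := abs_pos.2 hb
  refine (kw_le_rpow (mul_ne_zero ha hb) (θ := 1 / 4) le_rfl (by norm_num)).trans ?_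
  rw [kap_of_ne_zero ha, kap_of_ne_zero hb, if_pos h.le, if_pos h'.le,
    ← ENNReal.ofReal_add (by positivity) (by positivity)]
  apply ENNReal.ofReal_le_ofReal
  rw [abs_mul, Real.mul_rpow ha0.le hb0.le]
  have e : ∀ t : ℝ, 0 < t → t ^ (-(1 / 2) : ℝ) = t ^ (-(1 / 4) : ℝ) * t ^ (-(1 / 4) : ℝ) := by
    intro t ht
    rw [← Real.rpow_add ht]; norm_num
  rw [e _ ha0, e _ hb0]
  nlinarith [sq_nonneg (|a| ^ (-(1 / 4) : ℝ) - |b| ^ (-(1 / 4) : ℝ)),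
    sq_nonneg (|a| ^ (-(1 / 4) : ℝ) + |b| ^ (-(1 / 4) : ℝ))]

theorem lintegral_kap_lt_top : ∫⁻ t, kap t < ⊤ := by
  have h1 : ∫⁻ t in Ioi 0, kap t < ⊤ := by
    rw [← Ioc_union_Ioi_eq_Ioi zero_le_one]
    refine (lintegral_union_le _ _ _).trans_lt (ENNReal.add_lt_top.2 ⟨?_, ?_⟩)
    · have : IntegrableOn (fun t : ℝ => t ^ (-(1 / 2) : ℝ)) (Ioc 0 1) :=
        (intervalIntegrable_iff_integrableOn_Ioc_of_le zero_le_one).1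
          (intervalIntegral.intervalIntegrable_rpow' (by norm_num))
      refine lt_of_le_of_lt (setLIntegral_mono' measurableSet_Ioc fun t ht => ?_)
        this.lintegral_lt_top
      rw [kap_of_ne_zero ht.1.ne', abs_of_pos ht.1, if_pos ht.2]
    · have : IntegrableOn (fun t : ℝ => t ^ (-(7 / 4) : ℝ)) (Ioi 1) :=
        integrableOn_Ioi_rpow_of_lt (by norm_num) zero_lt_one
      refine lt_of_le_of_lt (setLIntegral_mono' measurableSet_Ioi fun t ht => ?_)
        this.lintegral_lt_top
      have h0 : (0 : ℝ) < t := zero_lt_one.trans ht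
      rw [kap_of_ne_zero h0.ne', abs_of_pos h0, if_neg (not_le.2 ht)]
  have h2 : ∫⁻ t in Iio 0, kap t = ∫⁻ t in Ioi 0, kap t := by
    rw [← lintegral_indicator measurableSet_Iio, ← lintegral_indicator measurableSet_Ioi,
      ← lintegral_neg_eq_self]
    congr 1
    ext t
    by_cases h : 0 < t <;> simp [indicator, h, kap_neg]
  have h3 : ∫⁻ t, kap t = ∫⁻ t in Iio 0 ∪ Ioi 0, kap t := by
    rw [Iio_union_Ioi, ← setLIntegral_univ]
    exact (setLIntegral_congr (by simp)).symm
  rw [h3]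
  refine (lintegral_union_le _ _ _).trans_lt (ENNReal.add_lt_top.2 ⟨h2 ▸ h1, h1⟩)

theorem lintegral_mul_le_l2 {a b : ℝ → ℝ≥0∞} (ha : Measurable a) (hb : Measurable b) :
    ∫⁻ x, a x * b x ≤ l2 a * l2 b :=
  ENNReal.lintegral_mul_le_Lp_mul_Lq volume Real.HolderConjugate.two_two ha.aemeasurable
    hb.aemeasurable

theorem l2_add_le {a b : ℝ → ℝ≥0∞} (ha : Measurable a) (hb : Measurable b) :
    l2 (fun x => a x + b x) ≤ l2 a + l2 b :=
  ENNReal.lintegral_Lp_add_le ha.aemeasurable hb.aemeasurable one_le_two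

theorem l2_mono {a b : ℝ → ℝ≥0∞} (h : ∀ x, a x ≤ b x) : l2 a ≤ l2 b := by
  unfold l2
  gcongr with x
  exact h x

theorem l2_const_mul {a : ℝ → ℝ≥0∞} (ha : Measurable a) (c : ℝ≥0∞) :
    l2 (fun x => c * a x) = c * l2 a := by
  unfold l2
  simp_rw [ENNReal.mul_rpow_of_nonneg _ _ zero_le_two]
  rw [lintegral_const_mul _ (by fun_prop), ENNReal.mul_rpow_of_nonneg _ _ (by norm_num),
    ← ENNReal.rpow_mul]
  norm_num

theorem l2_comp_sub_right (a : ℝ → ℝ≥0∞) (z : ℝ) : l2 (fun x => a (x - z)) = l2 a := by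
  unfold l2
  rw [lintegral_sub_right_eq_self (fun x => a x ^ (2 : ℝ))]

theorem l2_sq (a : ℝ → ℝ≥0∞) : l2 a ^ 2 = ∫⁻ x, a x ^ 2 := by
  unfold l2
  rw [← ENNReal.rpow_natCast, ← ENNReal.rpow_mul]
  norm_num

/-- Young's inequality: put y = t + x, and for each t apply Cauchy–Schwarz in x. -/
theorem lintegral_kernel_mul_le {k a b : ℝ → ℝ≥0∞} (hk : Measurable k) (ha : Measurable a)
    (hb : Measurable b) :
    ∫⁻ x, ∫⁻ y, k (y - x) * (a x * b y) ≤ (∫⁻ t, k t) * (l2 a * l2 b) := by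
  calc ∫⁻ x, ∫⁻ y, k (y - x) * (a x * b y)
      = ∫⁻ x, ∫⁻ t, k t * (a x * b (t + x)) := by
        refine lintegral_congr fun x => ?_
        rw [← lintegral_sub_right_eq_self (fun t => k t * (a x * b (t + x))) x]
        simp
    _ = ∫⁻ t, ∫⁻ x, k t * (a x * b (t + x)) := lintegral_lintegral_swap (by fun_prop)
    _ ≤ ∫⁻ t, k t * (l2 a * l2 b) := by
        refine lintegral_mono fun t => ?_
        rw [lintegral_const_mul _ (by fun_prop)]
        gcongr
        refine (lintegral_mul_le_l2 ha (by fun_prop)).trans_eq ?_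
        congr 1
        have := l2_comp_sub_right b (-t)
        simpa [add_comm] using this
    _ = _ := lintegral_mul_const _ hk

/-- The kernel does not involve s. Integrating in s first and using Cauchy–Schwarz removes p₃ and
p₄, and Young's inequality handles p₁ and p₂. -/
theorem quad_kernel_le {k p₁ p₂ p₃ p₄ : ℝ → ℝ≥0∞} (hk : Measurable k) (h₁ : Measurable p₁)
    (h₂ : Measurable p₂) (h₃ : Measurable p₃) (h₄ : Measurable p₄) :
    ∫⁻ s, ∫⁻ x, ∫⁻ y, k (y - x) * (p₁ x * p₃ (s - x) * (p₂ y * p₄ (s - y)))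
      ≤ (∫⁻ t, k t) * (l2 p₁ * l2 p₂ * l2 p₃ * l2 p₄) := by
  rw [lintegral_lintegral_swap (by fun_prop)]
  have : ∀ x, ∫⁻ s, ∫⁻ y, k (y - x) * (p₁ x * p₃ (s - x) * (p₂ y * p₄ (s - y)))
      = ∫⁻ y, ∫⁻ s, k (y - x) * (p₁ x * p₃ (s - x) * (p₂ y * p₄ (s - y))) := fun x =>
    lintegral_lintegral_swap (by fun_prop)
  simp_rw [this]
  calc _ ≤ ∫⁻ x, ∫⁻ y, k (y - x) * (p₁ x * p₂ y) * (l2 p₃ * l2 p₄) := by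
        refine lintegral_mono fun x => lintegral_mono fun y => ?_
        have e : ∀ s, k (y - x) * (p₁ x * p₃ (s - x) * (p₂ y * p₄ (s - y)))
            = k (y - x) * (p₁ x * p₂ y) * (p₃ (s - x) * p₄ (s - y)) := fun s => by ring
        simp_rw [e]
        rw [lintegral_const_mul _ (by fun_prop)]
        gcongr
        refine (lintegral_mul_le_l2 (by fun_prop) (by fun_prop)).trans_eq ?_
        rw [l2_comp_sub_right, l2_comp_sub_right]
    _ = (∫⁻ x, ∫⁻ y, k (y - x) * (p₁ x * p₂ y)) * (l2 p₃ * l2 p₄) := by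
        rw [← lintegral_mul_const _ (by fun_prop)]
        exact lintegral_congr fun x => lintegral_mul_const _ (by fun_prop)
    _ ≤ (∫⁻ t, k t) * (l2 p₁ * l2 p₂) * (l2 p₃ * l2 p₄) := by
        gcongr
        exact lintegral_kernel_mul_le hk h₁ h₂
    _ = _ := by ring

/-- The reflection y ↦ s - y exchanges p₂ and p₄ and turns x + y - s into x - y. -/
theorem quad_kernel_le' {k p₁ p₂ p₃ p₄ : ℝ → ℝ≥0∞} (hk : Measurable k) (hk' : ∀ t, k (-t) = k t)
    (h₁ : Measurable p₁) (h₂ : Measurable p₂) (h₃ : Measurable p₃) (h₄ : Measurable p₄) :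
    ∫⁻ s, ∫⁻ x, ∫⁻ y, k (x + y - s) * (p₁ x * p₃ (s - x) * (p₂ y * p₄ (s - y)))
      ≤ (∫⁻ t, k t) * (l2 p₁ * l2 p₂ * l2 p₃ * l2 p₄) := by
  refine le_trans (le_of_eq ?_) ((quad_kernel_le hk h₁ h₄ h₃ h₂).trans_eq (by ring))
  refine lintegral_congr fun s => lintegral_congr fun x => ?_
  rw [← lintegral_sub_left_eq_self _ s]
  refine lintegral_congr fun y => ?_
  rw [show x + (s - y) - s = -(y - x) by ring, hk', sub_sub_cancel]
  ring

/-- The constant in the estimates of `N4`. -/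
noncomputable def kapC : ℝ≥0∞ := 2 * ∫⁻ t, kap t

theorem kapC_ne_top : kapC ≠ ⊤ := ENNReal.mul_ne_top (by simp) lintegral_kap_lt_top.ne

/-- The kernel bound is required only where the product of the four functions is nonzero, so this
one estimate covers both the general case c = 1 and the gain from separated supports. -/
theorem N4_le_of_kernel_le {c : ℝ≥0∞} {p₁ p₂ p₃ p₄ : ℝ → ℝ≥0∞} (h₁ : Measurable p₁)
    (h₂ : Measurable p₂) (h₃ : Measurable p₃) (h₄ : Measurable p₄)
    (h : ∀ s x y, p₁ x * p₃ (s - x) * (p₂ y * p₄ (s - y)) ≠ 0 →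
      kw ((y - x) * (x + y - s)) ≤ c * (kap (y - x) + kap (x + y - s))) :
    N4 p₁ p₂ p₃ p₄ ≤ c * kapC * (l2 p₁ * l2 p₂ * l2 p₃ * l2 p₄) := by
  calc N4 p₁ p₂ p₃ p₄ ≤ ∫⁻ s, ∫⁻ x, ∫⁻ y, c * (kap (y - x) *
          (p₁ x * p₃ (s - x) * (p₂ y * p₄ (s - y))) + kap (x + y - s) *
          (p₁ x * p₃ (s - x) * (p₂ y * p₄ (s - y)))) := by
        refine lintegral_mono fun s => lintegral_mono fun x => lintegral_mono fun y => ?_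
        rcases eq_or_ne (p₁ x * p₃ (s - x) * (p₂ y * p₄ (s - y))) 0 with h0 | h0
        · simp only [h0, mul_zero, zero_le]
        · calc _ ≤ c * (kap (y - x) + kap (x + y - s)) *
                (p₁ x * p₃ (s - x) * (p₂ y * p₄ (s - y))) := mul_le_mul_left (h s x y h0) _
            _ = _ := by ring
    _ = c * ((∫⁻ s, ∫⁻ x, ∫⁻ y, kap (y - x) * (p₁ x * p₃ (s - x) * (p₂ y * p₄ (s - y)))) +
          ∫⁻ s, ∫⁻ x, ∫⁻ y, kap (x + y - s) * (p₁ x * p₃ (s - x) * (p₂ y * p₄ (s - y)))) := by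
        rw [← lintegral_add_left (by fun_prop), ← lintegral_const_mul _ (by fun_prop)]
        refine lintegral_congr fun s => ?_
        rw [← lintegral_add_left (by fun_prop), ← lintegral_const_mul _ (by fun_prop)]
        refine lintegral_congr fun x => ?_
        rw [← lintegral_add_left (by fun_prop), ← lintegral_const_mul _ (by fun_prop)]
    _ ≤ c * ((∫⁻ t, kap t) * (l2 p₁ * l2 p₂ * l2 p₃ * l2 p₄) +
          (∫⁻ t, kap t) * (l2 p₁ * l2 p₂ * l2 p₃ * l2 p₄)) := by
        gcongr
        · exact quad_kernel_le measurable_kap h₁ h₂ h₃ h₄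
        · exact quad_kernel_le' measurable_kap kap_neg h₁ h₂ h₃ h₄
    _ = _ := by unfold kapC; ring

theorem N4_le {p₁ p₂ p₃ p₄ : ℝ → ℝ≥0∞} (h₁ : Measurable p₁)
    (h₂ : Measurable p₂) (h₃ : Measurable p₃) (h₄ : Measurable p₄) :
    N4 p₁ p₂ p₃ p₄ ≤ kapC * (l2 p₁ * l2 p₂ * l2 p₃ * l2 p₄) := by
  simpa using N4_le_of_kernel_le (c := 1) h₁ h₂ h₃ h₄ fun s x y _ => by
    simpa using kw_mul_le _ _

theorem N4_le_of_separated {R : ℝ} (hR : 1 ≤ R) {p₁ p₂ p₃ p₄ : ℝ → ℝ≥0∞} (h₁ : Measurable p₁)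
    (h₂ : Measurable p₂) (h₃ : Measurable p₃) (h₄ : Measurable p₄)
    (hs : ∀ x y, p₁ x ≠ 0 → p₂ y ≠ 0 → R ≤ |y - x|) :
    N4 p₁ p₂ p₃ p₄ ≤
      ENNReal.ofReal (R ^ (-(1 / 4) : ℝ)) * kapC * (l2 p₁ * l2 p₂ * l2 p₃ * l2 p₄) := by
  refine N4_le_of_kernel_le h₁ h₂ h₃ h₄ fun s x y h => kw_mul_le_of_le hR (hs x y ?_ ?_) <;>
  · intro h0; simp [h0] at h

/-- The second factor of the kernel, x + y - s = x - (s - y), is the difference of the arguments of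
p₁ and p₄. -/
theorem N4_le_of_separated' {R : ℝ} (hR : 1 ≤ R) {p₁ p₂ p₃ p₄ : ℝ → ℝ≥0∞} (h₁ : Measurable p₁)
    (h₂ : Measurable p₂) (h₃ : Measurable p₃) (h₄ : Measurable p₄)
    (hs : ∀ x y, p₁ x ≠ 0 → p₄ y ≠ 0 → R ≤ |y - x|) :
    N4 p₁ p₂ p₃ p₄ ≤
      ENNReal.ofReal (R ^ (-(1 / 4) : ℝ)) * kapC * (l2 p₁ * l2 p₂ * l2 p₃ * l2 p₄) := by
  refine N4_le_of_kernel_le h₁ h₂ h₃ h₄ fun s x y h => ?_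
  rw [mul_comm (y - x), add_comm (kap (y - x))]
  refine kw_mul_le_of_le hR ?_
  have := hs x (s - y) (fun h0 => by simp [h0] at h) (fun h0 => by simp [h0] at h)
  rwa [abs_sub_comm, show x - (s - y) = x + y - s by ring] at this

theorem N4_add₂ {p₁ p₂ p₂' p₃ p₄ : ℝ → ℝ≥0∞} (h₁ : Measurable p₁)
    (h₂ : Measurable p₂) (h₃ : Measurable p₃) (h₄ : Measurable p₄) :
    N4 p₁ (fun x => p₂ x + p₂' x) p₃ p₄ = N4 p₁ p₂ p₃ p₄ + N4 p₁ p₂' p₃ p₄ := by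
  unfold N4
  simp_rw [add_mul, mul_add]
  rw [← lintegral_add_left (by fun_prop)]
  refine lintegral_congr fun s => ?_
  rw [← lintegral_add_left (by fun_prop)]
  refine lintegral_congr fun x => ?_
  rw [← lintegral_add_left (by fun_prop)]

theorem N4_add₃ {p₁ p₂ p₃ p₃' p₄ : ℝ → ℝ≥0∞} (h₁ : Measurable p₁)
    (h₂ : Measurable p₂) (h₃ : Measurable p₃) (h₄ : Measurable p₄) :
    N4 p₁ p₂ (fun x => p₃ x + p₃' x) p₄ = N4 p₁ p₂ p₃ p₄ + N4 p₁ p₂ p₃' p₄ := by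
  unfold N4
  simp_rw [mul_add, add_mul, mul_add]
  rw [← lintegral_add_left (by fun_prop)]
  refine lintegral_congr fun s => ?_
  rw [← lintegral_add_left (by fun_prop)]
  refine lintegral_congr fun x => ?_
  rw [← lintegral_add_left (by fun_prop)]

theorem N4_add₄ {p₁ p₂ p₃ p₄ p₄' : ℝ → ℝ≥0∞} (h₁ : Measurable p₁)
    (h₂ : Measurable p₂) (h₃ : Measurable p₃) (h₄ : Measurable p₄) :
    N4 p₁ p₂ p₃ (fun x => p₄ x + p₄' x) = N4 p₁ p₂ p₃ p₄ + N4 p₁ p₂ p₃ p₄' := by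
  unfold N4
  simp_rw [mul_add]
  rw [← lintegral_add_left (by fun_prop)]
  refine lintegral_congr fun s => ?_
  rw [← lintegral_add_left (by fun_prop)]
  refine lintegral_congr fun x => ?_
  rw [← lintegral_add_left (by fun_prop)]

/-- Conservation x = y + (s - y) - (s - x) prevents three arguments of modulus below r from
balancing one of modulus at least 3r. -/
theorem N4_eq_zero {r : ℝ} {p₁ p₂ p₃ p₄ : ℝ → ℝ≥0∞} (hp₁ : ∀ x, p₁ x ≠ 0 → 3 * r ≤ |x|)
    (hp₂ : ∀ x, p₂ x ≠ 0 → |x| < r) (hp₃ : ∀ x, p₃ x ≠ 0 → |x| < r)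
    (hp₄ : ∀ x, p₄ x ≠ 0 → |x| < r) : N4 p₁ p₂ p₃ p₄ = 0 := by
  have : ∀ s x y, p₁ x * p₃ (s - x) * (p₂ y * p₄ (s - y)) = 0 := by
    intro s x y
    by_contra h
    have h1 := hp₁ x (fun h0 => by simp [h0] at h)
    have h2 := hp₂ y (fun h0 => by simp [h0] at h)
    have h3 := hp₃ (s - x) (fun h0 => by simp [h0] at h)
    have h4 := hp₄ (s - y) (fun h0 => by simp [h0] at h)
    have h5 : |x| ≤ |y| + |s - y| + |s - x| := by
      calc |x| = |y + (s - y) - (s - x)| := by ring_nf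
        _ ≤ _ := (abs_sub _ _).trans (by gcongr; exact abs_add_le _ _)
    linarith
  simp [N4, this]

theorem N4_mono_of_weight {p₁ p₂ p₃ p₄ q₁ q₂ q₃ q₄ : ℝ → ℝ≥0∞} {c : ℝ≥0∞} (hc : c ≠ ⊤)
    (h : ∀ s x y, p₁ x * p₃ (s - x) * (p₂ y * p₄ (s - y)) ≤
      c * (q₁ x * q₃ (s - x) * (q₂ y * q₄ (s - y)))) :
    N4 p₁ p₂ p₃ p₄ ≤ c * N4 q₁ q₂ q₃ q₄ := by
  unfold N4
  rw [← lintegral_const_mul' _ _ hc]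
  refine lintegral_mono fun s => ?_
  rw [← lintegral_const_mul' _ _ hc]
  refine lintegral_mono fun x => ?_
  rw [← lintegral_const_mul' _ _ hc]
  refine lintegral_mono fun y => ?_
  calc _ ≤ kw ((y - x) * (x + y - s)) * (c * (q₁ x * q₃ (s - x) * (q₂ y * q₄ (s - y)))) :=
        mul_le_mul_right (h s x y) _
    _ = _ := by ring

end DispersionManagement

/-! ### Exponential weights and the bootstrap for exponential decay. -/

namespace DispersionManagement

open Filter Topology

/-- The exponential weight `e^{min(μ|x|, M)}`. -/
noncomputable def wt (μ M x : ℝ) : ℝ≥0∞ := ENNReal.ofReal (Real.exp (min (μ * |x|) M))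

@[fun_prop]
theorem measurable_wt (μ M : ℝ) : Measurable (wt μ M) := by unfold wt; fun_prop

theorem wt_le_exp (μ M x : ℝ) : wt μ M x ≤ ENNReal.ofReal (Real.exp M) :=
  ENNReal.ofReal_le_ofReal (Real.exp_le_exp.2 (min_le_right _ _))

theorem wt_le_exp_mul {μ r x : ℝ} (M : ℝ) (hμ : 0 ≤ μ) (hx : |x| ≤ r) :
    wt μ M x ≤ ENNReal.ofReal (Real.exp (μ * r)) :=
  ENNReal.ofReal_le_ofReal (Real.exp_le_exp.2 ((min_le_left _ _).trans (by gcongr)))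

theorem wt_sub_le {μ M : ℝ} (hμ : 0 ≤ μ) (x z : ℝ) :
    wt μ M (x - z) ≤ ENNReal.ofReal (Real.exp (μ * |z|)) * wt μ M x := by
  unfold wt
  rw [← ENNReal.ofReal_mul (Real.exp_nonneg _), ← Real.exp_add]
  refine ENNReal.ofReal_le_ofReal (Real.exp_le_exp.2 ?_)
  have h1 : μ * |x - z| ≤ μ * |x| + μ * |z| := by
    rw [← mul_add]; gcongr; exact abs_sub _ _
  have h2 : 0 ≤ μ * |z| := by positivity
  rcases min_cases (μ * |x|) M with h | h <;> rcases min_cases (μ * |x - z|) M with h' | h' <;>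
    linarith

/-- Capping preserves subadditivity of the exponent: if one summand on the right is capped it
already contributes M, and all the others are nonnegative. -/
theorem wt_le_mul {μ M : ℝ} (hμ : 0 ≤ μ) (hM : 0 ≤ M) {x a b c : ℝ} (h : |x| ≤ |a| + |b| + |c|) :
    wt μ M x ≤ wt μ M a * wt μ M b * wt μ M c := by
  unfold wt
  rw [← ENNReal.ofReal_mul (Real.exp_nonneg _), ← Real.exp_add,
    ← ENNReal.ofReal_mul (Real.exp_nonneg _), ← Real.exp_add]
  refine ENNReal.ofReal_le_ofReal (Real.exp_le_exp.2 ?_)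
  have h1 : μ * |x| ≤ μ * |a| + μ * |b| + μ * |c| := by
    rw [← mul_add, ← mul_add]; gcongr
  have ha : 0 ≤ μ * |a| := by positivity
  have hb : 0 ≤ μ * |b| := by positivity
  have hc : 0 ≤ μ * |c| := by positivity
  have := min_le_left (μ * |x|) M
  have := min_le_right (μ * |x|) M
  rcases min_cases (μ * |a|) M with h | h <;> rcases min_cases (μ * |b|) M with h' | h' <;>
    rcases min_cases (μ * |c|) M with h'' | h'' <;> linarith

/-- Because x = y + (s - y) - (s - x), the weight on the first argument can be distributed over the
other three; the shift by z costs e^{μ|z|}. -/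
theorem N4_weighted_le {μ M : ℝ} (hμ : 0 ≤ μ) (hM : 0 ≤ M) (p q : ℝ → ℝ≥0∞) (z : ℝ) :
    N4 (fun x => wt μ M (x - z) * q (x - z)) p p p ≤ ENNReal.ofReal (Real.exp (μ * |z|)) *
      N4 (fun x => q (x - z)) (fun x => wt μ M x * p x) (fun x => wt μ M x * p x)
        (fun x => wt μ M x * p x) := by
  refine N4_mono_of_weight ENNReal.ofReal_ne_top fun s x y => ?_
  have h1 := wt_sub_le (M := M) hμ x z
  have h2 : wt μ M x ≤ wt μ M (s - x) * wt μ M y * wt μ M (s - y) := by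
    refine wt_le_mul hμ hM ?_
    calc |x| = |y + (s - y) - (s - x)| := by ring_nf
      _ ≤ |y| + |s - y| + |s - x| := (abs_sub _ _).trans (by gcongr; exact abs_add_le _ _)
      _ = _ := by ring
  calc _ ≤ ENNReal.ofReal (Real.exp (μ * |z|)) * (wt μ M (s - x) * wt μ M y * wt μ M (s - y))
          * q (x - z) * p (s - x) * (p y * p (s - y)) := by
        gcongr
        exact h1.trans (by gcongr)
    _ = _ := by ring

/-- The estimate of `N4` when the first argument is far out, the others being split into an inner
and an outer part. -/
theorem N4_far_le {σ : ℝ} (hσ : 1 ≤ σ) {q h₁ h₂ : ℝ → ℝ≥0∞} (hq : Measurable q)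
    (mh₁ : Measurable h₁) (mh₂ : Measurable h₂) (sq : ∀ x, q x ≠ 0 → 3 * σ ≤ |x|)
    (sh₁ : ∀ x, h₁ x ≠ 0 → |x| < σ) :
    N4 q (fun x => h₁ x + h₂ x) (fun x => h₁ x + h₂ x) (fun x => h₁ x + h₂ x) ≤
      kapC * l2 q * (3 * ENNReal.ofReal (σ ^ (-(1 / 4) : ℝ)) * l2 h₁ ^ 2 * l2 h₂
        + 3 * l2 h₁ * l2 h₂ ^ 2 + l2 h₂ ^ 3) := by
  have sep : ∀ x y, q x ≠ 0 → h₁ y ≠ 0 → σ ≤ |y - x| := fun x y hx hy => by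
    have := sq x hx
    have := sh₁ y hy
    have := abs_sub_abs_le_abs_sub x y
    rw [abs_sub_comm]
    linarith
  have m12 : Measurable fun x => h₁ x + h₂ x := mh₁.add mh₂
  rw [N4_add₂ hq mh₁ m12 m12, N4_add₃ hq mh₁ mh₁ m12, N4_add₃ hq mh₂ mh₁ m12,
    N4_add₄ hq mh₁ mh₁ mh₁, N4_add₄ hq mh₁ mh₂ mh₁, N4_add₄ hq mh₂ mh₁ mh₁,
    N4_add₄ hq mh₂ mh₂ mh₁, N4_eq_zero sq sh₁ sh₁ sh₁]
  have e1 := N4_le_of_separated hσ hq mh₁ mh₁ mh₂ sep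
  have e2 := N4_le_of_separated hσ hq mh₁ mh₂ mh₁ sep
  have e3 := N4_le_of_separated' hσ hq mh₂ mh₁ mh₁ sep
  have e4 := N4_le hq mh₁ mh₂ mh₂
  have e5 := N4_le hq mh₂ mh₁ mh₂
  have e6 := N4_le hq mh₂ mh₂ mh₁
  have e7 := N4_le hq mh₂ mh₂ mh₂
  refine (add_le_add (add_le_add (add_le_add le_rfl e1) (add_le_add e2 e4))
    (add_le_add (add_le_add e3 e5) (add_le_add e6 e7))).trans_eq ?_
  ring

/-- The a priori inequality behind the bootstrap. It has no term of degree zero in the outer part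
apart from the one carrying the tail of ν, and its linear term carries the small factor σ^{-1/4}. -/
theorem l2_weight_tail_le {ν : Measure ℝ} {p : ℝ → ℝ≥0∞} (hp : Measurable p) (hp2 : l2 p ≠ ⊤)
    (H : ∀ φ : ℝ → ℝ≥0∞, Measurable φ → (∃ M : ℝ, ∀ x, φ x ≤ ENNReal.ofReal M) →
      ∫⁻ x, φ x * p x ^ 2 ≤ ∫⁻ z, N4 (fun x => φ (x - z) * p (x - z)) p p p ∂ν)
    {σ μ M : ℝ} (hσ : 1 ≤ σ) (hμ : 0 ≤ μ) (hM : 0 ≤ M) :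
    l2 ({x | 4 * σ ≤ |x|}.indicator fun x => wt μ M x * p x) ≤
      (∫⁻ z, ENNReal.ofReal (Real.exp (μ * |z|)) ∂ν) * kapC *
        (3 * ENNReal.ofReal (σ ^ (-(1 / 4) : ℝ)) *
            l2 ({x | |x| < σ}.indicator fun x => wt μ M x * p x) ^ 2 *
            l2 ({x | σ ≤ |x|}.indicator fun x => wt μ M x * p x)
          + 3 * l2 ({x | |x| < σ}.indicator fun x => wt μ M x * p x) *
            l2 ({x | σ ≤ |x|}.indicator fun x => wt μ M x * p x) ^ 2
          + l2 ({x | σ ≤ |x|}.indicator fun x => wt μ M x * p x) ^ 3)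
      + (∫⁻ z in {z | σ ≤ |z|}, ENNReal.ofReal (Real.exp (μ * |z|)) ∂ν) * kapC *
        (l2 ({x | |x| < σ}.indicator fun x => wt μ M x * p x) +
          l2 ({x | σ ≤ |x|}.indicator fun x => wt μ M x * p x)) ^ 3 := by
  set h : ℝ → ℝ≥0∞ := fun x => wt μ M x * p x with hh
  have mh : Measurable h := by fun_prop
  have mfar (r : ℝ) : MeasurableSet {x : ℝ | r ≤ |x|} := measurableSet_le (by fun_prop) (by fun_prop)
  have mnear : MeasurableSet {x : ℝ | |x| < σ} := measurableSet_lt (by fun_prop) (by fun_prop)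
  set hg := {x : ℝ | 4 * σ ≤ |x|}.indicator h with hhg
  set h₁ := {x : ℝ | |x| < σ}.indicator h with hh₁
  set h₂ := {x : ℝ | σ ≤ |x|}.indicator h with hh₂
  have mg : Measurable hg := mh.indicator (mfar _)
  have m₁ : Measurable h₁ := mh.indicator mnear
  have m₂ : Measurable h₂ := mh.indicator (mfar _)
  have hsum : h = fun x => h₁ x + h₂ x := by
    ext x
    by_cases hx : |x| < σ
    · simp [hh₁, hh₂, hx, not_le.2 hx]
    · simp [hh₁, hh₂, hx, not_lt.1 hx]
  set A := l2 hg
  set B := l2 h₁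
  set G := l2 h₂
  set R := ENNReal.ofReal (σ ^ (-(1 / 4) : ℝ))
  -- With the squared weight as test function the left side is A². In the form, one factor of the
  -- weight stays on the first argument and the other moves to the remaining three.
  set φ : ℝ → ℝ≥0∞ := {x : ℝ | 4 * σ ≤ |x|}.indicator fun x => wt μ M x ^ 2 with hφ
  have mφ : Measurable φ := Measurable.indicator (by fun_prop) (mfar _)
  have hA : A ≠ ⊤ := by
    have : A ≤ l2 fun x => ENNReal.ofReal (Real.exp M) * p x := l2_mono fun x => by
      refine (indicator_le_self _ _ x).trans ?_
      rw [hh]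
      exact mul_le_mul_left (wt_le_exp _ _ _) _
    rw [l2_const_mul hp] at this
    exact (this.trans_lt (ENNReal.mul_lt_top ENNReal.ofReal_lt_top hp2.lt_top)).ne
  have hz : ∀ z, N4 (fun x => φ (x - z) * p (x - z)) p p p ≤
      ENNReal.ofReal (Real.exp (μ * |z|)) * N4 (fun x => hg (x - z)) h h h := by
    intro z
    refine le_trans (le_of_eq ?_) (N4_weighted_le hμ hM p hg z)
    congr 1
    ext x
    by_cases hx : 4 * σ ≤ |x - z|
    · simp [hφ, hhg, hh, hx]; ring
    · simp [hφ, hhg, hx]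
  set X := kapC * A * (3 * R * B ^ 2 * G + 3 * B * G ^ 2 + G ^ 3) with hX
  set Y := kapC * A * (B + G) ^ 3 with hY
  have hN : ∀ z, N4 (fun x => hg (x - z)) h h h ≤ X + {z : ℝ | σ ≤ |z|}.indicator (fun _ => Y) z := by
    intro z
    have mgz : Measurable fun x => hg (x - z) := by fun_prop
    -- A shift shorter than σ keeps the first argument in |x| ≥ 3σ, as `N4_far_le` needs. Longer
    -- shifts get only the crude bound and are paid for by the tail of ν.
    by_cases hzσ : σ ≤ |z|
    · refine le_trans ?_ le_add_self
      rw [indicator_of_mem (show z ∈ {z : ℝ | σ ≤ |z|} from hzσ)]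
      refine (N4_le mgz mh mh mh).trans ?_
      have : l2 h ≤ B + G := by rw [hsum]; exact l2_add_le m₁ m₂
      rw [l2_comp_sub_right hg z]
      calc _ ≤ kapC * (A * (B + G) * (B + G) * (B + G)) := by gcongr
        _ = Y := by rw [hY]; ring
    · refine le_trans ?_ le_self_add
      rw [hsum]
      refine (N4_far_le hσ mgz m₁ m₂ ?_ ?_).trans_eq ?_
      · intro x hx
        have hx' : 4 * σ ≤ |x - z| := by
          by_contra hc
          simp [hhg, hc] at hx
        have := abs_sub x z
        linarith [not_le.1 hzσ]
      · intro x hx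
        by_contra hc
        simp [hh₁, hc] at hx
      · rw [l2_comp_sub_right hg z]
  have key : A * A ≤ A * ((∫⁻ z, ENNReal.ofReal (Real.exp (μ * |z|)) ∂ν) * kapC *
      (3 * R * B ^ 2 * G + 3 * B * G ^ 2 + G ^ 3) +
      (∫⁻ z in {z | σ ≤ |z|}, ENNReal.ofReal (Real.exp (μ * |z|)) ∂ν) * kapC * (B + G) ^ 3) := by
    calc A * A = ∫⁻ x, φ x * p x ^ 2 := by
          rw [← pow_two, l2_sq]
          refine lintegral_congr fun x => ?_
          by_cases hx : 4 * σ ≤ |x|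
          · simp [hφ, hhg, hh, hx]; ring
          · simp [hφ, hhg, hx]
      _ ≤ _ := H φ mφ ⟨Real.exp M ^ 2, fun x => by
          refine (indicator_le_self _ _ x).trans ?_
          rw [ENNReal.ofReal_pow (Real.exp_nonneg _)]
          gcongr
          exact wt_le_exp _ _ _⟩
      _ ≤ ∫⁻ z, (ENNReal.ofReal (Real.exp (μ * |z|)) * X + {z : ℝ | σ ≤ |z|}.indicator
            (fun z => ENNReal.ofReal (Real.exp (μ * |z|)) * Y) z) ∂ν := by
          refine lintegral_mono fun z => (hz z).trans ?_
          refine (mul_le_mul_right (hN z) _).trans_eq ?_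
          rw [mul_add]
          congr 1
          by_cases hzσ : σ ≤ |z| <;> simp [hzσ]
      _ = _ := by
          rw [lintegral_add_left (by fun_prop), lintegral_indicator (mfar _),
            lintegral_mul_const _ (by fun_prop), lintegral_mul_const _ (by fun_prop), hX, hY]
          ring
  -- The cap M makes A finite, so one factor A can be cancelled.
  rcases eq_or_ne A 0 with h0 | h0
  · rw [h0]; exact zero_le
  · exact (ENNReal.mul_le_mul_iff_right h0 hA).1 key

theorem exists_tail_le {ν : Measure ℝ} {g : ℝ → ℝ≥0∞} (hg : Measurable g)
    (hfin : ∫⁻ x, g x ∂ν ≠ ⊤) :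
    Tendsto (fun σ : ℝ => ∫⁻ x in {x | σ ≤ |x|}, g x ∂ν) atTop (𝓝 0) := by
  have mfar (r : ℝ) : MeasurableSet {x : ℝ | r ≤ |x|} := measurableSet_le (by fun_prop) (by fun_prop)
  have := tendsto_lintegral_filter_of_dominated_convergence (μ := ν) (l := atTop)
    (F := fun (σ : ℝ) x => {x : ℝ | σ ≤ |x|}.indicator g x) (f := fun _ => 0) g
    (Eventually.of_forall fun σ => hg.indicator (mfar σ))
    (Eventually.of_forall fun σ => Eventually.of_forall fun x => indicator_le_self _ _ x) hfin
    (Eventually.of_forall fun x => tendsto_const_nhds.congr' (by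
      filter_upwards [eventually_gt_atTop |x|] with σ hσ
      simp [hσ]))
  simpa [lintegral_indicator (mfar _)] using this

/-- The left side is quadratic and cubic in a, hence below a/3 for small a. The argument 3a is the
bound for the part outside σ in the bootstrap. -/
theorem exists_small_parameter {K β : ℝ≥0∞} (hK : K ≠ ⊤) (hβ : β ≠ ⊤) :
    ∃ a : ℝ≥0∞, 0 < a ∧ a ≠ ⊤ ∧ K * (3 * β * (3 * a) ^ 2 + (3 * a) ^ 3) ≤ a / 3 := by
  lift K to NNReal using hK
  lift β to NNReal using hβ
  have hc : Tendsto (fun a : ℝ => (K : ℝ) * (27 * β * a + 27 * a ^ 2)) (𝓝[>] 0) (𝓝 0) := by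
    have : Continuous fun a : ℝ => (K : ℝ) * (27 * β * a + 27 * a ^ 2) := by fun_prop
    simpa using (this.tendsto 0).mono_left nhdsWithin_le_nhds
  obtain ⟨a, ha, ha0⟩ := ((hc.eventually (gt_mem_nhds (show (0 : ℝ) < 1 / 3 by norm_num))).and
    self_mem_nhdsWithin).exists
  replace ha0 : 0 < a := ha0
  lift a to NNReal using ha0.le
  refine ⟨a, by exact_mod_cast ha0, ENNReal.coe_ne_top, ?_⟩
  rw [show (3 : ℝ≥0∞) = ((3 : NNReal) : ℝ≥0∞) by norm_cast, ← ENNReal.coe_div (by norm_num)]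
  norm_cast
  rw [← NNReal.coe_le_coe]
  push_cast
  nlinarith

/-- Exponential decay in the mean for subsolutions of the cubic inequality with form `N4`. -/
theorem exp_decay {ν : Measure ℝ} {p : ℝ → ℝ≥0∞} (hp : Measurable p) (hp2 : l2 p ≠ ⊤)
    {μ₀ : ℝ} (hμ₀ : 0 < μ₀) (hν : ∫⁻ z, ENNReal.ofReal (Real.exp (μ₀ * |z|)) ∂ν ≠ ⊤)
    (H : ∀ φ : ℝ → ℝ≥0∞, Measurable φ → (∃ M : ℝ, ∀ x, φ x ≤ ENNReal.ofReal M) →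
      ∫⁻ x, φ x * p x ^ 2 ≤ ∫⁻ z, N4 (fun x => φ (x - z) * p (x - z)) p p p ∂ν) :
    ∃ μ > 0, ∫⁻ x, ENNReal.ofReal (Real.exp (μ * |x|)) ^ 2 * p x ^ 2 ≠ ⊤ := by
  have mfar (r : ℝ) : MeasurableSet {x : ℝ | r ≤ |x|} := measurableSet_le (by fun_prop) (by fun_prop)
  have mnear (r : ℝ) : MeasurableSet {x : ℝ | |x| < r} :=
    measurableSet_lt (by fun_prop) (by fun_prop)
  set V := ∫⁻ z, ENNReal.ofReal (Real.exp (μ₀ * |z|)) ∂ν with hV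
  set e₁ : ℝ≥0∞ := ENNReal.ofReal (Real.exp 1) with he₁
  have he₁t : e₁ ≠ ⊤ := ENNReal.ofReal_ne_top
  set β := e₁ * l2 p with hβ
  have hβt : β ≠ ⊤ := ENNReal.mul_ne_top he₁t hp2
  have hKt : V * kapC ≠ ⊤ := ENNReal.mul_ne_top hν kapC_ne_top
  -- The threshold a depends only on the norm of p and the total weighted mass of ν. It is fixed
  -- before σ, so σ can still be taken large depending on it.
  obtain ⟨a, ha0, hat, ha⟩ := exists_small_parameter hKt hβt
  have ha3 : 0 < a / 3 := ENNReal.div_pos ha0.ne' (by norm_num)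
  have lim1 : Tendsto (fun σ : ℝ => V * kapC * (3 * ENNReal.ofReal (σ ^ (-(1 / 4) : ℝ)) * β ^ 2 *
      (3 * a))) atTop (𝓝 0) := by
    have h1 : Tendsto (fun σ : ℝ => ENNReal.ofReal (σ ^ (-(1 / 4) : ℝ))) atTop (𝓝 0) := by
      simpa using ENNReal.tendsto_ofReal (tendsto_rpow_neg_atTop (show (0 : ℝ) < 1 / 4 by norm_num))
    have h2 := ENNReal.Tendsto.const_mul h1 (a := V * kapC * 3 * β ^ 2 * (3 * a))
      (Or.inr (by finiteness))
    rw [mul_zero] at h2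
    refine h2.congr fun σ => by ring
  have lim2 : Tendsto (fun σ : ℝ => (∫⁻ z in {z | σ ≤ |z|}, ENNReal.ofReal (Real.exp (μ₀ * |z|)) ∂ν)
      * kapC * (β + 3 * a) ^ 3) atTop (𝓝 0) := by
    have h2 := ENNReal.Tendsto.mul_const (exists_tail_le (ν := ν) (by fun_prop) hν)
      (b := kapC * (β + 3 * a) ^ 3) (Or.inr (ENNReal.mul_ne_top kapC_ne_top (by finiteness)))
    rw [zero_mul] at h2
    refine h2.congr fun σ => by ring
  have hpt : ∫⁻ x, p x ^ (2 : ℝ) ≠ ⊤ := fun h => hp2 (by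
    unfold l2
    rw [h, ENNReal.top_rpow_of_pos (by norm_num)])
  have lim3 : Tendsto (fun σ : ℝ => e₁ * l2 ({x | σ ≤ |x|}.indicator p)) atTop (𝓝 0) := by
    have h1 := exists_tail_le (ν := volume) (by fun_prop) hpt
    have h2 := ((ENNReal.continuous_rpow_const (y := (1 / 2 : ℝ))).tendsto 0).comp h1
    have h3 := ENNReal.Tendsto.const_mul h2 (a := e₁) (Or.inr he₁t)
    rw [ENNReal.zero_rpow_of_pos (by norm_num), mul_zero] at h3
    refine h3.congr fun σ => ?_
    simp only [Function.comp, l2]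
    congr 2
    rw [← lintegral_indicator (mfar σ)]
    refine lintegral_congr fun x => ?_
    by_cases hx : σ ≤ |x| <;> simp [hx]
  -- The linear term and the ν-tail term each fall below a/3, and e times the norm of p outside σ
  -- falls below a. The last condition on σ ensures μ = 1/(4σ) ≤ μ₀.
  obtain ⟨σ, h1, h2, h3, hσ1, hσμ⟩ := ((lim1.eventually (gt_mem_nhds ha3)).and
    ((lim2.eventually (gt_mem_nhds ha3)).and ((lim3.eventually (gt_mem_nhds ha0)).and
    ((eventually_ge_atTop (1 : ℝ)).and (eventually_ge_atTop (1 / (4 * μ₀))))))).exists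
  have hσ0 : 0 < σ := by linarith
  -- This rate keeps the weight at most e on |x| ≤ 4σ for every cap M, so the near part and the
  -- shell σ ≤ |x| < 4σ are bounded uniformly in M.
  set μ := 1 / (4 * σ) with hμ
  have hμ0 : 0 < μ := by positivity
  have hμμ₀ : μ ≤ μ₀ := by
    rw [hμ, div_le_iff₀ (by positivity)]
    rw [div_le_iff₀ (by positivity)] at hσμ
    linarith
  have hwt : ∀ M x, |x| ≤ 4 * σ → wt μ M x ≤ e₁ := fun M x hx => by
    refine (wt_le_exp_mul M hμ0.le hx).trans_eq ?_
    rw [hμ, div_mul_cancel₀ _ (by positivity)]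
  have htail : ∀ M, l2 ({x | σ ≤ |x|}.indicator fun x => wt μ M x * p x) ≤
      a + l2 ({x | 4 * σ ≤ |x|}.indicator fun x => wt μ M x * p x) := by
    intro M
    calc _ ≤ l2 (fun x => e₁ * {x | σ ≤ |x|}.indicator p x
          + {x | 4 * σ ≤ |x|}.indicator (fun x => wt μ M x * p x) x) := by
          refine l2_mono fun x => ?_
          by_cases hx : σ ≤ |x|
          · by_cases hx' : 4 * σ ≤ |x|
            · simp [hx, hx']
            · simp only [mem_ofPred_eq, hx, indicator_of_mem, hx', not_false_eq_true,
                indicator_of_notMem, add_zero]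
              gcongr
              exact hwt M x (not_le.1 hx').le
          · simp [hx]
      _ ≤ _ := l2_add_le ((hp.indicator (mfar _)).const_mul _)
          (Measurable.indicator (by fun_prop) (mfar _))
      _ ≤ _ := by
          gcongr
          rw [l2_const_mul (hp.indicator (mfar _))]
          exact h3.le
  have hnear : ∀ M, l2 ({x | |x| < σ}.indicator fun x => wt μ M x * p x) ≤ β := by
    intro M
    rw [hβ, ← l2_const_mul hp]
    refine l2_mono fun x => ?_
    by_cases hx : |x| < σ
    · simp only [mem_ofPred_eq, hx, indicator_of_mem]
      gcongr
      exact hwt M x (by linarith)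
    · simp [hx]
  have hexp : ∀ z, ENNReal.ofReal (Real.exp (μ * |z|)) ≤ ENNReal.ofReal (Real.exp (μ₀ * |z|)) :=
    fun z => by gcongr
  have step : ∀ M, 0 ≤ M → l2 ({x | 4 * σ ≤ |x|}.indicator fun x => wt μ M x * p x) ≤ 2 * a →
      l2 ({x | 4 * σ ≤ |x|}.indicator fun x => wt μ M x * p x) ≤ a := by
    intro M hM hA
    have hG : l2 ({x | σ ≤ |x|}.indicator fun x => wt μ M x * p x) ≤ 3 * a :=
      (htail M).trans ((add_le_add le_rfl hA).trans_eq (by ring))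
    have hB := hnear M
    refine (l2_weight_tail_le hp hp2 H hσ1 hμ0.le hM).trans ?_
    calc _ ≤ V * kapC * (3 * ENNReal.ofReal (σ ^ (-(1 / 4) : ℝ)) * β ^ 2 * (3 * a)
          + 3 * β * (3 * a) ^ 2 + (3 * a) ^ 3)
          + (∫⁻ z in {z | σ ≤ |z|}, ENNReal.ofReal (Real.exp (μ₀ * |z|)) ∂ν) * kapC *
          (β + 3 * a) ^ 3 := by
          gcongr
          · exact lintegral_mono hexp
      _ = V * kapC * (3 * ENNReal.ofReal (σ ^ (-(1 / 4) : ℝ)) * β ^ 2 * (3 * a))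
          + V * kapC * (3 * β * (3 * a) ^ 2 + (3 * a) ^ 3)
          + (∫⁻ z in {z | σ ≤ |z|}, ENNReal.ofReal (Real.exp (μ₀ * |z|)) ∂ν) * kapC *
          (β + 3 * a) ^ 3 := by ring
      _ ≤ a / 3 + a / 3 + a / 3 := by gcongr
      _ = a := ENNReal.add_thirds a
  -- A discrete continuity argument in the cap: raising M by log 2 at most doubles the weight, so
  -- the bound a gives 2a at the next cap, which `step` improves to a again.
  have all : ∀ n : ℕ, l2 ({x | 4 * σ ≤ |x|}.indicator fun x => wt μ (n * Real.log 2) x * p x) ≤ a := by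
    intro n
    have hlog : 0 ≤ Real.log 2 := Real.log_nonneg one_le_two
    refine step _ (by positivity) ?_
    induction n with
    | zero =>
      refine le_trans (l2_mono fun x => ?_) ((le_of_eq (l2_const_mul
        (hp.indicator (mfar σ)) e₁)).trans (h3.le.trans (le_mul_of_one_le_left zero_le one_le_two)))
      by_cases hx : 4 * σ ≤ |x|
      · have hx' : σ ≤ |x| := by linarith
        simp only [mem_ofPred_eq, hx, indicator_of_mem, hx']
        gcongr
        refine (wt_le_exp _ _ _).trans (ENNReal.ofReal_le_ofReal (Real.exp_le_exp.2 (by simp)))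
      · simp [hx]
    | succ n ih =>
      have := step _ (by positivity) ih
      refine le_trans (l2_mono fun x => ?_) ((le_of_eq (l2_const_mul
        (Measurable.indicator (by fun_prop) (mfar (4 * σ))) 2)).trans (mul_le_mul_right this 2))
      by_cases hx : 4 * σ ≤ |x|
      · simp only [mem_ofPred_eq, hx, indicator_of_mem]
        rw [← mul_assoc]
        gcongr
        unfold wt
        rw [show (2 : ℝ≥0∞) = ENNReal.ofReal (Real.exp (Real.log 2)) by
          rw [Real.exp_log two_pos]; simp, ← ENNReal.ofReal_mul (Real.exp_nonneg _),
          ← Real.exp_add]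
        refine ENNReal.ofReal_le_ofReal (Real.exp_le_exp.2 ?_)
        push_cast
        rcases min_cases (μ * |x|) (n * Real.log 2) with h | h <;>
          rcases min_cases (μ * |x|) ((n + 1) * Real.log 2) with h' | h' <;> linarith
      · simp [hx]
  refine ⟨μ, hμ0, ?_⟩
  -- At each point the cap is eventually inactive, so Fatou's lemma transfers the uniform bound to
  -- the full weight.
  have hfat : ∫⁻ x, {x | 4 * σ ≤ |x|}.indicator
      (fun x => ENNReal.ofReal (Real.exp (μ * |x|)) ^ 2 * p x ^ 2) x ≤ a ^ 2 := by
    have hconv : ∀ x, {x | 4 * σ ≤ |x|}.indicator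
        (fun x => ENNReal.ofReal (Real.exp (μ * |x|)) ^ 2 * p x ^ 2) x ≤ liminf (fun n : ℕ =>
        ({x | 4 * σ ≤ |x|}.indicator (fun x => wt μ (n * Real.log 2) x * p x) x) ^ 2) atTop := by
      intro x
      refine le_liminf_of_le (by isBoundedDefault) ?_
      obtain ⟨N, hN⟩ := exists_nat_ge (μ * |x| / Real.log 2)
      filter_upwards [eventually_ge_atTop N] with n hn
      by_cases hx : 4 * σ ≤ |x|
      · simp only [mem_ofPred_eq, hx, indicator_of_mem, mul_pow]
        unfold wt
        rw [min_eq_left]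
        rw [← div_le_iff₀ (Real.log_pos one_lt_two)]
        exact hN.trans (by exact_mod_cast hn)
      · simp [hx]
    refine (lintegral_mono hconv).trans ((lintegral_liminf_le fun n => ?_).trans ?_)
    · exact (Measurable.indicator (by fun_prop) (mfar _)).pow_const 2
    · refine liminf_le_of_le (by isBoundedDefault) fun b hb => ?_
      obtain ⟨n, hn⟩ := hb.exists
      refine hn.trans ?_
      rw [← l2_sq]
      exact pow_le_pow_left' (all n) 2
  have hsplit : ∀ x, ENNReal.ofReal (Real.exp (μ * |x|)) ^ 2 * p x ^ 2 ≤ e₁ ^ 2 * p x ^ 2 +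
      {x | 4 * σ ≤ |x|}.indicator
      (fun x => ENNReal.ofReal (Real.exp (μ * |x|)) ^ 2 * p x ^ 2) x := by
    intro x
    by_cases hx : 4 * σ ≤ |x|
    · simp only [mem_ofPred_eq, hx, indicator_of_mem]
      exact le_add_self
    · refine le_trans ?_ le_self_add
      gcongr
      refine ENNReal.ofReal_le_ofReal (Real.exp_le_exp.2 ?_)
      rw [hμ, div_mul_eq_mul_div, one_mul, div_le_one (by positivity)]
      exact (not_le.1 hx).le
  refine ((lintegral_mono hsplit).trans_lt ?_).ne
  rw [lintegral_add_left (by fun_prop), lintegral_const_mul _ (by fun_prop), ← l2_sq]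
  exact ENNReal.add_lt_top.2 ⟨by finiteness, hfat.trans_lt (by finiteness)⟩

end DispersionManagement

/-! ### Weak derivatives and absolutely continuous representatives of the profile. -/

namespace DispersionManagement

open Filter Topology

/-- A smooth function on the line with compact support in `(a, b)` and integral zero is the
derivative of such a function. -/
theorem exists_primitive_of_integral_eq_zero {a b : ℝ} (hab : a < b) {θ : ℝ → ℝ}
    (hθ : ContDiff ℝ (⊤ : ℕ∞) θ) (hc : HasCompactSupport θ) (hs : tsupport θ ⊆ Ioo a b)
    (h0 : ∫ x, θ x = 0) :
    ∃ φ : ℝ → ℝ, ContDiff ℝ (⊤ : ℕ∞) φ ∧ HasCompactSupport φ ∧ tsupport φ ⊆ Ioo a b ∧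
      deriv φ = θ := by
  obtain ⟨a', b', ha', hb', hsub⟩ : ∃ a' b', a < a' ∧ b' < b ∧ tsupport θ ⊆ Icc a' b' := by
    rcases (tsupport θ).eq_empty_or_nonempty with h | h
    -- For empty support the endpoints are reversed on purpose: the inequalities hold and the
    -- interval [b, a] is harmless.
    · exact ⟨b, a, hab, hab, by simp [h]⟩
    · refine ⟨sInf (tsupport θ), sSup (tsupport θ), (hs (hc.isCompact.sInf_mem h)).1,
        (hs (hc.isCompact.sSup_mem h)).2, fun x hx => ⟨csInf_le hc.isCompact.bddBelow hx,
        le_csSup hc.isCompact.bddAbove hx⟩⟩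
  have hz : ∀ x, x ∉ Icc a' b' → θ x = 0 := fun x hx =>
    image_eq_zero_of_notMem_tsupport fun h => hx (hsub h)
  have hθc := hθ.continuous
  have hd : ∀ x, HasDerivAt (fun x => ∫ t in a..x, θ t) (θ x) x := fun x =>
    intervalIntegral.integral_hasDerivAt_right (hθc.intervalIntegrable _ _)
      hθc.stronglyMeasurable.stronglyMeasurableAtFilter hθc.continuousAt
  have hde : deriv (fun x => ∫ t in a..x, θ t) = θ := funext fun x => (hd x).deriv
  have hsupp : Function.support (fun x => ∫ t in a..x, θ t) ⊆ Icc a' b' := by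
    intro x hx
    by_contra hx'
    apply hx
    rcases lt_or_ge x a' with h | h
    · refine intervalIntegral.integral_zero_ae (Eventually.of_forall fun t ht => hz t fun h' => ?_)
      have := (mem_uIoc.1 ht)
      rcases this with h1 | h1
      · linarith [h'.1, h1.2]
      · linarith [h'.1, h1.2]
    · have hx2 : b' < x := by
        by_contra h2
        exact hx' ⟨h, not_lt.1 h2⟩
      rw [← h0]
      by_cases hax : a ≤ x
      · change ∫ t in a..x, θ t = ∫ x, θ x
        rw [intervalIntegral.integral_of_le hax]
        refine setIntegral_eq_integral_of_forall_compl_eq_zero fun t ht => hz t fun h' => ht ?_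
        exact ⟨ha'.trans_le h'.1, h'.2.trans hx2.le⟩
      · exact absurd (ha'.trans_le h) (not_lt.2 (not_le.1 hax).le)
  have hts : tsupport (fun x => ∫ t in a..x, θ t) ⊆ Icc a' b' :=
    closure_minimal hsupp isClosed_Icc
  refine ⟨_, ?_, HasCompactSupport.of_support_subset_isCompact isCompact_Icc hsupp,
    hts.trans fun x hx => ⟨ha'.trans_le hx.1, hx.2.trans_lt hb'⟩, hde⟩
  rw [contDiff_infty_iff_deriv]
  exact ⟨fun x => (hd x).differentiableAt, by rw [hde]; exact hθ⟩

/-- The du Bois-Reymond lemma. -/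
theorem ae_eq_const_of_integral_mul_deriv_eq_zero {a b : ℝ} (hab : a < b) {w : ℝ → ℝ}
    (hw : IntegrableOn w (Ioo a b))
    (h : ∀ φ : ℝ → ℝ, ContDiff ℝ (⊤ : ℕ∞) φ → HasCompactSupport φ → tsupport φ ⊆ Ioo a b →
      ∫ x in Ioo a b, w x * deriv φ x = 0) :
    ∃ c : ℝ, ∀ᵐ x, x ∈ Ioo a b → w x = c := by
  let f : ContDiffBump ((a + b) / 2) := ⟨(b - a) / 8, (b - a) / 4, by linarith, by linarith⟩
  set ψ₀ := f.normed volume with hψ₀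
  have sm₀ : ContDiff ℝ (⊤ : ℕ∞) ψ₀ := f.contDiff_normed
  have cs₀ : HasCompactSupport ψ₀ := f.hasCompactSupport_normed
  have ts₀ : tsupport ψ₀ ⊆ Ioo a b := by
    rw [hψ₀, f.tsupport_normed_eq, Real.closedBall_eq_Icc]
    intro x hx
    simp only [f, mem_Icc] at hx
    constructor <;> linarith [hx.1, hx.2]
  have int₀ : ∫ x, ψ₀ x = 1 := f.integral_normed
  have hint : ∀ ψ : ℝ → ℝ, Continuous ψ → HasCompactSupport ψ →
      IntegrableOn (fun x => w x * ψ x) (Ioo a b) := by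
    intro ψ h1 h2
    obtain ⟨C, hC⟩ := h1.bounded_above_of_compact_support h2
    exact hw.mul_bdd h1.aestronglyMeasurable (Eventually.of_forall hC)
  refine ⟨∫ x in Ioo a b, w x * ψ₀ x, ?_⟩
  set c := ∫ x in Ioo a b, w x * ψ₀ x with hc
  have := isOpen_Ioo.ae_eq_zero_of_integral_contDiff_smul_eq_zero (μ := volume)
    (U := Ioo a b) (f := fun x => w x - c) ?_ ?_
  · filter_upwards [this] with x hx hx'
    exact sub_eq_zero.1 (hx hx')
  · exact (hw.sub (integrableOn_const (by simp))).locallyIntegrableOn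
  · intro ψ hψ hψc hψs
    set A := ∫ x, ψ x with hA
    have ψi : Integrable ψ := hψ.continuous.integrable_of_hasCompactSupport hψc
    have ψ₀i : Integrable ψ₀ := sm₀.continuous.integrable_of_hasCompactSupport cs₀
    -- Subtracting A times the normalized bump makes the mean zero, so the difference is an
    -- admissible φ'.
    obtain ⟨φ, h1, h2, h3, h4⟩ := exists_primitive_of_integral_eq_zero hab
      (θ := fun x => ψ x - A * ψ₀ x) (hψ.sub (contDiff_const.mul sm₀))
      (hψc.sub cs₀.mul_left)
      ((tsupport_sub _ _).trans (union_subset hψs ((tsupport_mul_subset_right).trans ts₀))) (by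
        rw [integral_sub ψi (ψ₀i.const_mul A), integral_const_mul, int₀, ← hA]; ring)
    have key := h φ h1 h2 h3
    rw [h4] at key
    have e1 : ∫ x in Ioo a b, w x * (ψ x - A * ψ₀ x) = (∫ x in Ioo a b, w x * ψ x) - A * c := by
      rw [hc, ← integral_const_mul, ← integral_sub (hint ψ hψ.continuous hψc)
        ((hint ψ₀ sm₀.continuous cs₀).const_mul A)]
      congr 1
      ext x
      ring
    have e2 : ∫ x, ψ x • (w x - c) = ∫ x in Ioo a b, ψ x • (w x - c) := by
      refine (setIntegral_eq_integral_of_forall_compl_eq_zero fun x hx => ?_).symm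
      rw [image_eq_zero_of_notMem_tsupport fun h => hx (hψs h), zero_smul]
    have e3 : ∫ x in Ioo a b, ψ x = A :=
      setIntegral_eq_integral_of_forall_compl_eq_zero fun x hx =>
        image_eq_zero_of_notMem_tsupport fun h => hx (hψs h)
    rw [e2]
    calc ∫ x in Ioo a b, ψ x • (w x - c) = ∫ x in Ioo a b, (w x * ψ x - c * ψ x) := by
          congr 1; ext x; rw [smul_eq_mul]; ring
      _ = (∫ x in Ioo a b, w x * ψ x) - c * A := by
          rw [integral_sub (hint ψ hψ.continuous hψc) (ψi.integrableOn.const_mul c),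
            integral_const_mul, e3]
      _ = 0 := by rw [← key, e1]; ring

/-- The primitive of v has v as weak derivative, by integration by parts for absolutely continuous
functions. So u minus this primitive has vanishing weak derivative and is constant almost
everywhere. -/
theorem IsW11On.exists_primitive {a b : ℝ} (hab : a < b) {u : ℝ → ℝ} (hu : IsW11On a b u) :
    ∃ (v : ℝ → ℝ) (c : ℝ), IntervalIntegrable v volume a b ∧
      ∀ᵐ x, x ∈ Ioo a b → u x = c + ∫ t in a..x, v t := by
  obtain ⟨hui, v, hv, h⟩ := hu
  have hvi : IntervalIntegrable v volume a b :=
    (intervalIntegrable_iff_integrableOn_Ioo_of_le hab.le).2 hv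
  have hac := hvi.absolutelyContinuousOnInterval_intervalIntegral (c := a) left_mem_uIcc
  have hVc : ContinuousOn (fun x => ∫ t in a..x, v t) (Icc a b) := by
    simpa [uIcc_of_le hab.le] using hac.continuousOn
  have hVi : IntegrableOn (fun x => ∫ t in a..x, v t) (Ioo a b) :=
    (hVc.integrableOn_Icc).mono_set Ioo_subset_Icc_self
  obtain ⟨c, hc⟩ := ae_eq_const_of_integral_mul_deriv_eq_zero hab
    (w := fun x => u x - ∫ t in a..x, v t) (hui.sub hVi) (by
      intro φ h1 h2 h3
      have hφ : ContDiff ℝ 1 φ := h1.of_le (by exact_mod_cast le_top)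
      have hφac : AbsolutelyContinuousOnInterval φ a b :=
        hφ.contDiffOn.absolutelyContinuousOnInterval
      have hdc : Continuous (deriv φ) := hφ.continuous_deriv_one
      obtain ⟨C, hC⟩ := hdc.bounded_above_of_compact_support h2.deriv
      have i1 : IntegrableOn (fun x => u x * deriv φ x) (Ioo a b) :=
        hui.mul_bdd hdc.aestronglyMeasurable (Eventually.of_forall hC)
      have i2 : IntegrableOn (fun x => (∫ t in a..x, v t) * deriv φ x) (Ioo a b) :=
        hVi.mul_bdd hdc.aestronglyMeasurable (Eventually.of_forall hC)
      have ibp := hac.integral_mul_deriv_eq_deriv_mul hφac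
      have z : ∀ x, x ∉ Ioo a b → φ x = 0 := fun x hx =>
        image_eq_zero_of_notMem_tsupport fun h => hx (h3 h)
      rw [z a (by simp), z b (by simp), mul_zero, mul_zero, sub_zero, zero_sub,
        intervalIntegral.integral_of_le hab.le, integral_Ioc_eq_integral_Ioo] at ibp
      have e : ∫ x in a..b, deriv (fun x => ∫ t in a..x, v t) x * φ x
          = ∫ x in Ioo a b, v x * φ x := by
        rw [← integral_Ioc_eq_integral_Ioo, ← intervalIntegral.integral_of_le hab.le]
        refine intervalIntegral.integral_congr_ae ?_
        filter_upwards [hvi.ae_hasDerivAt_integral] with x hx hx'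
        rw [(hx (uIoc_subset_uIcc hx') a left_mem_uIcc).deriv]
      simp_rw [sub_mul]
      rw [integral_sub i1 i2, h φ h1 h2 h3, ibp, e]
      ring)
  refine ⟨v, c, hvi, ?_⟩
  filter_upwards [hc] with x hx hx'
  linarith [hx hx']

/-- On each piece the dispersion profile has an absolutely continuous representative, bounded
away from zero. -/
theorem exists_representative {a b L : ℝ} (hab : a < b) (ha : 0 ≤ a) (hb : b ≤ L) {d₀ : ℝ → ℝ}
    (hd : IsW11On a b d₀) (hd' : IsBoundedAwayFromZero L d₀) :
    ∃ (δ : ℝ → ℝ) (m : ℝ), 0 < m ∧ AbsolutelyContinuousOnInterval δ a b ∧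
      (∀ᵐ x, x ∈ Ioo a b → d₀ x = δ x) ∧ ∀ x ∈ Icc a b, m ≤ |δ x| := by
  obtain ⟨v, c, hv, h⟩ := hd.exists_primitive hab
  have hac : AbsolutelyContinuousOnInterval (fun x => c + ∫ t in a..x, v t) a b :=
    AbsolutelyContinuousOnInterval.add
      (contDiff_const.contDiffOn.absolutelyContinuousOnInterval)
      (hv.absolutelyContinuousOnInterval_intervalIntegral (c := a) left_mem_uIcc)
  set δ : ℝ → ℝ := fun x => c + ∫ t in a..x, v t with hδ
  obtain ⟨m, hm0, hm⟩ : ∃ m : ℝ, 0 < m ∧ ∀ᵐ x, x ∈ Icc 0 L → m ≤ |d₀ x| := by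
    obtain ⟨r, hr0, hr⟩ := exists_between hd'
    have hrt : r ≠ ⊤ := (hr.trans_le le_top).ne
    refine ⟨r.toReal, ENNReal.toReal_pos hr0.ne' hrt, ?_⟩
    rw [← ae_restrict_iff' measurableSet_Icc]
    filter_upwards [ae_lt_of_lt_essInf hr] with x hx
    have := ENNReal.toReal_mono ENNReal.ofReal_ne_top hx.le
    rwa [ENNReal.toReal_ofReal (abs_nonneg _)] at this
  refine ⟨δ, m, hm0, hac, h, ?_⟩
  have hcont : ContinuousOn (fun x => |δ x|) (Icc a b) := by
    have := hac.continuousOn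
    rw [uIcc_of_le hab.le] at this
    exact this.abs
  -- If |δ| < m at one point of the closed interval, continuity extends this to a nonempty open
  -- subset of (a, b), which has positive measure, contrary to the almost everywhere bound on d₀.
  by_contra! hcon
  obtain ⟨x, hx, hxm⟩ := hcon
  have hev := (hcont x hx).eventually (gt_mem_nhds hxm)
  have hxcl : x ∈ closure (Ioo a b) := by rwa [closure_Ioo hab.ne]
  have hev2 : ∀ᶠ y in 𝓝[Icc a b] x, |δ y| < m := hev
  rw [eventually_nhdsWithin_iff, eventually_nhds_iff] at hev2
  obtain ⟨U, hU, hUo, hxU⟩ := hev2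
  have hne : (U ∩ Ioo a b).Nonempty := mem_closure_iff.1 hxcl U hUo hxU
  have hpos : 0 < volume (U ∩ Ioo a b) := (hUo.inter isOpen_Ioo).measure_pos volume hne
  have hnull : volume (U ∩ Ioo a b) = 0 := by
    refine measure_mono_null ?_ (ae_iff.1 (h.and hm))
    intro y hy hcontra
    have h1 := hcontra.1 hy.2
    have h2 := hcontra.2 ⟨ha.trans hy.2.1.le, hy.2.2.le.trans hb⟩
    have h3 := hU y hy.1 ⟨hy.2.1.le, hy.2.2.le⟩
    rw [h1] at h2
    linarith
  exact hpos.ne' hnull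

end DispersionManagement

/-! ### Integrals along the accumulated dispersion. -/

namespace DispersionManagement

open Filter Topology

theorem absolutelyContinuousOnInterval_inv {a b m : ℝ} (hm : 0 < m) {δ : ℝ → ℝ}
    (hδ : AbsolutelyContinuousOnInterval δ a b) (h : ∀ x ∈ uIcc a b, m ≤ |δ x|) :
    AbsolutelyContinuousOnInterval (fun x => (δ x)⁻¹) a b := by
  rw [absolutelyContinuousOnInterval_iff] at hδ ⊢
  intro ε hε
  obtain ⟨r, hr, H⟩ := hδ (ε * m ^ 2) (by positivity)
  refine ⟨r, hr, fun E hE hEr => ?_⟩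
  have := H E hE hEr
  rw [← div_lt_iff₀ (by positivity), Finset.sum_div] at this
  refine lt_of_le_of_lt (Finset.sum_le_sum fun i hi => ?_) this
  have h1 := h _ (hE.left i hi).left
  have h2 := h _ (hE.left i hi).right
  have h10 : δ (E.2 i).1 ≠ 0 := abs_pos.1 (hm.trans_le h1)
  have h20 : δ (E.2 i).2 ≠ 0 := abs_pos.1 (hm.trans_le h2)
  rw [Real.dist_eq, Real.dist_eq, inv_sub_inv h10 h20, abs_div, abs_mul, abs_sub_comm]
  gcongr
  rw [pow_two]
  gcongr

/-- Since D' = δ, one has h(D(s)) = (1/δ(s)) · d/ds ∫ h over [D(a), D(s)]. Integration by parts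
moves the derivative onto 1/δ, which is absolutely continuous because |δ| ≥ m. The constant is the
boundary value of 1/δ plus its total variation, so it is independent of h. -/
theorem exists_norm_integral_comp_le_real {a b m : ℝ} (hab : a < b) (hm : 0 < m) {δ D : ℝ → ℝ}
    (hδ : AbsolutelyContinuousOnInterval δ a b) (hδm : ∀ x ∈ Icc a b, m ≤ |δ x|)
    (hD : ∀ s ∈ Icc a b, D s = D a + ∫ t in a..s, δ t) :
    ∃ C : ℝ, 0 ≤ C ∧ ∀ (h : ℝ → ℝ) (B : ℝ), Continuous h →
      (∀ s ∈ Icc a b, |∫ r in D a..D s, h r| ≤ B) → |∫ s in a..b, h (D s)| ≤ C * B := by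
  have hu : uIcc a b = Icc a b := uIcc_of_le hab.le
  have hρ := absolutelyContinuousOnInterval_inv hm hδ (by rwa [hu])
  have hδc : ContinuousOn δ (Icc a b) := hu ▸ hδ.continuousOn
  have hδi : IntervalIntegrable δ volume a b := (hu ▸ hδc : ContinuousOn δ (uIcc a b)).intervalIntegrable
  have hDac : AbsolutelyContinuousOnInterval (fun s => ∫ t in a..s, δ t) a b :=
    hδi.absolutelyContinuousOnInterval_intervalIntegral left_mem_uIcc
  have hDc : ContinuousOn D (Icc a b) := by
    refine ContinuousOn.congr (f := fun s => D a + ∫ t in a..s, δ t) ?_ hD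
    exact continuousOn_const.add (hu ▸ hDac.continuousOn)
  refine ⟨|(δ b)⁻¹| + ∫ x in a..b, |deriv (fun x => (δ x)⁻¹) x|, add_nonneg (abs_nonneg _)
    (intervalIntegral.integral_nonneg hab.le fun _ _ => abs_nonneg _), fun h B hh hB => ?_⟩
  have hg : ContinuousOn (fun s => h (D s) * δ s) (uIcc a b) := by
    rw [hu]; exact (hh.comp_continuousOn hDc).mul hδc
  have hgi : IntervalIntegrable (fun s => h (D s) * δ s) volume a b := hg.intervalIntegrable
  have hE := hgi.absolutelyContinuousOnInterval_intervalIntegral (c := a) left_mem_uIcc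
  have hDd : ∀ x ∈ Ioo a b, HasDerivAt D (δ x) x := by
    intro x hx
    have hnhds : Icc a b ∈ 𝓝 x := Icc_mem_nhds hx.1 hx.2
    have h1 : HasDerivAt (fun s => D a + ∫ t in a..s, δ t) (δ x) x := by
      refine HasDerivAt.const_add _ (intervalIntegral.integral_hasDerivAt_right
        (hδi.mono_set (uIcc_subset_uIcc left_mem_uIcc ?_)) ?_ (hδc.continuousAt hnhds))
      · rw [hu]; exact ⟨hx.1.le, hx.2.le⟩
      · exact ContinuousOn.stronglyMeasurableAtFilter_nhdsWithin hδc measurableSet_Icc x |>.filter_mono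
          (by rw [nhdsWithin_eq_nhds.2 hnhds])
    exact h1.congr_of_eventuallyEq (by filter_upwards [hnhds] with s hs using hD s hs)
  have hEB : ∀ s ∈ Icc a b, ∫ t in a..s, h (D t) * δ t = ∫ r in D a..D s, h r := by
    intro s hs
    have hsub : uIcc a s ⊆ Icc a b := by
      rw [uIcc_of_le hs.1]; exact Icc_subset_Icc_right hs.2
    refine intervalIntegral.integral_comp_mul_deriv'' (f := D) (f' := δ) (g := h)
      (hDc.mono hsub) ?_ (hδc.mono hsub) hh.continuousOn
    intro x hx
    rw [min_eq_left hs.1, max_eq_right hs.1] at hx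
    exact (hDd x ⟨hx.1, hx.2.trans_le hs.2⟩).hasDerivWithinAt
  have ibp := hρ.integral_mul_deriv_eq_deriv_mul hE
  have e1 : ∫ x in a..b, (δ x)⁻¹ * deriv (fun s => ∫ t in a..s, h (D t) * δ t) x
      = ∫ s in a..b, h (D s) := by
    refine intervalIntegral.integral_congr_ae ?_
    filter_upwards [hgi.ae_hasDerivAt_integral] with x hx hx'
    have hx'' := uIoc_subset_uIcc hx'
    rw [(hx hx'' a left_mem_uIcc).deriv]
    have : δ x ≠ 0 := abs_pos.1 (hm.trans_le (hδm x (hu ▸ hx'')))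
    field_simp
  rw [e1] at ibp
  simp only [intervalIntegral.integral_same, mul_zero, sub_zero] at ibp
  rw [ibp, add_mul, ← intervalIntegral.integral_mul_const]
  refine (abs_sub _ _).trans (add_le_add ?_ ?_)
  · rw [abs_mul, hEB b (right_mem_Icc.2 hab.le)]
    gcongr
    exact hB b (right_mem_Icc.2 hab.le)
  · have hρi := hρ.intervalIntegrable_deriv
    refine (intervalIntegral.abs_integral_le_integral_abs hab.le).trans
      (intervalIntegral.integral_mono_on hab.le (hρi.mul_continuousOn hE.continuousOn).abs
        (hρi.abs.mul_const B) fun x hx => ?_)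
    rw [abs_mul, hEB x hx]
    gcongr
    exact hB x hx

theorem exists_norm_integral_comp_le_piece {a b m : ℝ} (hab : a < b) (hm : 0 < m) {δ D : ℝ → ℝ}
    (hδ : AbsolutelyContinuousOnInterval δ a b) (hδm : ∀ x ∈ Icc a b, m ≤ |δ x|)
    (hD : ∀ s ∈ Icc a b, D s = D a + ∫ t in a..s, δ t) (hDc : ContinuousOn D (Icc a b)) :
    ∃ C : ℝ, 0 ≤ C ∧ ∀ (h : ℝ → ℂ) (B : ℝ), Continuous h →
      (∀ s ∈ Icc a b, ‖∫ r in D a..D s, h r‖ ≤ B) → ‖∫ s in a..b, h (D s)‖ ≤ C * B := by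
  obtain ⟨C, hC, H⟩ := exists_norm_integral_comp_le_real hab hm hδ hδm hD
  refine ⟨2 * C, by positivity, fun h B hh hB => ?_⟩
  have hi : IntervalIntegrable (fun s => h (D s)) volume a b := by
    apply ContinuousOn.intervalIntegrable
    rw [uIcc_of_le hab.le]
    exact hh.comp_continuousOn hDc
  have hi' : ∀ x y, IntervalIntegrable h volume x y := fun x y => hh.intervalIntegrable x y
  have hre := H (fun r => (h r).re) B (Complex.continuous_re.comp hh) fun s hs => by
    refine le_trans ?_ (hB s hs)
    rw [show ∫ r in D a..D s, (h r).re = (∫ r in D a..D s, h r).re from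
      Complex.reCLM.intervalIntegral_comp_comm (hi' _ _)]
    exact Complex.abs_re_le_norm _
  have him := H (fun r => (h r).im) B (Complex.continuous_im.comp hh) fun s hs => by
    refine le_trans ?_ (hB s hs)
    rw [show ∫ r in D a..D s, (h r).im = (∫ r in D a..D s, h r).im from
      Complex.imCLM.intervalIntegral_comp_comm (hi' _ _)]
    exact Complex.abs_im_le_norm _
  rw [show ∫ s in a..b, (h (D s)).re = (∫ s in a..b, h (D s)).re from
      Complex.reCLM.intervalIntegral_comp_comm hi] at hre
  rw [show ∫ s in a..b, (h (D s)).im = (∫ s in a..b, h (D s)).im from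
      Complex.imCLM.intervalIntegral_comp_comm hi] at him
  have := Complex.norm_le_abs_re_add_abs_im (∫ s in a..b, h (D s))
  linarith

section Profile

variable {L : ℝ} {d₀ : ℝ → ℝ}

theorem IsPiecewiseW11.partition_mem {N : ℕ} {c : ℕ → ℝ} (h0 : c 0 = 0) (hN : c N = L)
    (h : ∀ j < N, c j < c (j + 1)) : ∀ j ≤ N, 0 ≤ c j ∧ c j ≤ L := by
  intro j hj
  constructor
  · induction j with
    | zero => exact h0.ge
    | succ j ih => exact (ih (by omega)).trans (h j (by omega)).le
  · have key : ∀ k, j + k ≤ N → c j ≤ c (j + k) := by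
      intro k
      induction k with
      | zero => exact fun _ => le_rfl
      | succ k ih => exact fun hk => (ih (by omega)).trans (h (j + k) (by omega)).le
    have := key (N - j) (by omega)
    rwa [Nat.add_sub_cancel' hj, hN] at this

theorem IsPiecewiseW11.intervalIntegrable (hd : IsPiecewiseW11 L d₀) :
    IntervalIntegrable d₀ volume 0 L := by
  obtain ⟨N, c, h0, hN, h⟩ := hd
  rw [← h0, ← hN]
  exact IntervalIntegrable.trans_iterate fun j hj =>
    (intervalIntegrable_iff_integrableOn_Ioo_of_le (h j hj).1.le).2 (h j hj).2.1

theorem IsPiecewiseW11.continuousOn_accumulated (hL : 0 ≤ L) (hd : IsPiecewiseW11 L d₀) :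
    ContinuousOn (accumulated d₀) (Icc 0 L) := by
  have := hd.intervalIntegrable.absolutelyContinuousOnInterval_intervalIntegral
    (c := 0) left_mem_uIcc
  have := this.continuousOn
  rwa [uIcc_of_le hL] at this

/-- Integrals along the accumulated dispersion are controlled by integrals of the profile-free
function. -/
theorem exists_norm_integral_accumulated_le (hL : 0 ≤ L) (hd : IsPiecewiseW11 L d₀)
    (hd' : IsBoundedAwayFromZero L d₀) :
    ∃ C : ℝ, 0 < C ∧ ∀ (h : ℝ → ℂ) (B : ℝ), 0 ≤ B → Continuous h →
      (∀ s ∈ Icc 0 L, ∀ s' ∈ Icc 0 L,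
        ‖∫ r in accumulated d₀ s..accumulated d₀ s', h r‖ ≤ B) →
      ‖∫ s in (0 : ℝ)..L, h (accumulated d₀ s)‖ ≤ C * B := by
  have hint := hd.intervalIntegrable
  have hDc := hd.continuousOn_accumulated hL
  obtain ⟨N, c, h0, hN, hp⟩ := hd
  have hmem := IsPiecewiseW11.partition_mem h0 hN fun j hj => (hp j hj).1
  have piece : ∀ j, ∃ C : ℝ, 0 ≤ C ∧ (j < N → ∀ (h : ℝ → ℂ) (B : ℝ), Continuous h →
      (∀ s ∈ Icc (c j) (c (j + 1)), ‖∫ r in accumulated d₀ (c j)..accumulated d₀ s, h r‖ ≤ B) →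
      ‖∫ s in (c j)..(c (j + 1)), h (accumulated d₀ s)‖ ≤ C * B) := by
    intro j
    by_cases hj : j < N
    · obtain ⟨hlt, hW⟩ := hp j hj
      have hj0 := (hmem j hj.le).1
      have hjL := (hmem (j + 1) hj).2
      obtain ⟨δ, m, hm, hδ, hae, hδm⟩ := exists_representative hlt hj0 hjL hW hd'
      have hsub : Icc (c j) (c (j + 1)) ⊆ Icc 0 L := Icc_subset_Icc hj0 hjL
      obtain ⟨C, hC, H⟩ := exists_norm_integral_comp_le_piece (D := accumulated d₀) hlt hm hδ hδm
        (fun s hs => by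
          have hi : ∀ x ∈ Icc 0 L, ∀ y ∈ Icc 0 L, IntervalIntegrable d₀ volume x y :=
            fun x hx y hy => hint.mono_set (uIcc_subset_uIcc (by rwa [uIcc_of_le hL])
              (by rwa [uIcc_of_le hL]))
          have hcj : c j ∈ Icc 0 L := hsub (left_mem_Icc.2 hlt.le)
          unfold accumulated
          rw [← intervalIntegral.integral_add_adjacent_intervals
            (hi 0 (left_mem_Icc.2 hL) _ hcj) (hi _ hcj s (hsub hs))]
          congr 1
          refine intervalIntegral.integral_congr_ae ?_
          have hne : ∀ᵐ x : ℝ, x ≠ c (j + 1) := by simp [ae_iff]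
          filter_upwards [hae, hne] with x hx hxne hx'
          rw [uIoc_of_le hs.1] at hx'
          exact hx ⟨hx'.1, lt_of_le_of_ne (hx'.2.trans hs.2) hxne⟩) (hDc.mono hsub)
      exact ⟨C, hC, fun _ => H⟩
    · exact ⟨0, le_rfl, fun h => absurd h hj⟩
  choose C hC H using piece
  -- The summand 1 only makes the constant strictly positive.
  refine ⟨1 + ∑ j ∈ Finset.range N, C j,
    by linarith [Finset.sum_nonneg fun j (_ : j ∈ Finset.range N) => hC j], fun h B hB hh hb => ?_⟩
  have hi : ∀ j < N, IntervalIntegrable (fun s => h (accumulated d₀ s)) volume (c j) (c (j + 1)) := by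
    intro j hj
    apply ContinuousOn.intervalIntegrable
    rw [uIcc_of_le (hp j hj).1.le]
    exact hh.comp_continuousOn (hDc.mono (Icc_subset_Icc (hmem j hj.le).1 (hmem (j + 1) hj).2))
  have := intervalIntegral.sum_integral_adjacent_intervals hi
  rw [h0, hN] at this
  rw [← this]
  calc _ ≤ ∑ j ∈ Finset.range N, C j * B := by
        refine norm_sum_le_of_le _ fun j hj => ?_
        have hjN := Finset.mem_range.1 hj
        refine H j hjN h B hh fun s hs => hb _ (hmem j hjN.le) _ ?_
        exact ⟨(hmem j hjN.le).1.trans hs.1, hs.2.trans (hmem (j + 1) hjN).2⟩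
    _ = (∑ j ∈ Finset.range N, C j) * B := by rw [Finset.sum_mul]
    _ ≤ _ := by gcongr; linarith

end Profile

end DispersionManagement

/-! ### Oscillatory kernels in time. -/

namespace DispersionManagement

open Filter Topology

theorem enorm_le_mul_kw {z : ℂ} {A t : ℝ} (hA : 0 < A) (h1 : t ≠ 0 → ‖z‖ ≤ A * |t|⁻¹)
    (h2 : t ≠ 0 → ‖z‖ ≤ A * |t| ^ (-(1 / 4) : ℝ)) : ‖z‖ₑ ≤ ENNReal.ofReal A * kw t := by
  rcases eq_or_ne t 0 with rfl | ht
  · have : kw 0 = ⊤ := by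
      simp only [kw, enorm_zero, ENNReal.inv_zero]
      rw [ENNReal.zero_rpow_of_neg (by norm_num), min_self]
    rw [this, ENNReal.mul_top (by simpa using hA)]
    exact le_top
  · have h0 : 0 < |t| := abs_pos.2 ht
    unfold kw
    rw [Real.enorm_eq_ofReal_abs, ENNReal.ofReal_rpow_of_pos h0, ← ENNReal.ofReal_inv_of_pos h0,
      ← ENNReal.ofReal_min, ← ENNReal.ofReal_mul hA.le, ← ofReal_norm]
    refine ENNReal.ofReal_le_ofReal ?_
    rw [mul_min_of_nonneg _ _ hA.le]
    exact le_min (h1 ht) (h2 ht)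

theorem norm_integral_exp_le {t : ℝ} (ht : t ≠ 0) (a b : ℝ) :
    ‖∫ r in a..b, Complex.exp (Complex.I * t * r)‖ ≤ 2 * |t|⁻¹ := by
  have ht' : Complex.I * t ≠ 0 := mul_ne_zero Complex.I_ne_zero (by exact_mod_cast ht)
  have hn : ∀ r : ℝ, ‖Complex.exp (Complex.I * t * r)‖ = 1 := fun r => by
    rw [show Complex.I * t * r = ((t * r : ℝ) : ℂ) * Complex.I by push_cast; ring,
      Complex.norm_exp_ofReal_mul_I]
  rw [integral_exp_mul_complex ht', norm_div, norm_mul, Complex.norm_I, one_mul, Complex.norm_real,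
    Real.norm_eq_abs, div_eq_mul_inv]
  gcongr
  refine (norm_sub_le _ _).trans ?_
  rw [hn, hn]
  norm_num

/-- The function `e^{iτ/r}`. -/
noncomputable def recPhase (τ r : ℝ) : ℂ := Complex.exp (((τ / r : ℝ) : ℂ) * Complex.I)

theorem norm_recPhase (τ r : ℝ) : ‖recPhase τ r‖ = 1 := Complex.norm_exp_ofReal_mul_I _

/-- The phase oscillates without limit at r = 0 but is unimodular, so a factor vanishing there
restores continuity. This allows integration across r = 0. -/
theorem continuous_mul_recPhase {g : ℝ → ℝ} (hg : Continuous g) (h0 : g 0 = 0) (τ : ℝ) :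
    Continuous fun r => (g r : ℂ) * recPhase τ r := by
  rw [continuous_iff_continuousAt]
  intro r
  rcases eq_or_ne r 0 with rfl | hr
  · rw [ContinuousAt, h0]
    simp only [Complex.ofReal_zero, zero_mul]
    refine squeeze_zero_norm (a := fun r => |g r|) (fun r => ?_) ?_
    · rw [norm_mul, norm_recPhase, mul_one, Complex.norm_real, Real.norm_eq_abs]
    · have := (hg.abs).tendsto 0
      simpa [h0] using this
  · unfold recPhase
    have : ContinuousAt (fun r : ℝ => τ / r) r := continuousAt_const.div continuousAt_id hr
    fun_prop

theorem hasDerivAt_recPhase (τ : ℝ) {r : ℝ} (hr : r ≠ 0) :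
    HasDerivAt (recPhase τ) (-(τ / r ^ 2 : ℝ) * Complex.I * recPhase τ r) r := by
  unfold recPhase
  have h1 : HasDerivAt (fun r : ℝ => τ / r) (-(τ / r ^ 2)) r := by
    have := (hasDerivAt_inv hr).const_mul τ
    simpa [div_eq_mul_inv] using this
  have h2 := ((h1.ofReal_comp).mul_const Complex.I).cexp
  convert h2 using 1
  push_cast
  ring

theorem continuous_regularized {η : ℝ} (hη : 0 < η) {g : ℝ → ℝ} (hg : Continuous g) :
    Continuous fun r => g r / (r ^ 2 + η ^ 2) :=
  hg.div (by fun_prop) fun r => by positivity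

/-- Integration by parts, uniformly in η. The function p(r) = r³/(r² + η²) is chosen so that
differentiating the phase in p(r) e^{iτ/r} yields -iτ times the integrand. As p is increasing, the
boundary term and the term with p' are each at most p(R) ≤ R. -/
theorem norm_integral_recPhase_le {η τ R : ℝ} (hη : 0 < η) (hτ : τ ≠ 0) (hR : 0 ≤ R) :
    ‖∫ r in (0 : ℝ)..R, ((|r| / (r ^ 2 + η ^ 2) : ℝ) : ℂ) * recPhase τ r‖ ≤ 2 * R * |τ|⁻¹ := by
  set p : ℝ → ℝ := fun r => r ^ 3 / (r ^ 2 + η ^ 2) with hp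
  set p' : ℝ → ℝ := fun r => (r ^ 4 + 3 * r ^ 2 * η ^ 2) / (r ^ 2 + η ^ 2) ^ 2 with hp'
  have cp : Continuous p := continuous_regularized hη (by fun_prop)
  have cp' : Continuous p' := Continuous.div (by fun_prop) (by fun_prop) fun r => by positivity
  have dp : ∀ r, HasDerivAt p (p' r) r := fun r => by
    have h1 := (hasDerivAt_pow 3 r).div (((hasDerivAt_pow 2 r).add_const (η ^ 2)))
      (show r ^ 2 + η ^ 2 ≠ 0 by positivity)
    refine HasDerivAt.congr_deriv h1 ?_
    simp only [hp']
    congr 1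
    push_cast
    ring
  have cF : Continuous fun r => (p r : ℂ) * recPhase τ r := continuous_mul_recPhase cp (by simp [hp]) τ
  have cF' : Continuous fun r => (p' r : ℂ) * recPhase τ r :=
    continuous_mul_recPhase cp' (by simp [hp']) τ
  have cG : Continuous fun r => ((|r| / (r ^ 2 + η ^ 2) : ℝ) : ℂ) * recPhase τ r :=
    continuous_mul_recPhase (continuous_regularized hη continuous_abs) (by simp) τ
  have ftc := intervalIntegral.integral_eq_sub_of_hasDerivAt_of_le hR cF.continuousOn
    (f' := fun r => (p' r : ℂ) * recPhase τ r
      - τ * Complex.I * (((|r| / (r ^ 2 + η ^ 2) : ℝ) : ℂ) * recPhase τ r)) (fun r hr => by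
      have := ((dp r).ofReal_comp).mul (hasDerivAt_recPhase τ hr.1.ne')
      refine HasDerivAt.congr_deriv this ?_
      rw [abs_of_pos hr.1, sub_eq_add_neg]
      congr 1
      have h1 : (r : ℂ) ≠ 0 := by exact_mod_cast hr.1.ne'
      have h2 : (r : ℂ) ^ 2 + (η : ℂ) ^ 2 ≠ 0 := by
        exact_mod_cast (show r ^ 2 + η ^ 2 ≠ 0 by positivity)
      rw [hp]
      push_cast
      field_simp)
    ((cF'.sub (continuous_const.mul cG)).intervalIntegrable _ _)
  rw [intervalIntegral.integral_sub (cF'.intervalIntegrable _ _)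
    ((cG.intervalIntegrable _ _).const_mul _), intervalIntegral.integral_const_mul] at ftc
  have hp0 : p 0 = 0 := by simp [hp]
  have hpR : 0 ≤ p R := by simp only [hp]; positivity
  have hpR' : p R ≤ R := by
    simp only [hp]
    rw [div_le_iff₀ (by positivity)]
    nlinarith [mul_nonneg hR (sq_nonneg η)]
  have b1 : ‖∫ r in (0 : ℝ)..R, (p' r : ℂ) * recPhase τ r‖ ≤ p R := by
    have := intervalIntegral.integral_eq_sub_of_hasDerivAt (a := 0) (b := R) (fun r _ => dp r)
      (cp'.intervalIntegrable _ _)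
    rw [hp0, sub_zero] at this
    rw [← this]
    refine (intervalIntegral.norm_integral_le_integral_norm hR).trans_eq ?_
    refine intervalIntegral.integral_congr fun r _ => ?_
    simp only [norm_mul, norm_recPhase, mul_one, Complex.norm_real]
    rw [Real.norm_of_nonneg]
    simp only [hp']
    positivity
  have b2 : ‖(p R : ℂ) * recPhase τ R‖ = p R := by
    rw [norm_mul, norm_recPhase, mul_one, Complex.norm_real, Real.norm_of_nonneg hpR]
  rw [hp0] at ftc
  simp only [Complex.ofReal_zero, zero_mul, sub_zero] at ftc
  set G := ∫ r in (0 : ℝ)..R, ((|r| / (r ^ 2 + η ^ 2) : ℝ) : ℂ) * recPhase τ r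
  have e : (τ : ℂ) * Complex.I * G =
      (∫ r in (0 : ℝ)..R, (p' r : ℂ) * recPhase τ r) - (p R : ℂ) * recPhase τ R := by
    rw [← ftc]; ring
  have hn : |τ| * ‖G‖ ≤ 2 * R := by
    have : ‖(τ : ℂ) * Complex.I * G‖ = |τ| * ‖G‖ := by simp
    rw [← this, e]
    refine (norm_sub_le _ _).trans ?_
    rw [b2]
    linarith
  rw [← div_eq_mul_inv, le_div_iff₀ (abs_pos.2 hτ)]
  linarith

/-- The phase oscillates fast only for r below |τ|. There the previous bound gives 2; beyond |τ| the
integrand is at most 1/r. -/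
theorem norm_integral_recPhase_le_log {η τ R : ℝ} (hη : 0 < η) (hτ : τ ≠ 0) (hR : |τ| ≤ R) :
    ‖∫ r in (0 : ℝ)..R, ((|r| / (r ^ 2 + η ^ 2) : ℝ) : ℂ) * recPhase τ r‖
      ≤ 2 + Real.log (R / |τ|) := by
  have ht : 0 < |τ| := abs_pos.2 hτ
  have cG : Continuous fun r => ((|r| / (r ^ 2 + η ^ 2) : ℝ) : ℂ) * recPhase τ r :=
    continuous_mul_recPhase (continuous_regularized hη continuous_abs) (by simp) τ
  rw [← intervalIntegral.integral_add_adjacent_intervals (b := |τ|) (cG.intervalIntegrable _ _)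
    (cG.intervalIntegrable _ _)]
  refine (norm_add_le _ _).trans (add_le_add ?_ ?_)
  · refine (norm_integral_recPhase_le hη hτ ht.le).trans_eq ?_
    field_simp
  · rw [← integral_inv_of_pos ht (ht.trans_le hR)]
    have hi : IntervalIntegrable (fun r : ℝ => r⁻¹) volume |τ| R := by
      refine intervalIntegral.intervalIntegrable_inv (fun x hx => ?_) continuousOn_id
      rw [uIcc_of_le hR] at hx
      exact (ht.trans_le hx.1).ne'
    refine (intervalIntegral.norm_integral_le_integral_norm hR).trans
      (intervalIntegral.integral_mono_on hR (cG.norm.intervalIntegrable _ _) hi fun r hr => ?_)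
    have hr0 : 0 < r := ht.trans_le hr.1
    rw [norm_mul, norm_recPhase, mul_one, Complex.norm_real, Real.norm_of_nonneg (by positivity),
      abs_of_pos hr0, div_le_iff₀ (by positivity), inv_mul_eq_div, le_div_iff₀ hr0]
    nlinarith [sq_nonneg η]

theorem norm_integral_recPhase_le_min {η τ R M : ℝ} (hη : 0 < η) (hτ : τ ≠ 0) (hM : 1 ≤ M)
    (hR : |R| ≤ M) :
    ‖∫ r in (0 : ℝ)..R, ((|r| / (r ^ 2 + η ^ 2) : ℝ) : ℂ) * recPhase τ r‖ ≤ 6 * M * |τ|⁻¹ ∧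
    ‖∫ r in (0 : ℝ)..R, ((|r| / (r ^ 2 + η ^ 2) : ℝ) : ℂ) * recPhase τ r‖
      ≤ 6 * M * |τ| ^ (-(1 / 4) : ℝ) := by
  -- Reflecting r and τ together leaves τ/r, and hence the phase, unchanged.
  wlog hR0 : 0 ≤ R generalizing R τ
  · have h := this (τ := -τ) (R := -R) (neg_ne_zero.2 hτ) (by rwa [abs_neg])
      (by linarith [not_le.1 hR0])
    have e : ∫ r in (0 : ℝ)..(-R), ((|r| / (r ^ 2 + η ^ 2) : ℝ) : ℂ) * recPhase (-τ) r
        = -∫ r in (0 : ℝ)..R, ((|r| / (r ^ 2 + η ^ 2) : ℝ) : ℂ) * recPhase τ r := by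
      rw [← intervalIntegral.integral_symm]
      have := intervalIntegral.integral_comp_neg (a := R) (b := 0)
        (fun r => ((|r| / (r ^ 2 + η ^ 2) : ℝ) : ℂ) * recPhase (-τ) r)
      rw [neg_zero] at this
      rw [← this]
      simp [recPhase, neg_div_neg_eq]
    rwa [e, norm_neg, abs_neg] at h
  rw [abs_of_nonneg hR0] at hR
  have ht : 0 < |τ| := abs_pos.2 hτ
  have b1 := norm_integral_recPhase_le hη hτ hR0
  set X := ‖∫ r in (0 : ℝ)..R, ((|r| / (r ^ 2 + η ^ 2) : ℝ) : ℂ) * recPhase τ r‖ with hX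
  have b1' : X ≤ 2 * M * |τ|⁻¹ := b1.trans (by gcongr)
  have hMt : 0 ≤ M * |τ|⁻¹ := by positivity
  refine ⟨by linarith, ?_⟩
  have hM4 : (M / |τ|) ^ (1 / 4 : ℝ) ≤ M * |τ| ^ (-(1 / 4) : ℝ) := by
    rw [div_eq_mul_inv, Real.mul_rpow (by linarith) (by positivity), Real.inv_rpow ht.le,
      ← Real.rpow_neg ht.le]
    gcongr
    calc M ^ (1 / 4 : ℝ) ≤ M ^ (1 : ℝ) := Real.rpow_le_rpow_of_exponent_le hM (by norm_num)
      _ = M := Real.rpow_one M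
  rw [mul_assoc]
  refine le_trans ?_ (mul_le_mul_of_nonneg_left hM4 (by norm_num))
  rcases le_or_gt (M / |τ|) 1 with h | h
  · have h3 : M / |τ| ≤ (M / |τ|) ^ (1 / 4 : ℝ) := by
      calc M / |τ| = (M / |τ|) ^ (1 : ℝ) := (Real.rpow_one _).symm
        _ ≤ _ := Real.rpow_le_rpow_of_exponent_ge (by positivity) h (by norm_num)
    rw [← div_eq_mul_inv] at hMt
    rw [mul_assoc, ← div_eq_mul_inv] at b1'
    linarith
  · have h1 : 1 ≤ (M / |τ|) ^ (1 / 4 : ℝ) := Real.one_le_rpow h.le (by norm_num)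
    rcases le_or_gt R |τ| with h2 | h2
    · have : 2 * R * |τ|⁻¹ ≤ 2 := by
        rw [← div_eq_mul_inv, div_le_iff₀ ht]; linarith
      linarith
    · have b2 := norm_integral_recPhase_le_log hη hτ h2.le
      have h3 : Real.log (R / |τ|) ≤ Real.log (M / |τ|) :=
        Real.log_le_log (div_pos (ht.trans h2) ht) (by gcongr)
      have h4 : Real.log (M / |τ|) ≤ 4 * (M / |τ|) ^ (1 / 4 : ℝ) := by
        have := Real.log_le_rpow_div (x := M / |τ|) (by positivity) (show (0 : ℝ) < 1 / 4 by norm_num)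
        linarith
      linarith

section Profile

variable {L : ℝ} {d₀ : ℝ → ℝ}

theorem exists_phase_kernel_le (hL : 0 ≤ L) (hd : IsPiecewiseW11 L d₀)
    (hd' : IsBoundedAwayFromZero L d₀) :
    ∃ C : ℝ, 0 < C ∧ ∀ t : ℝ, ‖∫ s in (0 : ℝ)..L, Complex.exp (Complex.I * t * accumulated d₀ s)‖ₑ
      ≤ ENNReal.ofReal C * kw t := by
  obtain ⟨C, hC, H⟩ := exists_norm_integral_accumulated_le hL hd hd'
  have hb1 : ∀ t : ℝ, t ≠ 0 →
      ‖∫ s in (0 : ℝ)..L, Complex.exp (Complex.I * t * accumulated d₀ s)‖ ≤ C * (2 * |t|⁻¹) :=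
    fun t ht => H (fun r => Complex.exp (Complex.I * t * r)) (2 * |t|⁻¹) (by positivity)
      (by fun_prop) fun s _ s' _ => norm_integral_exp_le ht _ _
  have hb2 : ∀ t : ℝ, ‖∫ s in (0 : ℝ)..L, Complex.exp (Complex.I * t * accumulated d₀ s)‖ ≤ L := by
    intro t
    refine (intervalIntegral.norm_integral_le_of_norm_le_const (C := 1) fun s _ => ?_).trans ?_
    · rw [show Complex.I * t * accumulated d₀ s = ((t * accumulated d₀ s : ℝ) : ℂ) * Complex.I by
        push_cast; ring, Complex.norm_exp_ofReal_mul_I]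
    · rw [sub_zero, one_mul, abs_of_nonneg hL]
  -- The term 2C covers the oscillatory bound; L is the trivial bound, used for |t| ≤ 1.
  refine ⟨2 * C + L, by positivity, fun t => enorm_le_mul_kw (by positivity) (fun ht => ?_)
    fun ht => ?_⟩
  · refine (hb1 t ht).trans ?_
    have : 0 ≤ |t|⁻¹ := by positivity
    nlinarith
  · have h0 : 0 < |t| := abs_pos.2 ht
    rcases le_total |t| 1 with h | h
    · have : 1 ≤ |t| ^ (-(1 / 4) : ℝ) := Real.one_le_rpow_of_pos_of_le_one_of_nonpos h0 h (by norm_num)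
      refine (hb2 t).trans ?_
      nlinarith
    · refine (hb1 t ht).trans ?_
      have h1 : |t|⁻¹ ≤ |t| ^ (-(1 / 4) : ℝ) := by
        rw [← Real.rpow_neg_one]
        exact Real.rpow_le_rpow_of_exponent_le h (by norm_num)
      have h2 : 0 ≤ |t|⁻¹ := by positivity
      nlinarith

theorem exists_recPhase_kernel_le (hL : 0 ≤ L) (hd : IsPiecewiseW11 L d₀)
    (hd' : IsBoundedAwayFromZero L d₀) :
    ∃ C : ℝ, 0 < C ∧ ∀ η : ℝ, 0 < η → ∀ τ : ℝ,
      ‖∫ s in (0 : ℝ)..L, ((|accumulated d₀ s| / (accumulated d₀ s ^ 2 + η ^ 2) : ℝ) : ℂ) *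
        recPhase τ (accumulated d₀ s)‖ₑ ≤ ENNReal.ofReal C * kw τ := by
  obtain ⟨C, hC, H⟩ := exists_norm_integral_accumulated_le hL hd hd'
  obtain ⟨M', hM'⟩ := (isCompact_Icc.image_of_continuousOn
    (hd.continuousOn_accumulated hL)).isBounded.exists_norm_le
  set M := max 1 M'
  have hM1 : 1 ≤ M := le_max_left _ _
  have hM : ∀ s ∈ Icc 0 L, |accumulated d₀ s| ≤ M := fun s hs =>
    (hM' _ (mem_image_of_mem _ hs)).trans (le_max_right _ _)
  -- 6M bounds the integrals starting at 0, M ≥ 1 bounds |D| on [0, L], and the factor 2 comes from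
  -- writing an integral from D(s) to D(s') as a difference of two such integrals.
  refine ⟨C * (2 * (6 * M)), by positivity, fun η hη τ => ?_⟩
  have cG : Continuous fun r => ((|r| / (r ^ 2 + η ^ 2) : ℝ) : ℂ) * recPhase τ r :=
    continuous_mul_recPhase (continuous_regularized hη continuous_abs) (by simp) τ
  have key : ∀ B : ℝ, 0 ≤ B → (∀ R, |R| ≤ M →
      ‖∫ r in (0 : ℝ)..R, ((|r| / (r ^ 2 + η ^ 2) : ℝ) : ℂ) * recPhase τ r‖ ≤ B) →
      ‖∫ s in (0 : ℝ)..L, ((|accumulated d₀ s| / (accumulated d₀ s ^ 2 + η ^ 2) : ℝ) : ℂ) *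
        recPhase τ (accumulated d₀ s)‖ ≤ C * (2 * B) := by
    intro B hB h
    refine H (fun r => ((|r| / (r ^ 2 + η ^ 2) : ℝ) : ℂ) * recPhase τ r) (2 * B) (by positivity)
      cG fun s hs s' hs' => ?_
    rw [← intervalIntegral.integral_interval_sub_left (a := 0) (cG.intervalIntegrable _ _)
      (cG.intervalIntegrable _ _)]
    refine (norm_sub_le _ _).trans ?_
    linarith [h _ (hM s hs), h _ (hM s' hs')]
  refine enorm_le_mul_kw (by positivity) (fun ht => ?_) fun ht => ?_
  · refine (key (6 * M * |τ|⁻¹) (by positivity) fun R hR =>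
      (norm_integral_recPhase_le_min hη ht hM1 hR).1).trans_eq (by ring)
  · refine (key (6 * M * |τ| ^ (-(1 / 4) : ℝ)) (by positivity) fun R hR =>
      (norm_integral_recPhase_le_min hη ht hM1 hR).2).trans_eq (by ring)

/-- A tent of width η around 0 has integral of order η and equals 1 at 0. The integral bound along
D, whose constant does not depend on η, shows that the zero set of D has measure O(η). -/
theorem ae_accumulated_ne_zero (hL : 0 ≤ L) (hd : IsPiecewiseW11 L d₀)
    (hd' : IsBoundedAwayFromZero L d₀) :
    ∀ᵐ s, s ∈ Ioc 0 L → accumulated d₀ s ≠ 0 := by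
  obtain ⟨C, hC, H⟩ := exists_norm_integral_accumulated_le hL hd hd'
  have hDc := hd.continuousOn_accumulated hL
  set S := {s | s ∈ Icc 0 L ∧ accumulated d₀ s = 0} with hS
  have mS : MeasurableSet S := by
    have : S = Icc 0 L ∩ accumulated d₀ ⁻¹' {0} := rfl
    rw [this]
    exact (hDc.preimage_isClosed_of_isClosed isClosed_Icc isClosed_singleton).measurableSet
  have hbound : ∀ η : ℝ, 0 < η → volume.real S ≤ C * (2 * η) := by
    intro η hη
    have ch : Continuous fun r : ℝ => max 0 (1 - |r| / η) := by fun_prop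
    have h1 := H (fun r => ((max 0 (1 - |r| / η) : ℝ) : ℂ)) (2 * η) (by positivity)
      (by fun_prop) (fun s _ s' _ => by
        rw [intervalIntegral.integral_ofReal, Complex.norm_real]
        refine (intervalIntegral.norm_integral_le_integral_norm_uIoc).trans ?_
        have e : ∀ r : ℝ, ‖max 0 (1 - |r| / η)‖ ≤ (Icc (-η) η).indicator (fun _ => (1 : ℝ)) r := by
          intro r
          rw [Real.norm_of_nonneg (le_max_left _ _)]
          by_cases hr : r ∈ Icc (-η) η
          · rw [indicator_of_mem hr]
            have : 0 ≤ |r| / η := by positivity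
            exact max_le zero_le_one (by linarith)
          · rw [indicator_of_notMem hr]
            have : 1 ≤ |r| / η := by
              rw [le_div_iff₀ hη, one_mul]
              by_contra hc
              exact hr (abs_le.1 (not_le.1 hc).le)
            exact max_le le_rfl (by linarith)
        have hii : Integrable ((Icc (-η) η).indicator fun _ => (1 : ℝ)) :=
          (integrable_indicator_iff measurableSet_Icc).2 (integrableOn_const (by simp))
        calc _ ≤ ∫ r in uIoc (accumulated d₀ s) (accumulated d₀ s'),
              (Icc (-η) η).indicator (fun _ => (1 : ℝ)) r :=
              integral_mono_of_nonneg (Eventually.of_forall fun _ => norm_nonneg _)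
                hii.integrableOn (Eventually.of_forall e)
          _ ≤ ∫ r, (Icc (-η) η).indicator (fun _ => (1 : ℝ)) r :=
              setIntegral_le_integral hii (Eventually.of_forall fun r =>
                indicator_nonneg (fun _ _ => zero_le_one) r)
          _ = 2 * η := by
              rw [integral_indicator measurableSet_Icc]
              simp [hη.le]
              ring)
    rw [intervalIntegral.integral_ofReal, Complex.norm_real, Real.norm_of_nonneg
      (intervalIntegral.integral_nonneg hL fun s _ => le_max_left _ _)] at h1
    refine le_trans ?_ h1
    have hci : IntegrableOn (fun s => max 0 (1 - |accumulated d₀ s| / η)) (Icc 0 L) :=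
      (ch.comp_continuousOn hDc).integrableOn_Icc
    rw [intervalIntegral.integral_of_le hL, ← integral_Icc_eq_integral_Ioc]
    calc volume.real S = ∫ s in Icc 0 L, S.indicator (fun _ => (1 : ℝ)) s := by
          rw [integral_indicator mS, Measure.restrict_restrict mS,
            inter_eq_left.2 (fun s hs => hs.1)]
          simp
      _ ≤ _ := by
          refine setIntegral_mono_on ((integrable_indicator_iff mS).2 ?_) hci measurableSet_Icc
            fun s _ => ?_
          · exact integrableOn_const (measure_ne_top (volume.restrict (Icc 0 L)) S)
          · by_cases hs : s ∈ S
            · rw [indicator_of_mem hs, hs.2]; simp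
            · rw [indicator_of_notMem hs]; exact le_max_left _ _
  have hfin : volume S ≠ ⊤ := ((measure_mono (fun s hs => hs.1)).trans_lt
    (measure_Icc_lt_top (a := (0 : ℝ)) (b := L))).ne
  have hzero : volume S = 0 := by
    have : volume.real S ≤ 0 := by
      refine le_of_forall_pos_le_add fun ε hε => ?_
      refine (hbound (ε / (2 * C)) (by positivity)).trans_eq ?_
      field_simp
      ring
    rw [← measureReal_eq_zero_iff hfin]
    exact le_antisymm this measureReal_nonneg
  have := measure_eq_zero_iff_ae_notMem.1 hzero
  filter_upwards [this] with s hs hs' h0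
  exact hs ⟨Ioc_subset_Icc_self hs', h0⟩

end Profile

end DispersionManagement

/-! ### Fourier integrals and the four-linear Plancherel identity. -/

namespace DispersionManagement

open Filter Topology

/-! ### The Fourier transform on `L¹ ∩ L²` -/

theorem continuous_fourier {v : ℝ → ℂ} (h : Integrable v) : Continuous (𝓕 v) :=
  VectorFourier.fourierIntegral_continuous (L := innerₗ ℝ) Real.continuous_fourierChar
    continuous_inner h

theorem continuous_fourierInv {v : ℝ → ℂ} (h : Integrable v) : Continuous (𝓕⁻ v) := by
  rw [Real.fourierInv_eq_fourier_comp_neg]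
  exact continuous_fourier h.comp_neg

/-- Both transforms define the same distribution: the L² transform through its compatibility with
tempered distributions, the integral through the symmetry of ∫ 𝓕G · v. -/
theorem fourier_toLp_ae_eq {v : ℝ → ℂ} (h1 : Integrable v) (h2 : MemLp v 2) :
    ((𝓕 (h2.toLp v) : L2) : ℝ → ℂ) =ᵐ[volume] 𝓕 v := by
  have hcont : Continuous (𝓕 v) := continuous_fourier h1
  refine ae_eq_of_integral_contDiff_smul_eq
    ((Lp.memLp (𝓕 (h2.toLp v) : L2)).locallyIntegrable one_le_two) hcont.locallyIntegrable ?_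
  intro g hg hgc
  have hgC : ContDiff ℝ (⊤ : ℕ∞) (fun x => (g x : ℂ)) := Complex.ofRealCLM.contDiff.comp hg
  have hgCc : HasCompactSupport (fun x => (g x : ℂ)) := hgc.comp_left Complex.ofReal_zero
  set G : 𝓢(ℝ, ℂ) := hgCc.toSchwartzMap hgC with hG
  have hGx : ∀ x, G x = (g x : ℂ) := fun x => rfl
  have e1 := congrArg (fun T : 𝓢'(ℝ, ℂ) => T G) (Lp.fourier_toTemperedDistribution_eq (h2.toLp v))
  simp only [TemperedDistribution.fourier_apply, Lp.toTemperedDistribution_apply] at e1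
  have e2 : ∫ x, (𝓕 G) x • (h2.toLp v) x = ∫ x, (𝓕 G) x • v x := by
    refine integral_congr_ae ?_
    filter_upwards [h2.coeFn_toLp] with x hx
    rw [hx]
  have e3 : ∫ x, (𝓕 G) x • v x = ∫ x, G x • 𝓕 v x := by
    have := VectorFourier.integral_fourierIntegral_smul_eq_flip (L := innerₗ ℝ)
      Real.continuous_fourierChar continuous_inner (f := (G : ℝ → ℂ)) (g := v)
      (μ := volume) (ν := volume) G.integrable h1
    rw [flip_innerₗ] at this
    exact this
  have : ∫ x, G x • ((𝓕 (h2.toLp v) : L2) : ℝ → ℂ) x = ∫ x, G x • 𝓕 v x := by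
    rw [← e3, ← e2, e1]
  simpa [hGx] using this

theorem integral_conj_fourier_mul_fourier {a b : ℝ → ℂ} (ha1 : Integrable a) (ha2 : MemLp a 2)
    (hb1 : Integrable b) (hb2 : MemLp b 2) :
    ∫ x, starRingEnd ℂ (𝓕 a x) * 𝓕 b x = ∫ x, starRingEnd ℂ (a x) * b x := by
  have h := Lp.inner_fourier_eq (ha2.toLp a) (hb2.toLp b)
  rw [L2.inner_def, L2.inner_def] at h
  have e1 : ∫ x, starRingEnd ℂ (𝓕 a x) * 𝓕 b x =
      ∫ x, ⟪(𝓕 (ha2.toLp a) : L2) x, (𝓕 (hb2.toLp b) : L2) x⟫_ℂ := by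
    refine integral_congr_ae ?_
    filter_upwards [fourier_toLp_ae_eq ha1 ha2, fourier_toLp_ae_eq hb1 hb2] with x h1 h2
    rw [h1, h2, RCLike.inner_apply']
  have e2 : ∫ x, starRingEnd ℂ (a x) * b x = ∫ x, ⟪(ha2.toLp a) x, (hb2.toLp b) x⟫_ℂ := by
    refine integral_congr_ae ?_
    filter_upwards [ha2.coeFn_toLp, hb2.coeFn_toLp] with x h1 h2
    rw [h1, h2, RCLike.inner_apply']
  rw [e1, e2, h]

/-! ### Bounded functions of compact support -/

/-- Bounded measurable functions vanishing outside a bounded set. -/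
structure BddSupp (v : ℝ → ℂ) : Prop where
  meas : Measurable v
  bdd : ∃ C : ℝ, ∀ x, ‖v x‖ ≤ C
  supp : ∃ R : ℝ, ∀ x, v x ≠ 0 → |x| ≤ R

namespace BddSupp

theorem memLp {v : ℝ → ℂ} (hv : BddSupp v) (p : ℝ≥0∞) : MemLp v p := by
  obtain ⟨C, hC⟩ := hv.bdd
  obtain ⟨R, hR⟩ := hv.supp
  have : v = (Icc (-R) R).indicator v := by
    ext x
    by_cases hx : x ∈ Icc (-R) R
    · rw [indicator_of_mem hx]
    · rw [indicator_of_notMem hx]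
      by_contra h
      exact hx (abs_le.1 (hR x h))
  rw [this, memLp_indicator_iff_restrict measurableSet_Icc]
  exact MemLp.of_bound hv.meas.aestronglyMeasurable C (Eventually.of_forall hC)

theorem integrable {v : ℝ → ℂ} (hv : BddSupp v) : Integrable v := memLp_one_iff_integrable.1 (hv.memLp 1)

theorem exists_pos {v : ℝ → ℂ} (hv : BddSupp v) :
    ∃ C : ℝ, 0 < C ∧ (∀ x, ‖v x‖ ≤ C) ∧ ∀ x, v x ≠ 0 → |x| ≤ C := by
  obtain ⟨C, hC⟩ := hv.bdd
  obtain ⟨R, hR⟩ := hv.supp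
  exact ⟨max 1 (max C R), by positivity,
    fun x => (hC x).trans ((le_max_left _ _).trans (le_max_right _ _)),
    fun x hx => (hR x hx).trans ((le_max_right _ _).trans (le_max_right _ _))⟩

theorem mul_left {v m : ℝ → ℂ} (hv : BddSupp v) (hm : Measurable m) (hm1 : ∀ x, ‖m x‖ ≤ 1) :
    BddSupp fun x => m x * v x := by
  obtain ⟨C, hC⟩ := hv.bdd
  obtain ⟨R, hR⟩ := hv.supp
  refine ⟨hm.mul hv.meas, ⟨C, fun x => ?_⟩, R, fun x hx => hR x (right_ne_zero_of_mul hx)⟩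
  rw [norm_mul]
  exact (mul_le_of_le_one_left (norm_nonneg _) (hm1 x)).trans (hC x)

/-- The integrand of the four-linear form in the Fourier variables. -/
noncomputable def _root_.DispersionManagement.quadInt (v₁ v₂ v₃ v₄ : ℝ → ℂ) (z : ℝ × ℝ × ℝ) : ℂ :=
  starRingEnd ℂ (v₁ z.2.1 * v₃ (z.1 - z.2.1)) * (v₂ z.2.2 * v₄ (z.1 - z.2.2))

theorem integrable_quadInt {v₁ v₂ v₃ v₄ : ℝ → ℂ} (h₁ : BddSupp v₁) (h₂ : BddSupp v₂)
    (h₃ : BddSupp v₃) (h₄ : BddSupp v₄) : Integrable (quadInt v₁ v₂ v₃ v₄) := by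
  obtain ⟨C₁, p₁, b₁, s₁⟩ := h₁.exists_pos
  obtain ⟨C₂, p₂, b₂, s₂⟩ := h₂.exists_pos
  obtain ⟨C₃, p₃, b₃, s₃⟩ := h₃.exists_pos
  obtain ⟨C₄, p₄, b₄, s₄⟩ := h₄.exists_pos
  have m₁ := h₁.meas
  have m₂ := h₂.meas
  have m₃ := h₃.meas
  have m₄ := h₄.meas
  set K : Set (ℝ × ℝ × ℝ) := Icc (-(C₁ + C₃)) (C₁ + C₃) ×ˢ (Icc (-C₁) C₁ ×ˢ Icc (-C₂) C₂) with hK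
  have hKc : IsCompact K := isCompact_Icc.prod (isCompact_Icc.prod isCompact_Icc)
  have hz : quadInt v₁ v₂ v₃ v₄ = K.indicator (quadInt v₁ v₂ v₃ v₄) := by
    ext z
    by_cases h : z ∈ K
    · rw [indicator_of_mem h]
    · rw [indicator_of_notMem h]
      by_contra h0
      unfold quadInt at h0
      have a1 := s₁ _ (left_ne_zero_of_mul ((map_ne_zero _).1 (left_ne_zero_of_mul h0)))
      have a3 := s₃ _ (right_ne_zero_of_mul ((map_ne_zero _).1 (left_ne_zero_of_mul h0)))
      have a2 := s₂ _ (left_ne_zero_of_mul (right_ne_zero_of_mul h0))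
      refine h ⟨abs_le.1 ?_, abs_le.1 a1, abs_le.1 a2⟩
      calc |z.1| = |z.2.1 + (z.1 - z.2.1)| := by ring_nf
        _ ≤ _ := (abs_add_le _ _).trans (add_le_add a1 a3)
  have hm : Measurable (quadInt v₁ v₂ v₃ v₄) := by
    unfold quadInt
    exact (RCLike.continuous_conj.measurable.comp (by fun_prop)).mul (by fun_prop)
  rw [hz, integrable_indicator_iff hKc.measurableSet]
  refine Measure.integrableOn_of_bounded hKc.measure_lt_top.ne hm.aestronglyMeasurable
    (M := C₁ * C₃ * (C₂ * C₄)) (Eventually.of_forall fun z => ?_)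
  unfold quadInt
  rw [norm_mul, RCLike.norm_conj, norm_mul, norm_mul]
  gcongr <;> apply_assumption

theorem conv {a b : ℝ → ℂ} (ha : BddSupp a) (hb : BddSupp b) :
    BddSupp fun s => ∫ x, a x * b (s - x) := by
  obtain ⟨C₁, p₁, b₁, s₁⟩ := ha.exists_pos
  obtain ⟨C₂, p₂, b₂, s₂⟩ := hb.exists_pos
  have ma := ha.meas
  have mb := hb.meas
  refine ⟨?_, ⟨(∫ x, ‖a x‖) * C₂, fun s => ?_⟩, C₁ + C₂, fun s hs => ?_⟩
  · have : Measurable fun z : ℝ × ℝ => a z.2 * b (z.1 - z.2) := by fun_prop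
    exact this.stronglyMeasurable.integral_prod_right'.measurable
  · rw [← integral_mul_const]
    refine norm_integral_le_of_norm_le (ha.integrable.norm.mul_const _) (Eventually.of_forall
      fun x => ?_)
    rw [norm_mul]
    gcongr
    exact b₂ _
  · by_contra hc
    refine hs (integral_eq_zero_of_ae (Eventually.of_forall fun x => ?_))
    by_contra h0
    have a1 := s₁ x (left_ne_zero_of_mul h0)
    have a2 := s₂ _ (right_ne_zero_of_mul h0)
    refine hc ?_
    calc |s| = |x + (s - x)| := by ring_nf
      _ ≤ _ := (abs_add_le _ _).trans (add_le_add a1 a2)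

end BddSupp

theorem fourier_conv {a b : ℝ → ℂ} (ha : BddSupp a) (hb : BddSupp b) (ξ : ℝ) :
    𝓕 (fun s => ∫ x, a x * b (s - x)) ξ = 𝓕 a ξ * 𝓕 b ξ :=
  Real.fourier_mul_convolution_eq ha.integrable hb.integrable ξ

/-- Pairing the conjugated factors 1, 3 and the others 2, 4, each product is the transform of a
convolution. Plancherel then gives the inner product of two convolutions, with s as common total. -/
theorem integral_quad_fourier {v₁ v₂ v₃ v₄ : ℝ → ℂ} (h₁ : BddSupp v₁) (h₂ : BddSupp v₂)
    (h₃ : BddSupp v₃) (h₄ : BddSupp v₄) :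
    ∫ x, starRingEnd ℂ (𝓕 v₁ x) * 𝓕 v₂ x * starRingEnd ℂ (𝓕 v₃ x) * 𝓕 v₄ x =
      ∫ z, quadInt v₁ v₂ v₃ v₄ z := by
  have h13 := h₁.conv h₃
  have h24 := h₂.conv h₄
  have hint := BddSupp.integrable_quadInt h₁ h₂ h₃ h₄
  calc _ = ∫ x, starRingEnd ℂ (𝓕 (fun s => ∫ x, v₁ x * v₃ (s - x)) x) *
        𝓕 (fun s => ∫ x, v₂ x * v₄ (s - x)) x := by
        refine integral_congr_ae (Eventually.of_forall fun x => ?_)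
        simp only
        rw [fourier_conv h₁ h₃, fourier_conv h₂ h₄, map_mul]
        ring
    _ = ∫ s, starRingEnd ℂ (∫ x, v₁ x * v₃ (s - x)) * ∫ x, v₂ x * v₄ (s - x) :=
        integral_conj_fourier_mul_fourier h13.integrable (h13.memLp 2) h24.integrable (h24.memLp 2)
    _ = ∫ s, ∫ y : ℝ × ℝ, quadInt v₁ v₂ v₃ v₄ (s, y) := by
        refine integral_congr_ae (Eventually.of_forall fun s => ?_)
        simp only [quadInt]
        rw [← integral_conj, Measure.volume_eq_prod, integral_prod_mul
          (fun x => starRingEnd ℂ (v₁ x * v₃ (s - x))) (fun y => v₂ y * v₄ (s - y))]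
    _ = _ := by
        rw [Measure.volume_eq_prod] at hint ⊢
        exact (integral_prod _ hint).symm

theorem integral_quad_fourierInv {v₁ v₂ v₃ v₄ : ℝ → ℂ} (h₁ : BddSupp v₁) (h₂ : BddSupp v₂)
    (h₃ : BddSupp v₃) (h₄ : BddSupp v₄) :
    ∫ x, starRingEnd ℂ (𝓕⁻ v₁ x) * 𝓕⁻ v₂ x * starRingEnd ℂ (𝓕⁻ v₃ x) * 𝓕⁻ v₄ x =
      ∫ z, quadInt v₁ v₂ v₃ v₄ z := by
  rw [← integral_quad_fourier h₁ h₂ h₃ h₄, ← integral_neg_eq_self]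
  simp only [Real.fourierInv_eq_fourier_neg, neg_neg]

theorem fourierInv_toLp_ae_eq {v : ℝ → ℂ} (h1 : Integrable v) (h2 : MemLp v 2) :
    ((𝓕⁻ (h2.toLp v) : L2) : ℝ → ℂ) =ᵐ[volume] 𝓕⁻ v := by
  have h1' : Integrable fun x => v (-x) := h1.comp_neg
  have h2' : MemLp (fun x => v (-x)) 2 := h2.comp_measurePreserving (Measure.measurePreserving_neg _)
  have hcont : Continuous (𝓕⁻ v) := continuous_fourierInv h1
  refine ae_eq_of_integral_contDiff_smul_eq
    ((Lp.memLp (𝓕⁻ (h2.toLp v) : L2)).locallyIntegrable one_le_two) hcont.locallyIntegrable ?_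
  intro g hg hgc
  have hgC : ContDiff ℝ (⊤ : ℕ∞) (fun x => (g x : ℂ)) := Complex.ofRealCLM.contDiff.comp hg
  have hgCc : HasCompactSupport (fun x => (g x : ℂ)) := hgc.comp_left Complex.ofReal_zero
  set G : 𝓢(ℝ, ℂ) := hgCc.toSchwartzMap hgC with hG
  have hGx : ∀ x, G x = (g x : ℂ) := fun x => rfl
  have e1 := congrArg (fun T : 𝓢'(ℝ, ℂ) => T G) (Lp.fourierInv_toTemperedDistribution_eq (h2.toLp v))
  simp only [TemperedDistribution.fourierInv_apply, Lp.toTemperedDistribution_apply] at e1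
  have e2 : ∫ x, (𝓕⁻ G) x • (h2.toLp v) x = ∫ x, (𝓕⁻ G) x • v x := by
    refine integral_congr_ae ?_
    filter_upwards [h2.coeFn_toLp] with x hx
    rw [hx]
  have e3 : ∫ x, (𝓕⁻ G) x • v x = ∫ x, G x • 𝓕⁻ v x := by
    have := VectorFourier.integral_fourierIntegral_smul_eq_flip (L := innerₗ ℝ)
      Real.continuous_fourierChar continuous_inner (f := (G : ℝ → ℂ)) (g := fun x => v (-x))
      (μ := volume) (ν := volume) G.integrable h1'
    rw [flip_innerₗ] at this
    rw [Real.fourierInv_eq_fourier_comp_neg]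
    refine Eq.trans ?_ this
    rw [← integral_neg_eq_self]
    refine integral_congr_ae (Eventually.of_forall fun x => ?_)
    simp only [SchwartzMap.fourierInv_coe, Real.fourierInv_eq_fourier_neg, neg_neg]
    rfl
  have : ∫ x, G x • ((𝓕⁻ (h2.toLp v) : L2) : ℝ → ℂ) x = ∫ x, G x • 𝓕⁻ v x := by
    rw [← e3, ← e2, e1]
  simpa [hGx] using this

end DispersionManagement

/-! ### Approximation in L², the Schrödinger group and the phase of the four-linear form. -/

namespace DispersionManagement

open Filter Topology

theorem tendsto_toLp_of_dominated {F : ℕ → ℝ → ℂ} {g : ℝ → ℂ} {b : ℝ → ℝ}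
    (hF : ∀ n, MemLp (F n) 2) (hg : MemLp g 2) (hb : MemLp b 2)
    (bound : ∀ n, ∀ᵐ x, ‖F n x‖ ≤ b x)
    (lim : ∀ᵐ x, Tendsto (fun n => F n x) atTop (𝓝 (g x))) :
    Tendsto (fun n => (hF n).toLp (F n)) atTop (𝓝 (hg.toLp g)) := by
  rw [Lp.tendsto_Lp_iff_tendsto_eLpNorm'']
  have hgb : ∀ᵐ x, ‖g x‖ ≤ b x := by
    filter_upwards [lim, ae_all_iff.2 bound] with x h1 h2
    exact le_of_tendsto h1.norm (Eventually.of_forall h2)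
  have h0 : Tendsto (fun n => ∫⁻ x, ‖F n x - g x‖ₑ ^ (2 : ℝ)) atTop (𝓝 (∫⁻ _ : ℝ, 0)) := by
    refine tendsto_lintegral_of_dominated_convergence' (fun x => ‖2 * b x‖ₑ ^ (2 : ℝ))
      (fun n => ((hF n).aestronglyMeasurable.sub hg.aestronglyMeasurable).enorm.pow_const _)
      (fun n => ?_) ?_ ?_
    · filter_upwards [bound n, hgb] with x h1 h2
      gcongr
      refine enorm_le_iff_norm_le.2 ?_
      rw [norm_mul, Real.norm_two]
      refine (norm_sub_le _ _).trans ?_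
      linarith [Real.le_norm_self (b x)]
    · have := (hb.const_mul 2).eLpNorm_lt_top
      rw [eLpNorm_eq_lintegral_rpow_enorm_toReal two_ne_zero ENNReal.ofNat_ne_top] at this
      have h2 := (ENNReal.rpow_lt_top_iff_of_pos (by norm_num)).1 this
      simpa using h2.ne
    · filter_upwards [lim] with x hx
      have h1 : Tendsto (fun n => F n x - g x) atTop (𝓝 0) := by
        simpa using hx.sub (tendsto_const_nhds (x := g x))
      have h2 := (ENNReal.continuous_rpow_const (y := (2 : ℝ))).tendsto (‖(0 : ℂ)‖ₑ) |>.comp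
        ((continuous_enorm.tendsto (0 : ℂ)).comp h1)
      simpa [Function.comp_def, ENNReal.zero_rpow_of_pos] using h2
  have h1 := (ENNReal.continuous_rpow_const (y := (1 / 2 : ℝ))).tendsto _ |>.comp h0
  simp only [lintegral_zero, ENNReal.zero_rpow_of_pos (show (0 : ℝ) < 1 / 2 by norm_num)] at h1
  refine h1.congr fun n => ?_
  rw [eLpNorm_eq_lintegral_rpow_enorm_toReal two_ne_zero ENNReal.ofNat_ne_top]
  simp

/-- Every element of `L²` is a limit of bounded functions of bounded support, dominated by it. -/
theorem exists_bddSupp_tendsto (f : L2) :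
    ∃ v : ℕ → ℝ → ℂ, ∃ hv : ∀ n, BddSupp (v n), (∀ n x, ‖v n x‖ ≤ ‖f x‖) ∧
      Tendsto (fun n => ((hv n).memLp 2).toLp (v n)) atTop (𝓝 f) := by
  have mf : Measurable f := (Lp.stronglyMeasurable f).measurable
  set S : ℕ → Set ℝ := fun n => {x | ‖f x‖ ≤ n ∧ |x| ≤ n} with hS
  have mS : ∀ n, MeasurableSet (S n) := fun n =>
    MeasurableSet.inter (s₁ := {x | ‖f x‖ ≤ n}) (s₂ := {x | |x| ≤ n})
      (measurableSet_le (by fun_prop) (by fun_prop)) (measurableSet_le (by fun_prop) (by fun_prop))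
  have hv : ∀ n, BddSupp ((S n).indicator f) := fun n => by
    refine ⟨mf.indicator (mS n), ⟨n, fun x => ?_⟩, n, fun x hx => (mem_of_indicator_ne_zero hx).2⟩
    by_cases hx : x ∈ S n
    · rw [indicator_of_mem hx]; exact hx.1
    · rw [indicator_of_notMem hx]; simp
  have hle : ∀ n x, ‖(S n).indicator f x‖ ≤ ‖f x‖ := fun n x => norm_indicator_le_norm_self _ _
  refine ⟨_, hv, hle, ?_⟩
  have := tendsto_toLp_of_dominated (fun n => (hv n).memLp 2) (Lp.memLp f) (Lp.memLp f).norm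
    (fun n => Eventually.of_forall (hle n)) (Eventually.of_forall fun x => by
      refine tendsto_const_nhds.congr' ?_
      obtain ⟨N, hN⟩ := exists_nat_ge (max ‖f x‖ |x|)
      filter_upwards [eventually_ge_atTop N] with n hn
      have : (N : ℝ) ≤ n := by exact_mod_cast hn
      rw [indicator_of_mem]
      exact ⟨(le_max_left _ _).trans (hN.trans this), (le_max_right _ _).trans (hN.trans this)⟩)
  rwa [Lp.toLp_coeFn] at this

/-! ### The Schrödinger group -/

theorem measurable_schrodingerSymbol (r : ℝ) : Measurable (schrodingerSymbol r) := by
  unfold schrodingerSymbol; fun_prop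

theorem T_sub (r : ℝ) (f g : L2) : T r (f - g) = T r f - T r g := by
  have h : MemLp.toLp _ (memLp_schrodingerSymbol_mul r (𝓕 (f - g))) =
      MemLp.toLp _ (memLp_schrodingerSymbol_mul r (𝓕 f)) -
      MemLp.toLp _ (memLp_schrodingerSymbol_mul r (𝓕 g)) := by
    rw [← MemLp.toLp_sub, MemLp.toLp_eq_toLp_iff]
    have e : (𝓕 (f - g) : L2) = 𝓕 f - 𝓕 g := (Lp.fourierTransformₗᵢ ℝ ℂ).map_sub f g
    rw [e]
    filter_upwards [Lp.coeFn_sub (𝓕 f : L2) (𝓕 g)] with x hx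
    rw [hx, Pi.sub_apply, Pi.sub_apply, mul_sub]
  unfold T
  rw [h]
  exact (Lp.fourierTransformₗᵢ ℝ ℂ).symm.map_sub _ _

theorem norm_T (r : ℝ) (f : L2) : ‖T r f‖ = ‖f‖ := by
  have h1 : ‖T r f‖ = ‖MemLp.toLp _ (memLp_schrodingerSymbol_mul r (𝓕 f))‖ :=
    (Lp.fourierTransformₗᵢ ℝ ℂ).symm.norm_map _
  rw [h1, ← Lp.norm_fourier_eq f, Lp.norm_toLp, Lp.norm_def]
  congr 1
  refine eLpNorm_congr_norm_ae (Eventually.of_forall fun x => ?_)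
  rw [norm_mul, norm_schrodingerSymbol, one_mul]

theorem BddSupp.schrodinger {v : ℝ → ℂ} (hv : BddSupp v) (r : ℝ) :
    BddSupp fun ξ => schrodingerSymbol r ξ * v ξ :=
  hv.mul_left (measurable_schrodingerSymbol r) fun x => (norm_schrodingerSymbol r x).le

theorem T_ae_eq_of_fourier {f : L2} {v : ℝ → ℂ} (hv : BddSupp v) (hf : 𝓕 f = (hv.memLp 2).toLp v)
    (r : ℝ) : (T r f : ℝ → ℂ) =ᵐ[volume] 𝓕⁻ fun ξ => schrodingerSymbol r ξ * v ξ := by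
  have h : MemLp.toLp _ (memLp_schrodingerSymbol_mul r (𝓕 f)) =
      ((hv.schrodinger r).memLp 2).toLp _ := by
    rw [MemLp.toLp_eq_toLp_iff, hf]
    filter_upwards [(hv.memLp 2).coeFn_toLp] with x hx
    rw [hx]
  unfold T
  rw [h]
  exact fourierInv_toLp_ae_eq (hv.schrodinger r).integrable _

/-! ### The form `N4` and integrals over the product space -/

theorem kw_anti {s t : ℝ} (h : |s| ≤ |t|) : kw t ≤ kw s := by
  have h' : ‖s‖ₑ ≤ ‖t‖ₑ := enorm_le_iff_norm_le.2 h
  unfold kw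
  refine min_le_min (ENNReal.inv_le_inv.2 h') ?_
  rw [ENNReal.rpow_neg, ENNReal.rpow_neg]
  exact ENNReal.inv_le_inv.2 (ENNReal.rpow_le_rpow h' (by norm_num))

theorem kw_div_two_le (t : ℝ) : kw (t / 2) ≤ 2 * kw t := by
  rcases eq_or_ne t 0 with rfl | ht
  · rw [zero_div]; exact le_mul_of_one_le_left zero_le one_le_two
  have h0 : 0 < |t| := abs_pos.2 ht
  have h0' : 0 < |t / 2| := abs_pos.2 (by positivity)
  unfold kw
  rw [Real.enorm_eq_ofReal_abs, Real.enorm_eq_ofReal_abs, ENNReal.ofReal_rpow_of_pos h0,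
    ENNReal.ofReal_rpow_of_pos h0', ← ENNReal.ofReal_inv_of_pos h0, ← ENNReal.ofReal_inv_of_pos h0',
    ← ENNReal.ofReal_min, ← ENNReal.ofReal_min, show (2 : ℝ≥0∞) = ENNReal.ofReal 2 by simp,
    ← ENNReal.ofReal_mul zero_le_two]
  refine ENNReal.ofReal_le_ofReal ?_
  rw [mul_min_of_nonneg _ _ zero_le_two, abs_div, abs_two]
  refine min_le_min (by field_simp; exact le_rfl) ?_
  rw [Real.div_rpow h0.le zero_le_two, div_eq_mul_inv, mul_comm]
  gcongr
  rw [← Real.rpow_neg zero_le_two]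
  calc (2 : ℝ) ^ (-(-(1 / 4)) : ℝ) ≤ 2 ^ (1 : ℝ) :=
        Real.rpow_le_rpow_of_exponent_le one_le_two (by norm_num)
    _ = 2 := Real.rpow_one 2

theorem lintegral_kw_quadInt {v₁ v₂ v₃ v₄ : ℝ → ℂ} (h₁ : Measurable v₁) (h₂ : Measurable v₂)
    (h₃ : Measurable v₃) (h₄ : Measurable v₄) :
    ∫⁻ z : ℝ × ℝ × ℝ, kw ((z.2.2 - z.2.1) * (z.2.1 + z.2.2 - z.1)) * ‖quadInt v₁ v₂ v₃ v₄ z‖ₑ =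
      N4 (fun x => ‖v₁ x‖ₑ) (fun x => ‖v₂ x‖ₑ) (fun x => ‖v₃ x‖ₑ) (fun x => ‖v₄ x‖ₑ) := by
  have e : ∀ z : ℝ × ℝ × ℝ, ‖quadInt v₁ v₂ v₃ v₄ z‖ₑ =
      ‖v₁ z.2.1‖ₑ * ‖v₃ (z.1 - z.2.1)‖ₑ * (‖v₂ z.2.2‖ₑ * ‖v₄ (z.1 - z.2.2)‖ₑ) := fun z => by
    unfold quadInt
    rw [enorm_mul, enorm_mul, RCLike.enorm_conj, enorm_mul]
  simp_rw [e]
  rw [Measure.volume_eq_prod, lintegral_prod _ (by fun_prop)]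
  unfold N4
  refine lintegral_congr fun s => ?_
  rw [Measure.volume_eq_prod, lintegral_prod _ (by fun_prop)]

theorem N4_mono {p₁ p₂ p₃ p₄ q₁ q₂ q₃ q₄ : ℝ → ℝ≥0∞} (h₁ : ∀ x, p₁ x ≤ q₁ x)
    (h₂ : ∀ x, p₂ x ≤ q₂ x) (h₃ : ∀ x, p₃ x ≤ q₃ x) (h₄ : ∀ x, p₄ x ≤ q₄ x) :
    N4 p₁ p₂ p₃ p₄ ≤ N4 q₁ q₂ q₃ q₄ := by
  unfold N4
  gcongr <;> apply_assumption

/-- The resonance identity x² + (s - x)² - y² - (s - y)² = -2(y - x)(x + y - s), multiplied by 4π².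
-/
theorem schrodinger_quadInt (r : ℝ) (v₁ v₂ v₃ v₄ : ℝ → ℂ) (z : ℝ × ℝ × ℝ) :
    quadInt (fun ξ => schrodingerSymbol r ξ * v₁ ξ) (fun ξ => schrodingerSymbol r ξ * v₂ ξ)
      (fun ξ => schrodingerSymbol r ξ * v₃ ξ) (fun ξ => schrodingerSymbol r ξ * v₄ ξ) z =
    Complex.exp (Complex.I * ((-(8 * Real.pi ^ 2 * ((z.2.2 - z.2.1) * (z.2.1 + z.2.2 - z.1))) : ℝ) : ℂ)
      * r) * quadInt v₁ v₂ v₃ v₄ z := by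
  have hc : ∀ ξ : ℝ, starRingEnd ℂ (schrodingerSymbol r ξ) =
      Complex.exp (Complex.I * r * (2 * Real.pi * ξ) ^ 2) := fun ξ => by
    unfold schrodingerSymbol
    rw [← Complex.exp_conj]
    have h2 : starRingEnd ℂ (2 : ℂ) = 2 := Complex.conj_ofNat 2
    simp [h2]
  unfold quadInt
  simp only [map_mul, hc]
  unfold schrodingerSymbol
  rw [show Complex.I * ((-(8 * Real.pi ^ 2 * ((z.2.2 - z.2.1) * (z.2.1 + z.2.2 - z.1))) : ℝ) : ℂ) * r =
    Complex.I * r * (2 * Real.pi * z.2.1) ^ 2 +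
    Complex.I * r * (2 * Real.pi * ((z.1 - z.2.1 : ℝ) : ℂ)) ^ 2 +
    -(Complex.I * r * (2 * Real.pi * z.2.2) ^ 2) +
    -(Complex.I * r * (2 * Real.pi * ((z.1 - z.2.2 : ℝ) : ℂ)) ^ 2) by push_cast; ring,
    Complex.exp_add, Complex.exp_add, Complex.exp_add]
  ring

end DispersionManagement

/-! ### Frequency representation of the spatial integral and the space-time L⁴ bound. -/

namespace DispersionManagement

open Filter Topology

/-- The spatial integral in the definition of `Q`. -/
noncomputable def qint (r : ℝ) (f₁ f₂ f₃ f₄ : L2) : ℂ :=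
  ∫ x, starRingEnd ℂ (T r f₁ x) * T r f₂ x * starRingEnd ℂ (T r f₃ x) * T r f₄ x

/-- The product measure on the space-time strip `(0, L] × ℝ`. -/
noncomputable abbrev strip (L : ℝ) : Measure (ℝ × ℝ) :=
  (volume.restrict (Ioc 0 L)).prod volume

/-- `U` represents the evolution `(s, x) ↦ (T_{D(s)} f)(x)` on the strip. -/
structure IsEvol (L : ℝ) (D : ℝ → ℝ) (f : L2) (U : ℝ × ℝ → ℂ) : Prop where
  meas : AEStronglyMeasurable U (strip L)
  slice : ∀ᵐ s ∂volume.restrict (Ioc 0 L), (fun x => U (s, x)) =ᵐ[volume] T (D s) f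

variable {L : ℝ} {D : ℝ → ℝ}

/-- Slices determine the function through Fubini, which needs a measurable coincidence set; hence
the passage to strongly measurable representatives. -/
theorem IsEvol.ae_eq {f : L2} {U V : ℝ × ℝ → ℂ} (hU : IsEvol L D f U) (hV : IsEvol L D f V) :
    U =ᵐ[strip L] V := by
  have hU' := hU.meas.ae_eq_mk
  have hV' := hV.meas.ae_eq_mk
  have h : ∀ᵐ z ∂strip L, hU.meas.mk U z = hV.meas.mk V z := by
    rw [Measure.ae_prod_iff_ae_ae (measurableSet_eq_fun hU.meas.stronglyMeasurable_mk.measurable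
      hV.meas.stronglyMeasurable_mk.measurable)]
    filter_upwards [Measure.ae_ae_of_ae_prod hU', Measure.ae_ae_of_ae_prod hV', hU.slice,
      hV.slice] with s h1 h2 h3 h4
    filter_upwards [h1, h2, h3, h4] with x h1 h2 h3 h4
    rw [← h1, ← h2, h3, h4]
  filter_upwards [h, hU', hV'] with z h1 h2 h3
  rw [h2, h3, h1]

theorem IsEvol.congr {f : L2} {U V : ℝ × ℝ → ℂ} (hU : IsEvol L D f U) (h : U =ᵐ[strip L] V) :
    IsEvol L D f V := by
  refine ⟨hU.meas.congr h, ?_⟩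
  filter_upwards [hU.slice, Measure.ae_ae_of_ae_prod h] with s h1 h2
  filter_upwards [h1, h2] with x h1 h2
  rw [← h2, h1]

theorem IsEvol.sub {f g : L2} {U V : ℝ × ℝ → ℂ} (hU : IsEvol L D f U) (hV : IsEvol L D g V) :
    IsEvol L D (f - g) (U - V) := by
  refine ⟨hU.meas.sub hV.meas, ?_⟩
  filter_upwards [hU.slice, hV.slice] with s h1 h2
  rw [T_sub]
  filter_upwards [h1, h2, Lp.coeFn_sub (T (D s) f) (T (D s) g)] with x h1 h2 h3
  rw [h3, Pi.sub_apply, Pi.sub_apply, h1, h2]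

/-- The explicit evolution of a function whose Fourier transform `v` is bounded with bounded
support. -/
noncomputable def evol (D : ℝ → ℝ) (v : ℝ → ℂ) (z : ℝ × ℝ) : ℂ :=
  𝓕⁻ (fun ξ => schrodingerSymbol (D z.1) ξ * v ξ) z.2

theorem stronglyMeasurable_evol (hD : Measurable D) {v : ℝ → ℂ} (hv : BddSupp v) :
    StronglyMeasurable (evol D v) := by
  have e : evol D v = fun z : ℝ × ℝ => ∫ ξ : ℝ,
      Complex.exp ((2 * Real.pi * (z.2 * ξ) : ℝ) * Complex.I) *
        (schrodingerSymbol (D z.1) ξ * v ξ) := by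
    ext z
    simp only [evol, Real.fourierInv_eq', smul_eq_mul]
    rfl
  have hv' := hv.meas
  have hm : Measurable fun p : (ℝ × ℝ) × ℝ => Complex.exp ((2 * Real.pi * (p.1.2 * p.2) : ℝ) *
      Complex.I) * (schrodingerSymbol (D p.1.1) p.2 * v p.2) := by
    unfold schrodingerSymbol; fun_prop
  rw [e]
  exact hm.stronglyMeasurable.integral_prod_right'

theorem isEvol_evol (hD : Measurable D) {f : L2} {v : ℝ → ℂ} (hv : BddSupp v)
    (hf : 𝓕 f = (hv.memLp 2).toLp v) : IsEvol L D f (evol D v) :=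
  ⟨(stronglyMeasurable_evol hD hv).aestronglyMeasurable, Eventually.of_forall fun s =>
    (T_ae_eq_of_fourier hv hf (D s)).symm⟩

theorem qint_eq_of_fourier {f₁ f₂ f₃ f₄ : L2} {v₁ v₂ v₃ v₄ : ℝ → ℂ} (h₁ : BddSupp v₁)
    (h₂ : BddSupp v₂) (h₃ : BddSupp v₃) (h₄ : BddSupp v₄)
    (e₁ : 𝓕 f₁ = (h₁.memLp 2).toLp v₁) (e₂ : 𝓕 f₂ = (h₂.memLp 2).toLp v₂)
    (e₃ : 𝓕 f₃ = (h₃.memLp 2).toLp v₃) (e₄ : 𝓕 f₄ = (h₄.memLp 2).toLp v₄) (r : ℝ) :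
    qint r f₁ f₂ f₃ f₄ = ∫ z : ℝ × ℝ × ℝ,
      Complex.exp (Complex.I * ((-(8 * Real.pi ^ 2 *
        ((z.2.2 - z.2.1) * (z.2.1 + z.2.2 - z.1))) : ℝ) : ℂ) * r) * quadInt v₁ v₂ v₃ v₄ z := by
  simp_rw [← schrodinger_quadInt]
  rw [← integral_quad_fourierInv (h₁.schrodinger r) (h₂.schrodinger r) (h₃.schrodinger r)
    (h₄.schrodinger r)]
  refine integral_congr_ae ?_
  filter_upwards [T_ae_eq_of_fourier h₁ e₁ r, T_ae_eq_of_fourier h₂ e₂ r,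
    T_ae_eq_of_fourier h₃ e₃ r, T_ae_eq_of_fourier h₄ e₄ r] with x h1 h2 h3 h4
  rw [h1, h2, h3, h4]

theorem norm_exp_I_mul_ofReal (a b : ℝ) : ‖Complex.exp (Complex.I * (a : ℂ) * b)‖ = 1 := by
  rw [show Complex.I * (a : ℂ) * b = ((a * b : ℝ) : ℂ) * Complex.I by push_cast; ring,
    Complex.norm_exp_ofReal_mul_I]

/-- Bound of an oscillatory integral by the positive form, given a bound for its kernel. -/
theorem enorm_integral_quadInt_le {K : ℝ → ℝ × ℝ × ℝ → ℂ} (hL : 0 ≤ L)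
    (hK : Measurable (Function.uncurry K)) {B : ℝ} (hB : ∀ s z, ‖K s z‖ ≤ B) {c : ℝ≥0∞}
    (hc : c ≠ ⊤)
    (hKc : ∀ z : ℝ × ℝ × ℝ, ‖∫ s in (0 : ℝ)..L, K s z‖ₑ ≤
      c * kw ((z.2.2 - z.2.1) * (z.2.1 + z.2.2 - z.1)))
    {v₁ v₂ v₃ v₄ : ℝ → ℂ} (h₁ : BddSupp v₁) (h₂ : BddSupp v₂) (h₃ : BddSupp v₃)
    (h₄ : BddSupp v₄) :
    ‖∫ s in (0 : ℝ)..L, ∫ z, K s z * quadInt v₁ v₂ v₃ v₄ z‖ₑ ≤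
      c * N4 (fun x => ‖v₁ x‖ₑ) (fun x => ‖v₂ x‖ₑ) (fun x => ‖v₃ x‖ₑ) (fun x => ‖v₄ x‖ₑ) := by
  have hq := BddSupp.integrable_quadInt h₁ h₂ h₃ h₄
  have hint : Integrable (Function.uncurry fun s z => K s z * quadInt v₁ v₂ v₃ v₄ z)
      ((volume.restrict (Ioc 0 L)).prod volume) := by
    have := (hq.comp_snd (volume.restrict (Ioc 0 L))).bdd_mul (c := B)
      hK.aestronglyMeasurable (Eventually.of_forall fun p => hB p.1 p.2)
    exact this
  rw [intervalIntegral.integral_of_le hL, integral_integral_swap hint]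
  refine (enorm_integral_le_lintegral_enorm _).trans ?_
  rw [← lintegral_kw_quadInt h₁.meas h₂.meas h₃.meas h₄.meas, ← lintegral_const_mul' _ _ hc]
  refine lintegral_mono fun z => ?_
  rw [integral_mul_const, enorm_mul, ← mul_assoc, ← intervalIntegral.integral_of_le hL]
  gcongr
  exact hKc z

/-- The factor 8π² in the phase exceeds 1, and `kw` decreases in |t|, so it can be dropped. -/
theorem enorm_integral_qint_le (hL : 0 ≤ L) (hD : Measurable D) {C : ℝ}
    (hC : ∀ t : ℝ, ‖∫ s in (0 : ℝ)..L, Complex.exp (Complex.I * t * D s)‖ₑ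
      ≤ ENNReal.ofReal C * kw t)
    {f₁ f₂ f₃ f₄ : L2} {v₁ v₂ v₃ v₄ : ℝ → ℂ} (h₁ : BddSupp v₁)
    (h₂ : BddSupp v₂) (h₃ : BddSupp v₃) (h₄ : BddSupp v₄)
    (e₁ : 𝓕 f₁ = (h₁.memLp 2).toLp v₁) (e₂ : 𝓕 f₂ = (h₂.memLp 2).toLp v₂)
    (e₃ : 𝓕 f₃ = (h₃.memLp 2).toLp v₃) (e₄ : 𝓕 f₄ = (h₄.memLp 2).toLp v₄) :
    ‖∫ s in (0 : ℝ)..L, qint (D s) f₁ f₂ f₃ f₄‖ₑ ≤ ENNReal.ofReal C *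
      N4 (fun x => ‖v₁ x‖ₑ) (fun x => ‖v₂ x‖ₑ) (fun x => ‖v₃ x‖ₑ) (fun x => ‖v₄ x‖ₑ) := by
  simp_rw [qint_eq_of_fourier h₁ h₂ h₃ h₄ e₁ e₂ e₃ e₄]
  refine enorm_integral_quadInt_le hL (by unfold Function.uncurry; fun_prop) (B := 1)
    (fun s z => (norm_exp_I_mul_ofReal _ _).le) ENNReal.ofReal_ne_top (fun z => ?_) h₁ h₂ h₃ h₄
  have h : ∀ x : ℝ, |x| ≤ |-(8 * Real.pi ^ 2 * x)| := fun x => by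
    rw [abs_neg, abs_mul, abs_of_nonneg (show 0 ≤ 8 * Real.pi ^ 2 by positivity)]
    exact le_mul_of_one_le_left (abs_nonneg x) (by nlinarith [Real.pi_gt_three])
  exact (hC _).trans (mul_le_mul_right (kw_anti (h _)) _)

theorem l2_enorm_coe (f : L2) : l2 (fun x => ‖f x‖ₑ) = ‖f‖ₑ := by
  rw [Lp.enorm_def, eLpNorm_eq_lintegral_rpow_enorm_toReal two_ne_zero ENNReal.ofNat_ne_top]
  simp [l2]

theorem l2_enorm_toLp {v : ℝ → ℂ} (hv : MemLp v 2) : l2 (fun x => ‖v x‖ₑ) = ‖hv.toLp v‖ₑ := by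
  rw [Lp.enorm_toLp, eLpNorm_eq_lintegral_rpow_enorm_toReal two_ne_zero ENNReal.ofNat_ne_top]
  simp [l2]

/-- The square of the inverse transform of w is the inverse transform of w convolved with itself,
which is in L². -/
theorem BddSupp.integrable_norm_fourierInv_pow_four {w : ℝ → ℂ} (hw : BddSupp w) :
    Integrable fun x => ‖𝓕⁻ w x‖ ^ 4 := by
  have hc := hw.conv hw
  have h1 : MemLp (𝓕⁻ (fun s => ∫ x, w x * w (s - x))) 2 :=
    (memLp_congr_ae (fourierInv_toLp_ae_eq hc.integrable (hc.memLp 2))).1 (Lp.memLp _)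
  have h2 := (memLp_two_iff_integrable_sq_norm h1.aestronglyMeasurable).1 h1
  refine h2.congr (Eventually.of_forall fun x => ?_)
  simp only [Real.fourierInv_eq_fourier_neg]
  rw [fourier_conv hw hw, norm_mul]
  ring

/-- A Strichartz-type bound: with four equal arguments the four-linear functional is the fourth
power of the L⁴ norm on the strip, and `N4_le` bounds it by the fourth power of the L² norm. -/
theorem eLpNorm_evol_le (hL : 0 ≤ L) (hD : Measurable D) {C : ℝ}
    (hC : ∀ t : ℝ, ‖∫ s in (0 : ℝ)..L, Complex.exp (Complex.I * t * D s)‖ₑ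
      ≤ ENNReal.ofReal C * kw t) {f : L2} {v : ℝ → ℂ} (hv : BddSupp v)
    (hf : 𝓕 f = (hv.memLp 2).toLp v) :
    eLpNorm (evol D v) 4 (strip L) ≤ (ENNReal.ofReal C * kapC) ^ (1 / 4 : ℝ) * ‖f‖ₑ := by
  have hm := stronglyMeasurable_evol hD hv
  have hq : ∀ s, qint (D s) f f f f = ((∫ x, ‖evol D v (s, x)‖ ^ 4 : ℝ) : ℂ) := by
    intro s
    unfold qint
    rw [← integral_complex_ofReal]
    refine integral_congr_ae ?_
    filter_upwards [T_ae_eq_of_fourier hv hf (D s)] with x hx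
    rw [hx]
    have e : ∀ z : ℂ, starRingEnd ℂ z * z * starRingEnd ℂ z * z = ((‖z‖ ^ 4 : ℝ) : ℂ) := fun z => by
      have := Complex.conj_mul' z
      calc _ = (starRingEnd ℂ z * z) ^ 2 := by ring
        _ = _ := by rw [this]; push_cast; ring
    exact e _
  have hin : ∀ s, ∫⁻ x, ‖evol D v (s, x)‖ₑ ^ (4 : ℝ) =
      ENNReal.ofReal (∫ x, ‖evol D v (s, x)‖ ^ 4) := by
    intro s
    have hi : Integrable fun x => ‖evol D v (s, x)‖ ^ 4 := by
      have h0 := BddSupp.integrable_norm_fourierInv_pow_four (hv.schrodinger (D s))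
      simpa only [evol] using h0
    rw [ofReal_integral_eq_lintegral_ofReal hi (Eventually.of_forall fun x => by positivity)]
    refine lintegral_congr fun x => ?_
    rw [ENNReal.ofReal_pow (norm_nonneg _), ofReal_norm]
    norm_cast
  have hqm : StronglyMeasurable fun s => ∫ x, ‖evol D v (s, x)‖ ^ 4 :=
    StronglyMeasurable.integral_prod_right' (f := fun z => ‖evol D v z‖ ^ 4) (hm.norm.pow 4)
  have hqi : IntegrableOn (fun s => ∫ x, ‖evol D v (s, x)‖ ^ 4) (Ioc 0 L) := by
    refine Measure.integrableOn_of_bounded (M := ∫ z, ‖quadInt v v v v z‖) (by simp)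
      hqm.aestronglyMeasurable (Eventually.of_forall fun s => ?_)
    have : ‖∫ x, ‖evol D v (s, x)‖ ^ 4‖ = ‖qint (D s) f f f f‖ := by
      rw [hq, Complex.norm_real]
    rw [this, qint_eq_of_fourier hv hv hv hv hf hf hf hf]
    refine norm_integral_le_of_norm_le (BddSupp.integrable_quadInt hv hv hv hv).norm
      (Eventually.of_forall fun z => ?_)
    rw [norm_mul, norm_exp_I_mul_ofReal, one_mul]
  have key : ∫⁻ z, ‖evol D v z‖ₑ ^ (4 : ℝ) ∂strip L ≤ ENNReal.ofReal C * kapC * ‖f‖ₑ ^ (4 : ℝ) := by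
    rw [lintegral_prod _ (by exact (hm.enorm.pow_const _).aemeasurable)]
    simp_rw [hin]
    have h1 := enorm_integral_qint_le hL hD hC hv hv hv hv hf hf hf hf
    rw [← ofReal_integral_eq_lintegral_ofReal hqi (Eventually.of_forall fun s =>
      integral_nonneg fun x => by positivity)]
    have h2 : ENNReal.ofReal (∫ s in Ioc 0 L, ∫ x, ‖evol D v (s, x)‖ ^ 4) =
        ‖∫ s in (0 : ℝ)..L, qint (D s) f f f f‖ₑ := by
      simp_rw [hq]
      rw [intervalIntegral.integral_ofReal, intervalIntegral.integral_of_le hL, ← ofReal_norm,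
        Complex.norm_real, Real.norm_of_nonneg]
      exact integral_nonneg fun s => integral_nonneg fun x => by positivity
    rw [h2]
    refine h1.trans ?_
    have m : Measurable fun x => ‖v x‖ₑ := hv.meas.enorm
    refine (mul_le_mul_right (N4_le m m m m) _).trans_eq ?_
    rw [l2_enorm_toLp (hv.memLp 2), ← hf]
    have : ‖(𝓕 f : L2)‖ₑ = ‖f‖ₑ := by rw [← ofReal_norm, Lp.norm_fourier_eq, ofReal_norm]
    rw [this, show ((4 : ℝ)) = ((4 : ℕ) : ℝ) by norm_num, ENNReal.rpow_natCast]
    ring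
  rw [eLpNorm_eq_lintegral_rpow_enorm_toReal (by norm_num) ENNReal.ofNat_ne_top]
  simp only [ENNReal.toReal_ofNat]
  calc _ ≤ (ENNReal.ofReal C * kapC * ‖f‖ₑ ^ (4 : ℝ)) ^ (1 / 4 : ℝ) := by gcongr
    _ = _ := by
      rw [ENNReal.mul_rpow_of_nonneg _ _ (by norm_num), ← ENNReal.rpow_mul]
      norm_num

end DispersionManagement

/-! ### The evolution of general L² data and continuity of the four-linear functional. -/

namespace DispersionManagement

open Filter Topology

variable {L : ℝ} {D : ℝ → ℝ}

instance fact_one_le_four : Fact ((1 : ℝ≥0∞) ≤ 4) := ⟨by norm_num⟩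

theorem BddSupp.sub {v w : ℝ → ℂ} (hv : BddSupp v) (hw : BddSupp w) : BddSupp (v - w) := by
  obtain ⟨B, hB⟩ := hv.bdd
  obtain ⟨B', hB'⟩ := hw.bdd
  obtain ⟨R, hR⟩ := hv.supp
  obtain ⟨R', hR'⟩ := hw.supp
  refine ⟨hv.meas.sub hw.meas, ⟨B + B', fun x => (norm_sub_le _ _).trans (add_le_add (hB x) (hB' x))⟩,
    max R R', fun x hx => ?_⟩
  by_cases h : v x = 0
  · refine (hR' x fun h' => hx ?_).trans (le_max_right _ _)
    rw [Pi.sub_apply, h, h', sub_zero]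
  · exact (hR x h).trans (le_max_left _ _)

/-- A first subsequence converges almost everywhere on the strip. For each good time a further one
makes the isometric images T(D(s))F converge almost everywhere in x, and the two limits agree. -/
theorem IsEvol.of_tendsto {f : L2} {F : ℕ → L2} (hF : Tendsto F atTop (𝓝 f))
    {u : Lp ℂ 4 (strip L)} {U : ℕ → Lp ℂ 4 (strip L)} (hU : Tendsto U atTop (𝓝 u))
    (h : ∀ n, IsEvol L D (F n) (U n)) : IsEvol L D f u := by
  refine ⟨Lp.aestronglyMeasurable u, ?_⟩
  obtain ⟨ns, hns, hlim⟩ := (tendstoInMeasure_of_tendsto_Lp hU).exists_seq_tendsto_ae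
  filter_upwards [Measure.ae_ae_of_ae_prod hlim, ae_all_iff.2 fun n => (h n).slice] with s h1 h2
  have hT : Tendsto (fun k => T (D s) (F (ns k))) atTop (𝓝 (T (D s) f)) := by
    rw [tendsto_iff_norm_sub_tendsto_zero]
    simp_rw [← T_sub, norm_T]
    rw [← tendsto_iff_norm_sub_tendsto_zero]
    exact hF.comp hns.tendsto_atTop
  obtain ⟨ms, hms, hlim'⟩ := (tendstoInMeasure_of_tendsto_Lp hT).exists_seq_tendsto_ae
  filter_upwards [h1, hlim', ae_all_iff.2 h2] with x h1 h3 h4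
  refine tendsto_nhds_unique ((h1.comp hms.tendsto_atTop).congr fun k => ?_) h3
  exact h4 _

theorem exists_evol (hL : 0 ≤ L) (hD : Measurable D) {C : ℝ}
    (hC : ∀ t : ℝ, ‖∫ s in (0 : ℝ)..L, Complex.exp (Complex.I * t * D s)‖ₑ
      ≤ ENNReal.ofReal C * kw t) :
    ∃ A : NNReal, ∀ f : L2, ∃ U : Lp ℂ 4 (strip L), IsEvol L D f U ∧ ‖U‖ ≤ A * ‖f‖ := by
  have hA : (ENNReal.ofReal C * kapC) ^ (1 / 4 : ℝ) ≠ ⊤ :=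
    ENNReal.rpow_ne_top_of_nonneg (by norm_num) (ENNReal.mul_ne_top ENNReal.ofReal_ne_top kapC_ne_top)
  set A : NNReal := ((ENNReal.ofReal C * kapC) ^ (1 / 4 : ℝ)).toNNReal with hAdef
  have hA' : (ENNReal.ofReal C * kapC) ^ (1 / 4 : ℝ) = A := (ENNReal.coe_toNNReal hA).symm
  have hnice : ∀ (f : L2) (v : ℝ → ℂ) (hv : BddSupp v), 𝓕 f = (hv.memLp 2).toLp v →
      ∃ U : Lp ℂ 4 (strip L), IsEvol L D f U ∧ ‖U‖ ≤ A * ‖f‖ := by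
    intro f v hv hf
    have hb := eLpNorm_evol_le hL hD hC hv hf
    have hE := isEvol_evol (L := L) hD hv hf
    rw [hA'] at hb
    have hm : MemLp (evol D v) 4 (strip L) := ⟨hE.meas, hb.trans_lt (by finiteness)⟩
    refine ⟨hm.toLp _, hE.congr hm.coeFn_toLp.symm, ?_⟩
    rw [Lp.norm_toLp]
    refine (ENNReal.toReal_mono (by finiteness) hb).trans_eq ?_
    simp
  refine ⟨A, fun f => ?_⟩
  obtain ⟨v, hv, -, hlim⟩ := exists_bddSupp_tendsto (𝓕 f)
  set F : ℕ → L2 := fun n => 𝓕⁻ ((hv n).memLp 2 |>.toLp (v n)) with hFdef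
  have hFf : ∀ n, 𝓕 (F n) = ((hv n).memLp 2).toLp (v n) := fun n =>
    FourierTransform.fourier_fourierInv_eq _
  have hF : Tendsto F atTop (𝓝 f) := by
    have := ((Lp.fourierTransformₗᵢ ℝ ℂ).symm.continuous.tendsto (𝓕 f)).comp hlim
    have e : (Lp.fourierTransformₗᵢ ℝ ℂ).symm (𝓕 f) = f :=
      (Lp.fourierTransformₗᵢ ℝ ℂ).symm_apply_apply f
    rw [e] at this
    exact this
  choose U hU hUn using fun n => hnice (F n) (v n) (hv n) (hFf n)
  -- The L⁴ bound applies to the difference of two nice data, whose evolution is U m - U n by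
  -- uniqueness; so the evolutions form a Cauchy sequence.
  have hdiff : ∀ m n, ‖U m - U n‖ ≤ A * ‖F m - F n‖ := by
    intro m n
    have e : 𝓕 (F m - F n) = (((hv m).sub (hv n)).memLp 2).toLp (v m - v n) := by
      have e1 : (𝓕 (F m - F n) : L2) = 𝓕 (F m) - 𝓕 (F n) :=
        (Lp.fourierTransformₗᵢ ℝ ℂ).map_sub _ _
      rw [e1, hFf, hFf, ← MemLp.toLp_sub]
    obtain ⟨W, hW, hWn⟩ := hnice _ _ ((hv m).sub (hv n)) e
    have h1 : IsEvol L D (F m - F n) (U m - U n : Lp ℂ 4 (strip L)) :=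
      ((hU m).sub (hU n)).congr (Lp.coeFn_sub _ _).symm
    rw [Lp.ext (h1.ae_eq hW)]
    exact hWn
  have hcau : CauchySeq U := by
    have h1 := hF.cauchySeq
    rw [Metric.cauchySeq_iff] at h1 ⊢
    intro ε hε
    obtain ⟨N, hN⟩ := h1 (ε / (A + 1)) (by positivity)
    refine ⟨N, fun m hm n hn => ?_⟩
    have h2 := hN m hm n hn
    rw [dist_eq_norm] at h2 ⊢
    rw [lt_div_iff₀ (by positivity)] at h2
    refine (hdiff m n).trans_lt (lt_of_le_of_lt ?_ h2)
    rw [mul_comm]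
    gcongr
    linarith
  obtain ⟨u, hu⟩ := cauchySeq_tendsto_of_complete hcau
  refine ⟨u, IsEvol.of_tendsto hF hu hU, ?_⟩
  exact le_of_tendsto_of_tendsto' hu.norm (hF.norm.const_mul _) hUn

instance holderTriple_four_four_two : ENNReal.HolderTriple 4 4 2 := by
  refine ⟨?_⟩
  rw [← two_mul, show (4 : ℝ≥0∞) = 2 * 2 by norm_num, ENNReal.mul_inv (by simp) (by simp),
    ← mul_assoc, ENNReal.mul_inv_cancel (by simp) (by simp), one_mul]

theorem integrable_qint_and_continuous (hL : 0 ≤ L) (hD : Measurable D) {C : ℝ}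
    (hC : ∀ t : ℝ, ‖∫ s in (0 : ℝ)..L, Complex.exp (Complex.I * t * D s)‖ₑ
      ≤ ENNReal.ofReal C * kw t) :
    (∀ f₁ f₂ f₃ f₄, IntegrableOn (fun s => qint (D s) f₁ f₂ f₃ f₄) (Ioc 0 L)) ∧
    Continuous fun p : L2 × L2 × L2 × L2 =>
      ∫ s in (0 : ℝ)..L, qint (D s) p.1 p.2.1 p.2.2.1 p.2.2.2 := by
  obtain ⟨A, hA⟩ := exists_evol hL hD hC
  choose U hU hUn using hA
  have hcont : Continuous U := by
    refine (LipschitzWith.of_dist_le_mul (K := A) fun f g => ?_).continuous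
    rw [dist_eq_norm, dist_eq_norm]
    have h1 : IsEvol L D (f - g) (U f - U g : Lp ℂ 4 (strip L)) :=
      ((hU f).sub (hU g)).congr (Lp.coeFn_sub _ _).symm
    rw [Lp.ext (h1.ae_eq (hU (f - g)))]
    exact hUn _
  -- By Hölder the products U₁U₃ and U₂U₄ lie in L² of the strip. The functional is their inner
  -- product, hence jointly continuous.
  set B := (ContinuousLinearMap.mul ℂ ℂ).holderL (strip L) 4 4 2 with hB
  have hBe : ∀ f g, (B (U f) (U g) : ℝ × ℝ → ℂ) =ᵐ[strip L] fun z => U f z * U g z := fun f g =>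
    ContinuousLinearMap.coeFn_holder _ _ _
  have hint : ∀ f₁ f₂ f₃ f₄, Integrable (fun z => starRingEnd ℂ (U f₁ z) * U f₂ z *
      starRingEnd ℂ (U f₃ z) * U f₄ z) (strip L) ∧ ∫ z, (starRingEnd ℂ (U f₁ z) * U f₂ z *
      starRingEnd ℂ (U f₃ z) * U f₄ z) ∂strip L = ⟪B (U f₁) (U f₃), B (U f₂) (U f₄)⟫_ℂ := by
    intro f₁ f₂ f₃ f₄
    have h := L2.integrable_inner (𝕜 := ℂ) (B (U f₁) (U f₃)) (B (U f₂) (U f₄))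
    have e : (fun z => ⟪B (U f₁) (U f₃) z, B (U f₂) (U f₄) z⟫_ℂ) =ᵐ[strip L]
        fun z => starRingEnd ℂ (U f₁ z) * U f₂ z * starRingEnd ℂ (U f₃ z) * U f₄ z := by
      filter_upwards [hBe f₁ f₃, hBe f₂ f₄] with z h1 h2
      rw [h1, h2, RCLike.inner_apply, map_mul]
      ring
    exact ⟨h.congr e, by rw [L2.inner_def, integral_congr_ae e]⟩
  have hsl : ∀ f₁ f₂ f₃ f₄, (fun s => ∫ x, (starRingEnd ℂ (U f₁ (s, x)) * U f₂ (s, x) *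
      starRingEnd ℂ (U f₃ (s, x)) * U f₄ (s, x))) =ᵐ[volume.restrict (Ioc 0 L)]
      fun s => qint (D s) f₁ f₂ f₃ f₄ := by
    intro f₁ f₂ f₃ f₄
    filter_upwards [(hU f₁).slice, (hU f₂).slice, (hU f₃).slice, (hU f₄).slice] with s h1 h2 h3 h4
    refine integral_congr_ae ?_
    filter_upwards [h1, h2, h3, h4] with x h1 h2 h3 h4
    rw [h1, h2, h3, h4]
  have hval : ∀ f₁ f₂ f₃ f₄, ∫ s in (0 : ℝ)..L, qint (D s) f₁ f₂ f₃ f₄ =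
      ⟪B (U f₁) (U f₃), B (U f₂) (U f₄)⟫_ℂ := fun f₁ f₂ f₃ f₄ => by
    rw [intervalIntegral.integral_of_le hL, ← integral_congr_ae (hsl f₁ f₂ f₃ f₄),
      ← (hint f₁ f₂ f₃ f₄).2, integral_prod _ (hint f₁ f₂ f₃ f₄).1]
  refine ⟨fun f₁ f₂ f₃ f₄ => ((hint f₁ f₂ f₃ f₄).1.integral_prod_left).congr (hsl f₁ f₂ f₃ f₄), ?_⟩
  simp_rw [hval]
  fun_prop

end DispersionManagement

/-! ### Position representation of the spatial integral through chirps. -/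

namespace DispersionManagement

open Filter Topology

/-- The quadratic phase `e^{iy²/(4r)}`. -/
noncomputable def chirp (r y : ℝ) : ℂ := Complex.exp (((y ^ 2 / (4 * r) : ℝ) : ℂ) * Complex.I)

theorem norm_chirp (r y : ℝ) : ‖chirp r y‖ = 1 := Complex.norm_exp_ofReal_mul_I _

theorem measurable_chirp (r : ℝ) : Measurable (chirp r) := by unfold chirp; fun_prop

theorem BddSupp.chirp {v : ℝ → ℂ} (hv : BddSupp v) (r : ℝ) :
    BddSupp fun y => chirp r y * v y :=
  hv.mul_left (measurable_chirp r) fun x => (norm_chirp r x).le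

/-- The heat-regularized Schrödinger evolution is convolution with a Gaussian. -/
theorem fourierInv_gaussian_mul_fourier {b : ℂ} (hb : 0 < b.re) {g : ℝ → ℂ} (hg : Integrable g)
    (x : ℝ) :
    𝓕⁻ (fun ξ : ℝ => Complex.exp (-(b * (2 * Real.pi * ξ) ^ 2)) * 𝓕 g ξ) x =
      1 / (4 * Real.pi * b) ^ (1 / 2 : ℂ) *
        ∫ y : ℝ, Complex.exp (-(((y : ℂ) - x) ^ 2 / (4 * b))) * g y := by
  have hb0 : b ≠ 0 := by rintro rfl; simp at hb
  have hb' : 0 < (4 * Real.pi * b).re := by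
    rw [show (4 * Real.pi * b : ℂ) = ((4 * Real.pi : ℝ) : ℂ) * b by push_cast; ring,
      Complex.re_ofReal_mul]
    positivity
  set h : ℝ → ℂ := fun ξ => Complex.exp (-Real.pi * (4 * Real.pi * b) * ξ ^ 2 +
    2 * Real.pi * (Complex.I * x) * ξ) with hh
  have hF := fourier_gaussian_pi' hb' (Complex.I * x)
  have hint : Integrable h := by
    have h2 : 0 < (Real.pi * (4 * Real.pi * b)).re := by
      rw [Complex.re_ofReal_mul]; positivity
    have h3 : (-Real.pi * (4 * Real.pi * b) : ℂ).re < 0 := by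
      rw [neg_mul, Complex.neg_re]; linarith
    have := integrable_cexp_quadratic' h3 (2 * Real.pi * (Complex.I * x)) 0
    simpa only [add_zero] using this
  have hflip := VectorFourier.integral_fourierIntegral_smul_eq_flip (L := innerₗ ℝ)
    Real.continuous_fourierChar continuous_inner hg hint
  have e1 : 𝓕⁻ (fun ξ : ℝ => Complex.exp (-(b * (2 * Real.pi * ξ) ^ 2)) * 𝓕 g ξ) x =
      ∫ ξ, 𝓕 g ξ • h ξ := by
    rw [Real.fourierInv_eq']
    refine integral_congr_ae (Eventually.of_forall fun ξ => ?_)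
    simp only [hh, smul_eq_mul, RCLike.inner_apply, conj_trivial]
    rw [← mul_assoc, mul_comm (𝓕 g ξ), ← Complex.exp_add]
    congr 2
    push_cast
    ring
  have e2 : ∫ ξ, 𝓕 g ξ • h ξ = ∫ y, g y • 𝓕 h y := by
    rw [flip_innerₗ] at hflip
    exact hflip
  rw [e1, e2, ← integral_const_mul]
  refine integral_congr_ae (Eventually.of_forall fun y => ?_)
  simp only [smul_eq_mul]
  rw [hF]
  simp only []
  rw [mul_comm, mul_assoc]
  congr 3
  rw [← mul_assoc, Complex.I_mul_I]
  field_simp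
  ring

/-- The constant `(4πir)^{-1/2}`. -/
noncomputable def dispersionConst (r : ℝ) : ℂ :=
  1 / (4 * Real.pi * (Complex.I * r)) ^ (1 / 2 : ℂ)

theorem norm_dispersionConst_pow_four (r : ℝ) :
    ‖dispersionConst r‖ ^ 4 = 1 / (4 * Real.pi * r) ^ 2 := by
  have h1 : dispersionConst r ^ 2 = 1 / (4 * Real.pi * (Complex.I * r)) := by
    rw [dispersionConst, div_pow, one_pow, one_div (2 : ℂ)]
    congr 1
    exact_mod_cast Complex.cpow_nat_inv_pow (4 * Real.pi * (Complex.I * r)) two_ne_zero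
  calc ‖dispersionConst r‖ ^ 4 = ‖dispersionConst r ^ 2‖ ^ 2 := by rw [norm_pow]; ring
    _ = _ := by
      rw [h1]
      simp [mul_pow]

/-- The Gaussian formula holds for parameters with positive real part. Taking 1/(n+1) + ir and
letting n tend to infinity, the multipliers converge in L² and the convolutions converge pointwise.
Expanding (y - x)² splits the limit kernel into two chirps and a Fourier character. -/
theorem T_ae_eq_chirp {f : L2} {g : ℝ → ℂ} (hg : BddSupp g) (hf : f = (hg.memLp 2).toLp g) {r : ℝ}
    (hr : r ≠ 0) :
    (T r f : ℝ → ℂ) =ᵐ[volume] fun x => dispersionConst r *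
      (chirp r x * 𝓕 (fun y => chirp r y * g y) (x / (4 * Real.pi * r))) := by
  have hrC : (r : ℂ) ≠ 0 := by exact_mod_cast hr
  set b : ℕ → ℂ := fun n => ((1 / ((n : ℝ) + 1) : ℝ) : ℂ) + Complex.I * r with hb
  have hbre : ∀ n, 0 < (b n).re := fun n => by
    have : (b n).re = 1 / ((n : ℝ) + 1) := by
      simp only [hb, Complex.add_re, Complex.ofReal_re, Complex.re_mul_ofReal, Complex.I_re,
        zero_mul, add_zero]
    rw [this]; positivity
  have hblim : Tendsto b atTop (𝓝 (Complex.I * r)) := by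
    have h1 := (Complex.continuous_ofReal.tendsto 0).comp tendsto_one_div_add_atTop_nhds_zero_nat
    have h2 := h1.add_const (Complex.I * r)
    simpa [hb, Function.comp_def] using h2
  have hFg1 : Continuous (𝓕 g) := continuous_fourier hg.integrable
  have hFf : (𝓕 f : L2) =ᵐ[volume] 𝓕 g := by
    rw [hf]; exact fourier_toLp_ae_eq hg.integrable _
  have hFg2 : MemLp (𝓕 g) 2 := (memLp_congr_ae hFf).1 (Lp.memLp _)
  obtain ⟨M, hM⟩ : ∃ M, ∀ ξ, ‖𝓕 g ξ‖ ≤ M := ⟨∫ x, ‖g x‖, fun ξ =>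
    VectorFourier.norm_fourierIntegral_le_integral_norm _ _ _ _ _⟩
  set F : ℕ → ℝ → ℂ := fun n ξ => Complex.exp (-(b n * (2 * Real.pi * ξ) ^ 2)) * 𝓕 g ξ with hFdef
  have hen : ∀ n (ξ : ℝ), ‖Complex.exp (-(b n * (2 * Real.pi * ξ) ^ 2))‖ =
      Real.exp (-((b n).re * (2 * Real.pi * ξ) ^ 2)) := fun n ξ => by
    rw [Complex.norm_exp, Complex.neg_re,
      show (b n * (2 * Real.pi * ξ) ^ 2 : ℂ) = (((2 * Real.pi * ξ) ^ 2 : ℝ) : ℂ) * b n by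
        push_cast; ring, Complex.re_ofReal_mul, mul_comm]
  have hFc : ∀ n, Continuous (F n) := fun n => by
    simp only [hFdef]; fun_prop
  have hFb : ∀ n ξ, ‖F n ξ‖ ≤ ‖𝓕 g ξ‖ := fun n ξ => by
    simp only [hFdef]
    rw [norm_mul, hen]
    refine mul_le_of_le_one_left (norm_nonneg _) (Real.exp_le_one_iff.2 ?_)
    have := (hbre n).le
    rw [neg_nonpos]; positivity
  have hF2 : ∀ n, MemLp (F n) 2 := fun n =>
    hFg2.of_le (hFc n).aestronglyMeasurable (Eventually.of_forall (hFb n))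
  have hF1 : ∀ n, Integrable (F n) := fun n => by
    have h0 : 0 < (b n).re * (2 * Real.pi) ^ 2 := mul_pos (hbre n) (by positivity)
    refine ((integrable_exp_neg_mul_sq h0).mul_const M).mono' (hFc n).aestronglyMeasurable
      (Eventually.of_forall fun ξ => ?_)
    simp only [hFdef]
    rw [norm_mul, hen]
    refine mul_le_mul (le_of_eq ?_) (hM ξ) (norm_nonneg _) (Real.exp_pos _).le
    congr 1; ring
  have hTlim : Tendsto (fun n => (𝓕⁻ ((hF2 n).toLp (F n)) : L2)) atTop (𝓝 (T r f)) := by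
    have h := tendsto_toLp_of_dominated hF2 (memLp_schrodingerSymbol_mul r (𝓕 f)) hFg2.norm
      (fun n => Eventually.of_forall (hFb n)) (by
        filter_upwards [hFf] with ξ hξ
        rw [hξ]
        refine Tendsto.mul_const _ ?_
        have : Continuous fun z : ℂ => Complex.exp (-(z * (2 * Real.pi * ξ) ^ 2)) := by fun_prop
        exact (this.tendsto _).comp hblim)
    exact ((Lp.fourierTransformₗᵢ ℝ ℂ).symm.continuous.tendsto _).comp h
  have hpt : ∀ x, Tendsto (fun n => 𝓕⁻ (F n) x) atTop
      (𝓝 (dispersionConst r * (chirp r x * 𝓕 (fun y => chirp r y * g y) (x / (4 * Real.pi * r))))) := by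
    intro x
    simp only [hFdef, fourierInv_gaussian_mul_fourier (hbre _) hg.integrable]
    refine Tendsto.mul ?_ ?_
    · refine Tendsto.div tendsto_const_nhds ?_ ?_
      · have hs : (4 * Real.pi * (Complex.I * r) : ℂ) ∈ Complex.slitPlane := by
          rw [Complex.mem_slitPlane_iff]
          right
          simp [hr]
        have h1 : Tendsto (fun n => (4 * Real.pi * b n : ℂ)) atTop
            (𝓝 (4 * Real.pi * (Complex.I * r))) := hblim.const_mul _
        exact (continuousAt_cpow_const hs).tendsto.comp h1
      · rw [Ne, Complex.cpow_eq_zero_iff]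
        simp [hr]
    · have e : chirp r x * 𝓕 (fun y => chirp r y * g y) (x / (4 * Real.pi * r)) =
          ∫ y : ℝ, Complex.exp (-(((y : ℂ) - x) ^ 2 / (4 * (Complex.I * r)))) * g y := by
        rw [Real.fourier_eq', ← integral_const_mul]
        refine integral_congr_ae (Eventually.of_forall fun y => ?_)
        simp only [smul_eq_mul, RCLike.inner_apply, conj_trivial, chirp]
        rw [← mul_assoc, ← mul_assoc, ← Complex.exp_add, ← Complex.exp_add]
        congr 2
        have hI : Complex.I ≠ 0 := Complex.I_ne_zero
        push_cast
        field_simp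
        linear_combination (-(2 * (x : ℂ) * y) + x ^ 2 + y ^ 2) * Complex.I_sq
      rw [e]
      refine tendsto_integral_of_dominated_convergence (fun y => ‖g y‖) (fun n => ?_)
        hg.integrable.norm (fun n => Eventually.of_forall fun y => ?_)
        (Eventually.of_forall fun y => ?_)
      · have := hg.meas
        exact Measurable.aestronglyMeasurable (by fun_prop)
      · rw [norm_mul, Complex.norm_exp]
        refine mul_le_of_le_one_left (norm_nonneg _) (Real.exp_le_one_iff.2 ?_)
        have : (-(((y : ℂ) - x) ^ 2 / (4 * b n))) = ((-((y - x) ^ 2 / 4) : ℝ) : ℂ) * (b n)⁻¹ := by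
          push_cast
          rw [div_mul_eq_div_div, div_eq_mul_inv _ (b n), neg_mul]
        rw [this, Complex.re_ofReal_mul, Complex.inv_re]
        refine mul_nonpos_of_nonpos_of_nonneg (by rw [neg_nonpos]; positivity) ?_
        exact div_nonneg (hbre n).le (Complex.normSq_nonneg _)
      · refine Tendsto.mul_const _ ?_
        refine (Complex.continuous_exp.tendsto _).comp (Tendsto.neg ?_)
        refine Tendsto.div tendsto_const_nhds (hblim.const_mul 4) ?_
        simp [hr]
  obtain ⟨ns, hns, hlim⟩ := (tendstoInMeasure_of_tendsto_Lp hTlim).exists_seq_tendsto_ae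
  filter_upwards [hlim, ae_all_iff.2 fun n => fourierInv_toLp_ae_eq (hF1 n) (hF2 n)] with x h1 h2
  refine tendsto_nhds_unique h1 (((hpt x).comp hns.tendsto_atTop).congr fun k => ?_)
  exact (h2 _).symm

theorem chirp_quadInt (r : ℝ) (v₁ v₂ v₃ v₄ : ℝ → ℂ) (z : ℝ × ℝ × ℝ) :
    quadInt (fun y => chirp r y * v₁ y) (fun y => chirp r y * v₂ y)
      (fun y => chirp r y * v₃ y) (fun y => chirp r y * v₄ y) z =
    recPhase (((z.2.2 - z.2.1) * (z.2.1 + z.2.2 - z.1)) / 2) r * quadInt v₁ v₂ v₃ v₄ z := by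
  have hc : ∀ y : ℝ, starRingEnd ℂ (chirp r y) =
      Complex.exp (-(((y ^ 2 / (4 * r) : ℝ) : ℂ) * Complex.I)) := fun y => by
    unfold chirp
    rw [← Complex.exp_conj, map_mul, Complex.conj_ofReal, Complex.conj_I, mul_neg]
  unfold quadInt
  simp only [map_mul, hc]
  unfold chirp recPhase
  rw [show (((z.2.2 - z.2.1) * (z.2.1 + z.2.2 - z.1) / 2 / r : ℝ) : ℂ) * Complex.I =
    -(((z.2.1 ^ 2 / (4 * r) : ℝ) : ℂ) * Complex.I) +
    -((((z.1 - z.2.1) ^ 2 / (4 * r) : ℝ) : ℂ) * Complex.I) +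
    ((z.2.2 ^ 2 / (4 * r) : ℝ) : ℂ) * Complex.I +
    (((z.1 - z.2.2) ^ 2 / (4 * r) : ℝ) : ℂ) * Complex.I by
      push_cast
      rcases eq_or_ne (r : ℂ) 0 with h | h
      · simp [h]
      · field_simp; ring,
    Complex.exp_add, Complex.exp_add, Complex.exp_add]
  ring

/-- The outer chirps cancel in modulus. The four constants give (4πr)^{-2}, and the rescaling of x
gives 4π|r|. -/
theorem qint_eq_of_position {f₁ f₂ f₃ f₄ : L2} {g₁ g₂ g₃ g₄ : ℝ → ℂ} (h₁ : BddSupp g₁)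
    (h₂ : BddSupp g₂) (h₃ : BddSupp g₃) (h₄ : BddSupp g₄)
    (e₁ : f₁ = (h₁.memLp 2).toLp g₁) (e₂ : f₂ = (h₂.memLp 2).toLp g₂)
    (e₃ : f₃ = (h₃.memLp 2).toLp g₃) (e₄ : f₄ = (h₄.memLp 2).toLp g₄) {r : ℝ} (hr : r ≠ 0) :
    qint r f₁ f₂ f₃ f₄ = ((1 / (4 * Real.pi * |r|) : ℝ) : ℂ) * ∫ z : ℝ × ℝ × ℝ,
      recPhase (((z.2.2 - z.2.1) * (z.2.1 + z.2.2 - z.1)) / 2) r * quadInt g₁ g₂ g₃ g₄ z := by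
  simp_rw [← chirp_quadInt]
  rw [← integral_quad_fourier (h₁.chirp r) (h₂.chirp r) (h₃.chirp r) (h₄.chirp r)]
  set H : ℝ → ℂ := fun x => starRingEnd ℂ (𝓕 (fun y => chirp r y * g₁ y) x) *
    𝓕 (fun y => chirp r y * g₂ y) x * starRingEnd ℂ (𝓕 (fun y => chirp r y * g₃ y) x) *
    𝓕 (fun y => chirp r y * g₄ y) x with hH
  have ha : 4 * Real.pi * r ≠ 0 := by positivity
  have hn : ∀ z : ℂ, starRingEnd ℂ z * z * (starRingEnd ℂ z * z) = ((‖z‖ ^ 4 : ℝ) : ℂ) := fun z => by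
    rw [Complex.conj_mul']; push_cast; ring
  have e : qint r f₁ f₂ f₃ f₄ =
      ∫ x, ((1 / (4 * Real.pi * r) ^ 2 : ℝ) : ℂ) * H (x / (4 * Real.pi * r)) := by
    refine integral_congr_ae ?_
    filter_upwards [T_ae_eq_chirp h₁ e₁ hr, T_ae_eq_chirp h₂ e₂ hr, T_ae_eq_chirp h₃ e₃ hr,
      T_ae_eq_chirp h₄ e₄ hr] with x h1 h2 h3 h4
    rw [h1, h2, h3, h4, ← norm_dispersionConst_pow_four, ← hn]
    have hχ : starRingEnd ℂ (chirp r x) * chirp r x * (starRingEnd ℂ (chirp r x) * chirp r x) = 1 := by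
      rw [hn, norm_chirp]; simp
    simp only [map_mul, hH]
    linear_combination (starRingEnd ℂ (dispersionConst r) * dispersionConst r *
      (starRingEnd ℂ (dispersionConst r) * dispersionConst r) * H (x / (4 * Real.pi * r))) * hχ
  rw [e, integral_const_mul, Measure.integral_comp_div, Complex.real_smul, ← mul_assoc]
  congr 1
  rw [← Complex.ofReal_mul]
  congr 1
  rw [← sq_abs (4 * Real.pi * r), show 4 * Real.pi * |r| = |4 * Real.pi * r| by
    rw [abs_mul, abs_of_pos (by positivity : 0 < 4 * Real.pi)]]
  have := abs_pos.2 ha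
  field_simp

end DispersionManagement

/-! ### Domination of Q by the positive form in position and in frequency. -/

namespace DispersionManagement

open Filter Topology

variable {L : ℝ} {D : ℝ → ℝ}

/-- A bound of a continuous functional by `N4` extends from nice functions to `L²`. -/
theorem enorm_le_N4_of_bddSupp {J : L2 × L2 × L2 × L2 → ℂ} (hJ : Continuous J) {Φ : L2 → L2}
    (hΦ : Continuous Φ) {c : ℝ≥0∞}
    (h : ∀ (v₁ v₂ v₃ v₄ : ℝ → ℂ) (h₁ : BddSupp v₁) (h₂ : BddSupp v₂) (h₃ : BddSupp v₃)
      (h₄ : BddSupp v₄), ‖J (Φ ((h₁.memLp 2).toLp v₁), Φ ((h₂.memLp 2).toLp v₂),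
        Φ ((h₃.memLp 2).toLp v₃), Φ ((h₄.memLp 2).toLp v₄))‖ₑ ≤
      c * N4 (fun x => ‖v₁ x‖ₑ) (fun x => ‖v₂ x‖ₑ) (fun x => ‖v₃ x‖ₑ) (fun x => ‖v₄ x‖ₑ))
    (u₁ u₂ u₃ u₄ : L2) : ‖J (Φ u₁, Φ u₂, Φ u₃, Φ u₄)‖ₑ ≤
      c * N4 (fun x => ‖u₁ x‖ₑ) (fun x => ‖u₂ x‖ₑ) (fun x => ‖u₃ x‖ₑ) (fun x => ‖u₄ x‖ₑ) := by
  obtain ⟨v₁, h₁, b₁, l₁⟩ := exists_bddSupp_tendsto u₁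
  obtain ⟨v₂, h₂, b₂, l₂⟩ := exists_bddSupp_tendsto u₂
  obtain ⟨v₃, h₃, b₃, l₃⟩ := exists_bddSupp_tendsto u₃
  obtain ⟨v₄, h₄, b₄, l₄⟩ := exists_bddSupp_tendsto u₄
  have hc : Continuous fun p : L2 × L2 × L2 × L2 => ‖J (Φ p.1, Φ p.2.1, Φ p.2.2.1, Φ p.2.2.2)‖ₑ := by
    fun_prop
  have hlim := (hc.tendsto (u₁, u₂, u₃, u₄)).comp
    (l₁.prodMk_nhds (l₂.prodMk_nhds (l₃.prodMk_nhds l₄)))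
  refine le_of_tendsto' hlim fun n => (h _ _ _ _ (h₁ n) (h₂ n) (h₃ n) (h₄ n)).trans ?_
  exact mul_le_mul_right (N4_mono (fun x => enorm_le_iff_norm_le.2 (b₁ n x))
    (fun x => enorm_le_iff_norm_le.2 (b₂ n x)) (fun x => enorm_le_iff_norm_le.2 (b₃ n x))
    fun x => enorm_le_iff_norm_le.2 (b₄ n x)) _

/-- Position space bound for nice functions. -/
theorem enorm_integral_qint_le_position (hL : 0 ≤ L) (hD : Measurable D)
    (hD0 : ∀ᵐ s ∂volume.restrict (Ioc 0 L), D s ≠ 0)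
    (hqi : ∀ f₁ f₂ f₃ f₄, IntegrableOn (fun s => qint (D s) f₁ f₂ f₃ f₄) (Ioc 0 L)) {C : ℝ}
    (hC : ∀ η > 0, ∀ τ : ℝ, ‖∫ s in (0 : ℝ)..L, ((|D s| / (D s ^ 2 + η ^ 2) : ℝ) : ℂ) *
      recPhase τ (D s)‖ₑ ≤ ENNReal.ofReal C * kw τ)
    {v₁ v₂ v₃ v₄ : ℝ → ℂ} (h₁ : BddSupp v₁) (h₂ : BddSupp v₂) (h₃ : BddSupp v₃)
    (h₄ : BddSupp v₄) :
    ‖∫ s in (0 : ℝ)..L, qint (D s) ((h₁.memLp 2).toLp v₁) ((h₂.memLp 2).toLp v₂)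
        ((h₃.memLp 2).toLp v₃) ((h₄.memLp 2).toLp v₄)‖ₑ ≤
      (ENNReal.ofReal C * 2) *
      N4 (fun x => ‖v₁ x‖ₑ) (fun x => ‖v₂ x‖ₑ) (fun x => ‖v₃ x‖ₑ) (fun x => ‖v₄ x‖ₑ) := by
  set q : ℝ → ℂ := fun s => qint (D s) ((h₁.memLp 2).toLp v₁) ((h₂.memLp 2).toLp v₂)
        ((h₃.memLp 2).toLp v₃) ((h₄.memLp 2).toLp v₄) with hq
  have hq1 : IntegrableOn q (Ioc 0 L) := hqi _ _ _ _
  -- The position kernel has the singular factor 1/|D|. Multiplying by D²/(D² + η²), which tends to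
  -- 1 wherever D ≠ 0, turns it into the bounded |D|/(D² + η²), so that Fubini applies; the bounds
  -- are uniform in η.
  set η : ℕ → ℝ := fun n => 1 / ((n : ℝ) + 1) with hη
  have hη0 : ∀ n, 0 < η n := fun n => by positivity
  have hηlim : Tendsto η atTop (𝓝 0) := tendsto_one_div_add_atTop_nhds_zero_nat
  have hlim : Tendsto (fun n => ∫ s in Ioc 0 L, ((D s ^ 2 / (D s ^ 2 + η n ^ 2) : ℝ) : ℂ) * q s)
      atTop (𝓝 (∫ s in Ioc 0 L, q s)) := by
    refine tendsto_integral_of_dominated_convergence (fun s => ‖q s‖) (fun n => ?_) hq1.norm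
      (fun n => Eventually.of_forall fun s => ?_) ?_
    · refine AEStronglyMeasurable.mul ?_ hq1.aestronglyMeasurable
      exact Measurable.aestronglyMeasurable (by fun_prop)
    · rw [norm_mul, Complex.norm_real]
      refine mul_le_of_le_one_left (norm_nonneg _) ?_
      rw [Real.norm_of_nonneg (by positivity)]
      have := hη0 n
      exact div_le_one_of_le₀ (by nlinarith) (by positivity)
    · filter_upwards [hD0] with s hs
      have h1 : Tendsto (fun n => D s ^ 2 / (D s ^ 2 + η n ^ 2)) atTop
          (𝓝 (D s ^ 2 / (D s ^ 2 + 0 ^ 2))) :=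
        tendsto_const_nhds.div (tendsto_const_nhds.add (hηlim.pow 2)) (by simpa using hs)
      have h2 : D s ^ 2 / (D s ^ 2 + 0 ^ 2) = 1 := by field_simp; simp
      rw [h2] at h1
      have h3 := ((Complex.continuous_ofReal.tendsto 1).comp h1).mul_const (q s)
      simpa only [Complex.ofReal_one, one_mul, Function.comp_def] using h3
  rw [intervalIntegral.integral_of_le hL]
  refine le_of_tendsto' ((continuous_enorm.tendsto _).comp hlim) fun n => ?_
  simp only [Function.comp_apply]
  set K : ℝ → ℝ × ℝ × ℝ → ℂ := fun s z => ((1 / (4 * Real.pi) : ℝ) : ℂ) *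
    (((|D s| / (D s ^ 2 + η n ^ 2) : ℝ) : ℂ) *
      recPhase (((z.2.2 - z.2.1) * (z.2.1 + z.2.2 - z.1)) / 2) (D s)) with hK
  have e : ∀ s, ((D s ^ 2 / (D s ^ 2 + η n ^ 2) : ℝ) : ℂ) * q s =
      ∫ z, K s z * quadInt v₁ v₂ v₃ v₄ z := by
    intro s
    by_cases hs : D s = 0
    · simp [hK, hs]
    have e' : ∫ z, K s z * quadInt v₁ v₂ v₃ v₄ z = (((1 / (4 * Real.pi) : ℝ) : ℂ) *
        ((|D s| / (D s ^ 2 + η n ^ 2) : ℝ) : ℂ)) * ∫ z : ℝ × ℝ × ℝ,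
        recPhase (((z.2.2 - z.2.1) * (z.2.1 + z.2.2 - z.1)) / 2) (D s) * quadInt v₁ v₂ v₃ v₄ z := by
      rw [← integral_const_mul]
      refine integral_congr_ae (Eventually.of_forall fun z => ?_)
      simp only [hK]
      ring
    rw [e']
    simp only [hq, qint_eq_of_position h₁ h₂ h₃ h₄ rfl rfl rfl rfl hs]
    rw [← mul_assoc]
    congr 1
    rw [← Complex.ofReal_mul, ← Complex.ofReal_mul]
    congr 1
    have h0 := abs_pos.2 hs
    rw [← sq_abs (D s)]
    field_simp
  simp_rw [e]
  rw [← intervalIntegral.integral_of_le hL]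
  have hpi : ‖(1 / (4 * Real.pi) : ℝ)‖ ≤ 1 := by
    rw [Real.norm_of_nonneg (by positivity)]
    exact div_le_one_of_le₀ (by nlinarith [Real.pi_gt_three]) (by positivity)
  refine enorm_integral_quadInt_le hL ?_ (B := 1 / η n) (fun s z => ?_)
    (ENNReal.mul_ne_top ENNReal.ofReal_ne_top ENNReal.ofNat_ne_top) (fun z => ?_) h₁ h₂ h₃ h₄
  · simp only [hK, recPhase]
    unfold Function.uncurry
    fun_prop
  · simp only [hK]
    rw [norm_mul, norm_mul, norm_recPhase, mul_one, Complex.norm_real, Complex.norm_real]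
    refine (mul_le_of_le_one_left (norm_nonneg _) hpi).trans ?_
    have := hη0 n
    rw [Real.norm_of_nonneg (by positivity), div_le_div_iff₀ (by positivity) this]
    nlinarith [sq_nonneg (|D s| - η n), sq_abs (D s), abs_nonneg (D s)]
  · simp only [hK]
    rw [intervalIntegral.integral_const_mul, enorm_mul]
    have h1 : ‖((1 / (4 * Real.pi) : ℝ) : ℂ)‖ₑ ≤ 1 := by
      rw [← ofReal_norm, Complex.norm_real]
      exact ENNReal.ofReal_le_one.2 hpi
    refine (mul_le_of_le_one_left' h1).trans ((hC _ (hη0 n) _).trans ?_)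
    rw [mul_assoc]
    exact mul_le_mul_right (kw_div_two_le _) _

/-- Bounds and continuity of `Q` on `L²`. -/
theorem Q_bounds (hL : 0 < L) {d₀ : ℝ → ℝ} (hd : IsPiecewiseW11 L d₀)
    (hd' : IsBoundedAwayFromZero L d₀) :
    (Continuous fun p : L2 × L2 × L2 × L2 => Q L d₀ p.1 p.2.1 p.2.2.1 p.2.2.2) ∧
    ∃ C : ℝ, 0 < C ∧ ∀ f₁ f₂ f₃ f₄ : L2,
      ‖Q L d₀ f₁ f₂ f₃ f₄‖ₑ ≤ ENNReal.ofReal C *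
        N4 (fun x => ‖(𝓕 f₁ : L2) x‖ₑ) (fun x => ‖(𝓕 f₂ : L2) x‖ₑ) (fun x => ‖(𝓕 f₃ : L2) x‖ₑ)
          (fun x => ‖(𝓕 f₄ : L2) x‖ₑ) ∧
      ‖Q L d₀ f₁ f₂ f₃ f₄‖ₑ ≤ ENNReal.ofReal C *
        N4 (fun x => ‖f₁ x‖ₑ) (fun x => ‖f₂ x‖ₑ) (fun x => ‖f₃ x‖ₑ) (fun x => ‖f₄ x‖ₑ) := by
  obtain ⟨C₁, hC₁, b₁⟩ := exists_phase_kernel_le hL.le hd hd'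
  obtain ⟨C₂, hC₂, b₂⟩ := exists_recPhase_kernel_le hL.le hd hd'
  have hz := ae_accumulated_ne_zero hL.le hd hd'
  have hcont := hd.continuousOn_accumulated hL.le
  -- Nothing is known about d₀ outside [0, L]; replacing the accumulated dispersion by 0 there makes
  -- it measurable on the whole line without changing the integrals.
  set D : ℝ → ℝ := (Ioc 0 L).piecewise (accumulated d₀) 0 with hDdef
  have hDm : Measurable D := (hcont.mono Ioc_subset_Icc_self).measurable_piecewise
    continuousOn_const measurableSet_Ioc
  have hDe : ∀ s ∈ Ioc 0 L, D s = accumulated d₀ s := fun s hs => piecewise_eq_of_mem _ _ _ hs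
  have hI : ∀ G : ℝ → ℝ → ℂ, ∫ s in (0 : ℝ)..L, G s (D s) =
      ∫ s in (0 : ℝ)..L, G s (accumulated d₀ s) := fun G => by
    rw [intervalIntegral.integral_of_le hL.le, intervalIntegral.integral_of_le hL.le]
    exact setIntegral_congr_fun measurableSet_Ioc fun s hs => by simp only [hDe s hs]
  have k₁ : ∀ t : ℝ, ‖∫ s in (0 : ℝ)..L, Complex.exp (Complex.I * t * D s)‖ₑ
      ≤ ENNReal.ofReal C₁ * kw t := fun t => by
    rw [hI fun _ r => Complex.exp (Complex.I * t * r)]; exact b₁ t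
  have k₂ : ∀ η > 0, ∀ τ : ℝ, ‖∫ s in (0 : ℝ)..L, ((|D s| / (D s ^ 2 + η ^ 2) : ℝ) : ℂ) *
      recPhase τ (D s)‖ₑ ≤ ENNReal.ofReal C₂ * kw τ := fun η hη τ => by
    rw [hI fun _ r => ((|r| / (r ^ 2 + η ^ 2) : ℝ) : ℂ) * recPhase τ r]; exact b₂ η hη τ
  have hD0 : ∀ᵐ s ∂volume.restrict (Ioc 0 L), D s ≠ 0 := by
    rw [ae_restrict_iff' measurableSet_Ioc]
    filter_upwards [hz] with s hs hs'
    rw [hDe s hs']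
    exact hs hs'
  obtain ⟨hqi, hqc⟩ := integrable_qint_and_continuous hL.le hDm k₁
  have hQ : ∀ f₁ f₂ f₃ f₄, Q L d₀ f₁ f₂ f₃ f₄ =
      ((1 / L : ℝ) : ℂ) * ∫ s in (0 : ℝ)..L, qint (D s) f₁ f₂ f₃ f₄ := fun f₁ f₂ f₃ f₄ => by
    rw [hI fun _ r => qint r f₁ f₂ f₃ f₄]
    rfl
  have hQc : Continuous fun p : L2 × L2 × L2 × L2 => Q L d₀ p.1 p.2.1 p.2.2.1 p.2.2.2 := by
    simp_rw [hQ]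
    exact continuous_const.mul hqc
  refine ⟨hQc, (1 / L) * (C₁ + C₂ * 2), by positivity, fun f₁ f₂ f₃ f₄ => ⟨?_, ?_⟩⟩
  · have h := enorm_le_N4_of_bddSupp hqc (Φ := fun u => 𝓕⁻ u)
      (Lp.fourierTransformₗᵢ ℝ ℂ).symm.continuous (c := ENNReal.ofReal C₁)
      (fun v₁ v₂ v₃ v₄ h₁ h₂ h₃ h₄ => enorm_integral_qint_le hL.le hDm k₁ h₁ h₂ h₃ h₄
        (FourierTransform.fourier_fourierInv_eq _) (FourierTransform.fourier_fourierInv_eq _)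
        (FourierTransform.fourier_fourierInv_eq _) (FourierTransform.fourier_fourierInv_eq _))
      (𝓕 f₁) (𝓕 f₂) (𝓕 f₃) (𝓕 f₄)
    simp only [FourierTransform.fourierInv_fourier_eq] at h
    rw [hQ, enorm_mul, ← ofReal_norm, Complex.norm_real, Real.norm_of_nonneg (by positivity),
      ENNReal.ofReal_mul (by positivity), mul_assoc]
    refine mul_le_mul_right (h.trans (mul_le_mul_left (ENNReal.ofReal_le_ofReal ?_) _)) _
    linarith
  · have h := enorm_le_N4_of_bddSupp hqc (Φ := id) continuous_id (c := ENNReal.ofReal C₂ * 2)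
      (fun v₁ v₂ v₃ v₄ h₁ h₂ h₃ h₄ => enorm_integral_qint_le_position hL.le hDm hD0 hqi k₂
        h₁ h₂ h₃ h₄) f₁ f₂ f₃ f₄
    simp only [id] at h
    rw [hQ, enorm_mul, ← ofReal_norm, Complex.norm_real, Real.norm_of_nonneg (by positivity),
      ENNReal.ofReal_mul (by positivity), mul_assoc]
    refine mul_le_mul_right (h.trans (mul_le_mul_left ?_ _)) _
    rw [show (2 : ℝ≥0∞) = ENNReal.ofReal 2 by simp, ← ENNReal.ofReal_mul hC₂.le]
    exact ENNReal.ofReal_le_ofReal (by linarith)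

end DispersionManagement

/-! ### The weak equation in resolvent form. -/

namespace DispersionManagement

open Filter Topology

theorem ae_eq_of_integral_schwartz {a b : ℝ → ℂ} (ha : LocallyIntegrable a)
    (hb : LocallyIntegrable b) (h : ∀ G : 𝓢(ℝ, ℂ), ∫ x, G x * a x = ∫ x, G x * b x) :
    a =ᵐ[volume] b := by
  refine ae_eq_of_integral_contDiff_smul_eq ha hb fun g hg hgc => ?_
  have hgC : ContDiff ℝ (⊤ : ℕ∞) (fun x => (g x : ℂ)) := Complex.ofRealCLM.contDiff.comp hg
  have hgCc : HasCompactSupport (fun x => (g x : ℂ)) := hgc.comp_left Complex.ofReal_zero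
  have := h (hgCc.toSchwartzMap hgC)
  simpa using this

theorem fourier_deriv_apply (f : L2) (G : 𝓢(ℝ, ℂ)) :
    (𝓕 (∂_{(1 : ℝ)} (f : 𝓢'(ℝ, ℂ)))) G =
      ∫ k, G k * (2 * Real.pi * Complex.I * k * (𝓕 f : L2) k) := by
  rw [TemperedDistribution.fourier_lineDerivOp_eq, Lp.fourier_toTemperedDistribution_eq]
  have hg : (fun x : ℝ => ((inner ℝ x (1 : ℝ) : ℝ) : ℂ)).HasTemperateGrowth := by fun_prop
  change (2 * Real.pi * Complex.I) • (TemperedDistribution.smulLeftCLM ℂ _ _) G = _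
  rw [TemperedDistribution.smulLeftCLM_apply_apply, Lp.toTemperedDistribution_apply,
    smul_eq_mul, ← integral_const_mul]
  refine integral_congr_ae (Eventually.of_forall fun k => ?_)
  simp only [SchwartzMap.smulLeftCLM_apply_apply hg, smul_eq_mul]
  simp
  ring

/-- On the Fourier side the derivative is multiplication by `2πik`. -/
theorem HasH1Deriv.fourier_ae_eq {f f' : L2} (h : HasH1Deriv f f') :
    (𝓕 f' : L2) =ᵐ[volume] fun k => 2 * Real.pi * Complex.I * k * (𝓕 f : L2) k := by
  have hloc : LocallyIntegrable fun k : ℝ => 2 * Real.pi * Complex.I * k * (𝓕 f : L2) k :=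
    ((Lp.memLp (𝓕 f : L2)).locallyIntegrable one_le_two).continuous_smul (𝕜 := ℂ)
      (g := fun k : ℝ => 2 * Real.pi * Complex.I * k) (by fun_prop)
  refine ae_eq_of_integral_schwartz ((Lp.memLp (𝓕 f' : L2)).locallyIntegrable one_le_two) hloc
    fun G => ?_
  rw [← fourier_deriv_apply, h, Lp.fourier_toTemperedDistribution_eq,
    Lp.toTemperedDistribution_apply]
  rfl

theorem hasH1Deriv_of_fourier {f f' : L2}
    (h : (𝓕 f' : L2) =ᵐ[volume] fun k => 2 * Real.pi * Complex.I * k * (𝓕 f : L2) k) :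
    HasH1Deriv f f' := by
  have e : 𝓕 (∂_{(1 : ℝ)} (f : 𝓢'(ℝ, ℂ))) = 𝓕 (f' : 𝓢'(ℝ, ℂ)) := by
    ext G
    rw [fourier_deriv_apply, Lp.fourier_toTemperedDistribution_eq,
      Lp.toTemperedDistribution_apply]
    refine integral_congr_ae ?_
    filter_upwards [h] with k hk
    rw [hk, smul_eq_mul]
  have := congrArg (fun u : 𝓢'(ℝ, ℂ) => 𝓕⁻ u) e
  simp only [FourierTransform.fourierInv_fourier_eq] at this
  exact this

/-! ### The resolvent -/

/-- The symbol `1 / (ω + d (2πk)²)` of the resolvent. -/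
noncomputable def resolventSymbol (d ω k : ℝ) : ℂ := ((1 / (ω + d * (2 * Real.pi * k) ^ 2) : ℝ) : ℂ)

theorem continuous_resolventSymbol {d ω : ℝ} (hd : 0 ≤ d) (hω : 0 < ω) :
    Continuous (resolventSymbol d ω) := by
  unfold resolventSymbol
  refine Complex.continuous_ofReal.comp (continuous_const.div (by fun_prop) fun k => ?_)
  positivity

theorem norm_resolventSymbol_le {d ω : ℝ} (hd : 0 ≤ d) (hω : 0 < ω) (k : ℝ) :
    ‖resolventSymbol d ω k‖ ≤ 1 / ω := by
  unfold resolventSymbol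
  rw [Complex.norm_real, Real.norm_of_nonneg (by positivity)]
  gcongr
  have : 0 ≤ d * (2 * Real.pi * k) ^ 2 := by positivity
  linarith

/-- The resolvent as a continuous Fourier multiplier. -/
theorem exists_resolvent {d ω : ℝ} (hd : 0 ≤ d) (hω : 0 < ω) :
    ∃ R : L2 → L2, Continuous R ∧ ∀ h : L2, (𝓕 (R h) : L2) =ᵐ[volume]
      fun k => resolventSymbol d ω k * (𝓕 h : L2) k := by
  have hm : MemLp (resolventSymbol d ω) ⊤ :=
    memLp_top_of_bound (continuous_resolventSymbol hd hω).aestronglyMeasurable (1 / ω)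
      (Eventually.of_forall (norm_resolventSymbol_le hd hω))
  set B := (ContinuousLinearMap.mul ℂ ℂ).holderL (volume : Measure ℝ) ⊤ 2 2 (hm.toLp _) with hB
  refine ⟨fun h => 𝓕⁻ (B (𝓕 h)), ?_, fun h => ?_⟩
  · exact (Lp.fourierTransformₗᵢ ℝ ℂ).symm.continuous.comp
      (B.continuous.comp (Lp.fourierTransformₗᵢ ℝ ℂ).continuous)
  · rw [FourierTransform.fourier_fourierInv_eq]
    have h1 : (B (𝓕 h) : ℝ → ℂ) =ᵐ[volume] fun k => hm.toLp _ k * (𝓕 h : L2) k :=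
      ContinuousLinearMap.coeFn_holder _ _ _
    filter_upwards [h1, hm.coeFn_toLp] with k h1 h2
    rw [h1, h2]

theorem inner_eq_fourier (g f : L2) :
    ⟪g, f⟫_ℂ = ∫ k, starRingEnd ℂ ((𝓕 g : L2) k) * (𝓕 f : L2) k := by
  rw [← Lp.inner_fourier_eq, L2.inner_def]
  refine integral_congr_ae (Eventually.of_forall fun k => ?_)
  simp only [RCLike.inner_apply]
  ring

theorem integrable_conj_mul (g f : L2) : Integrable fun k => starRingEnd ℂ (g k) * f k := by
  refine (L2.integrable_inner (𝕜 := ℂ) g f).congr (Eventually.of_forall fun k => ?_)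
  simp only [RCLike.inner_apply]
  ring

theorem IsWeakSolution.nonneg {L : ℝ} {d₀ : ℝ → ℝ} {dav ω : ℝ} {f : L2}
    (hf : IsWeakSolution L d₀ dav ω f) : 0 ≤ dav := by
  rcases hf with ⟨h, -⟩ | ⟨h, -⟩
  · exact h.le
  · exact h.ge

/-- The weak equation with the resolvent applied to the test function. -/
theorem IsWeakSolution.inner_eq {L : ℝ} {d₀ : ℝ → ℝ} {dav ω : ℝ} (hω : 0 < ω) {f : L2}
    (hQ : Continuous fun p : L2 × L2 × L2 × L2 => Q L d₀ p.1 p.2.1 p.2.2.1 p.2.2.2)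
    (hf : IsWeakSolution L d₀ dav ω f) {R : L2 → L2} (hR : Continuous R)
    (hRm : ∀ h : L2, (𝓕 (R h) : L2) =ᵐ[volume]
      fun k => resolventSymbol dav ω k * (𝓕 h : L2) k) (h : L2) :
    ⟪h, f⟫_ℂ = Q L d₀ (R h) f f f := by
  have hd := hf.nonneg
  have hnice : ∀ (v : ℝ → ℂ) (hv : BddSupp v), ⟪(𝓕⁻ ((hv.memLp 2).toLp v) : L2), f⟫_ℂ =
      Q L d₀ (R (𝓕⁻ ((hv.memLp 2).toLp v))) f f f := by
    intro v hv
    set h : L2 := 𝓕⁻ ((hv.memLp 2).toLp v) with hh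
    have hFh : (𝓕 h : L2) =ᵐ[volume] v := by
      rw [hh, FourierTransform.fourier_fourierInv_eq]; exact MemLp.coeFn_toLp _
    -- The transform of the derivative of Rh. Bounded support of v keeps it in L², so Rh is an
    -- admissible test function also for d_av = 0, where the resolvent does not smooth.
    set w : ℝ → ℂ := fun k => 2 * Real.pi * Complex.I * k * (resolventSymbol dav ω k * v k) with hw
    have hwB : BddSupp w := by
      obtain ⟨M, hM0, hM, hS⟩ := hv.exists_pos
      have := hv.meas
      have := (continuous_resolventSymbol hd hω).measurable
      refine ⟨by fun_prop, ⟨2 * Real.pi * M * (1 / ω * M), fun k => ?_⟩, M, fun k hk => hS k ?_⟩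
      · by_cases hk : v k = 0
        · simp only [hw, hk, mul_zero, norm_zero]; positivity
        · simp only [hw]
          have e : ‖(2 * Real.pi * Complex.I : ℂ)‖ = 2 * Real.pi := by
            simp [abs_of_pos Real.pi_pos]
          rw [norm_mul, norm_mul, norm_mul (resolventSymbol dav ω k), e, Complex.norm_real,
            Real.norm_eq_abs]
          gcongr
          · exact hS k hk
          · exact norm_resolventSymbol_le hd hω k
          · exact hM k
      · exact right_ne_zero_of_mul (right_ne_zero_of_mul hk)
    set g' : L2 := 𝓕⁻ ((hwB.memLp 2).toLp w) with hg'
    have hFg' : (𝓕 g' : L2) =ᵐ[volume] w := by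
      rw [hg', FourierTransform.fourier_fourierInv_eq]; exact MemLp.coeFn_toLp _
    have hH1 : HasH1Deriv (R h) g' := hasH1Deriv_of_fourier (by
      filter_upwards [hFg', hRm h, hFh] with k h1 h2 h3
      rw [h1, h2, h3])
    have hcoef : ∀ k : ℝ, (ω + dav * (2 * Real.pi * k) ^ 2 : ℂ) * resolventSymbol dav ω k = 1 := by
      intro k
      unfold resolventSymbol
      have h0 : ω + dav * (2 * Real.pi * k) ^ 2 ≠ 0 := by positivity
      have h1 : (ω + dav * (2 * Real.pi * k) ^ 2 : ℂ) =
        ((ω + dav * (2 * Real.pi * k) ^ 2 : ℝ) : ℂ) := by push_cast; ring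
      rw [h1, ← Complex.ofReal_mul, mul_one_div_cancel h0, Complex.ofReal_one]
    have hconj : ∀ k, starRingEnd ℂ (resolventSymbol dav ω k) = resolventSymbol dav ω k :=
      fun k => Complex.conj_ofReal _
    rcases hf with ⟨-, f', hf', heq⟩ | ⟨hd0, heq⟩
    · have h1 := heq _ _ hH1
      have h2 : (ω : ℂ) * ⟪R h, f⟫_ℂ + dav * ⟪g', f'⟫_ℂ = ⟪h, f⟫_ℂ := by
        rw [inner_eq_fourier (R h), inner_eq_fourier g', inner_eq_fourier h, ← integral_const_mul,
          ← integral_const_mul, ← integral_add ((integrable_conj_mul _ _).const_mul _)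
          ((integrable_conj_mul _ _).const_mul _)]
        refine integral_congr_ae ?_
        filter_upwards [hFg', hRm h, hFh, hf'.fourier_ae_eq] with k h1 h2 h3 h4
        have h5 : starRingEnd ℂ (2 : ℂ) = 2 := Complex.conj_ofNat 2
        rw [h1, h2, h3, h4]
        simp only [hw, map_mul, hconj, h5, Complex.conj_ofReal, Complex.conj_I]
        linear_combination (starRingEnd ℂ (v k) * (𝓕 f : L2) k) * hcoef k -
          (4 * Real.pi ^ 2 * dav * k ^ 2 * resolventSymbol dav ω k * starRingEnd ℂ (v k) *
            (𝓕 f : L2) k) * Complex.I_sq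
      rw [← h2]
      linear_combination -h1
    · have h1 := heq _ _ hH1
      have h2 : (ω : ℂ) * ⟪R h, f⟫_ℂ = ⟪h, f⟫_ℂ := by
        rw [inner_eq_fourier (R h), inner_eq_fourier h, ← integral_const_mul]
        refine integral_congr_ae ?_
        filter_upwards [hRm h, hFh] with k h2 h3
        rw [h2, h3]
        simp only [map_mul, hconj]
        have := hcoef k
        rw [hd0, Complex.ofReal_zero] at this
        rw [hd0]
        linear_combination (starRingEnd ℂ (v k) * (𝓕 f : L2) k) * this
      rw [← h2]
      linear_combination -h1
  obtain ⟨v, hv, -, hlim⟩ := exists_bddSupp_tendsto (𝓕 h)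
  have hF : Tendsto (fun n => (𝓕⁻ (((hv n).memLp 2).toLp (v n)) : L2)) atTop (𝓝 h) := by
    have := ((Lp.fourierTransformₗᵢ ℝ ℂ).symm.continuous.tendsto (𝓕 h)).comp hlim
    have e : (Lp.fourierTransformₗᵢ ℝ ℂ).symm (𝓕 h) = h :=
      (Lp.fourierTransformₗᵢ ℝ ℂ).symm_apply_apply h
    rw [e] at this
    exact this
  have c1 : Continuous fun g : L2 => ⟪g, f⟫_ℂ := by fun_prop
  have c2 : Continuous fun g : L2 => Q L d₀ (R g) f f f :=
    hQ.comp (f := fun g : L2 => (R g, f, f, f)) (by fun_prop)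
  exact tendsto_nhds_unique ((c1.tendsto h).comp hF)
    (((c2.tendsto h).comp hF).congr fun n => (hnice _ (hv n)).symm)

end DispersionManagement

/-! ### Weighted square integrability of the solution and of its transform. -/

namespace DispersionManagement

open Filter Topology

theorem N4_mono_left_ae {p₁ q₁ p₂ p₃ p₄ : ℝ → ℝ≥0∞} (h : ∀ᵐ x, p₁ x ≤ q₁ x) :
    N4 p₁ p₂ p₃ p₄ ≤ N4 q₁ p₂ p₃ p₄ := by
  unfold N4
  refine lintegral_mono fun s => lintegral_mono_ae ?_
  filter_upwards [h] with x hx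
  gcongr

theorem N4_lintegral_left {ν : Measure ℝ} [SFinite ν] {q p₂ p₃ p₄ : ℝ → ℝ≥0∞} (hq : Measurable q)
    (h₂ : Measurable p₂) (h₃ : Measurable p₃) (h₄ : Measurable p₄) :
    N4 (fun x => ∫⁻ z, q (x - z) ∂ν) p₂ p₃ p₄ = ∫⁻ z, N4 (fun x => q (x - z)) p₂ p₃ p₄ ∂ν := by
  have e : ∀ s x y : ℝ, kw ((y - x) * (x + y - s)) *
      ((∫⁻ z, q (x - z) ∂ν) * p₃ (s - x) * (p₂ y * p₄ (s - y))) =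
      ∫⁻ z, kw ((y - x) * (x + y - s)) * (q (x - z) * p₃ (s - x) * (p₂ y * p₄ (s - y))) ∂ν := by
    intro s x y
    rw [lintegral_const_mul _ (by fun_prop), lintegral_mul_const _ (by fun_prop),
      lintegral_mul_const _ (by fun_prop)]
  set K : ℝ → ℝ → ℝ → ℝ → ℝ≥0∞ := fun s x y z =>
    kw ((y - x) * (x + y - s)) * (q (x - z) * p₃ (s - x) * (p₂ y * p₄ (s - y))) with hK
  have m₁ : ∀ s, Measurable fun a : ℝ × ℝ => ∫⁻ y, K s a.1 y a.2 := fun s =>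
    Measurable.lintegral_prod_right' (f := fun b : (ℝ × ℝ) × ℝ => K s b.1.1 b.2 b.1.2) (by fun_prop)
  have m₂ : Measurable fun a : (ℝ × ℝ) × ℝ => ∫⁻ y, K a.1.1 a.2 y a.1.2 :=
    Measurable.lintegral_prod_right'
      (f := fun b : ((ℝ × ℝ) × ℝ) × ℝ => K b.1.1.1 b.1.2 b.2 b.1.1.2) (by fun_prop)
  have e₁ : ∀ s x, ∫⁻ y, ∫⁻ z, K s x y z ∂ν = ∫⁻ z, (∫⁻ y, K s x y z) ∂ν := fun s x =>
    lintegral_lintegral_swap (μ := volume) (ν := ν) (f := fun y z => K s x y z)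
      (by unfold Function.uncurry; fun_prop)
  have e₂ : ∀ s, ∫⁻ x, ∫⁻ z, (∫⁻ y, K s x y z) ∂ν =
      ∫⁻ z, (∫⁻ x, ∫⁻ y, K s x y z) ∂ν := fun s =>
    lintegral_lintegral_swap (μ := volume) (ν := ν) (m₁ s).aemeasurable
  unfold N4
  simp_rw [e]
  change ∫⁻ s, ∫⁻ x, ∫⁻ y, ∫⁻ z, K s x y z ∂ν = _
  simp_rw [e₁, e₂]
  exact lintegral_lintegral_swap
    (Measurable.lintegral_prod_right' (f := fun a : (ℝ × ℝ) × ℝ => ∫⁻ y, K a.1.1 a.2 y a.1.2)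
      m₂).aemeasurable

/-- Exponentially weighted square integrability from a self-improving bound. -/
theorem exists_exp_weight_of_bound (u : L2) {ν : Measure ℝ} [SFinite ν] {μ₀ : ℝ} (hμ₀ : 0 < μ₀)
    (hν : ∫⁻ z, ENNReal.ofReal (Real.exp (μ₀ * |z|)) ∂ν ≠ ⊤) {C : ℝ}
    (hb : ∀ w : L2, ‖⟪w, u⟫_ℂ‖ₑ ≤ ENNReal.ofReal C * N4 (fun x => ∫⁻ z, ‖w (x - z)‖ₑ ∂ν)
      (fun x => ‖u x‖ₑ) (fun x => ‖u x‖ₑ) (fun x => ‖u x‖ₑ)) :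
    ∃ μ > 0, ∫⁻ x, ENNReal.ofReal (Real.exp (μ * |x|)) ^ 2 * ‖u x‖ₑ ^ 2 ≠ ⊤ := by
  have mu : Measurable u := (Lp.stronglyMeasurable u).measurable
  have mp : Measurable fun x => ‖u x‖ₑ := mu.enorm
  -- The constant C is absorbed into the measure.
  refine exp_decay (ν := ENNReal.ofReal C • ν) mp ?_ hμ₀ ?_ fun φ hφ hM => ?_
  · rw [l2_enorm_coe]; exact enorm_ne_top
  · rw [lintegral_smul_measure]
    exact ENNReal.mul_ne_top ENNReal.ofReal_ne_top hν
  obtain ⟨M, hM⟩ := hM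
  have hφtop : ∀ x, φ x ≠ ⊤ := fun x => ((hM x).trans_lt ENNReal.ofReal_lt_top).ne
  -- Testing with w = φu turns the pairing with u into ∫ φ|u|²; boundedness of φ keeps w in L².
  have hw : MemLp (fun x => ((φ x).toReal : ℂ) * u x) 2 := by
    refine ((Lp.memLp u).const_mul ((max M 0 : ℝ) : ℂ)).of_le
      (Measurable.aestronglyMeasurable (by fun_prop)) (Eventually.of_forall fun x => ?_)
    rw [norm_mul, norm_mul, Complex.norm_real, Complex.norm_real,
      Real.norm_of_nonneg ENNReal.toReal_nonneg, Real.norm_of_nonneg (le_max_right _ _)]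
    gcongr
    refine ENNReal.toReal_le_of_le_ofReal (le_max_right _ _) ((hM x).trans ?_)
    exact ENNReal.ofReal_le_ofReal (le_max_left _ _)
  set w : L2 := hw.toLp _ with hwdef
  have hwe : (w : ℝ → ℂ) =ᵐ[volume] fun x => ((φ x).toReal : ℂ) * u x := hw.coeFn_toLp
  have hwn : ∀ᵐ x, ‖w x‖ₑ = φ x * ‖u x‖ₑ := by
    filter_upwards [hwe] with x hx
    rw [hx, enorm_mul]
    congr 1
    rw [← ofReal_norm, Complex.norm_real, Real.norm_of_nonneg ENNReal.toReal_nonneg,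
      ENNReal.ofReal_toReal (hφtop x)]
  have h1 : ∫⁻ x, φ x * ‖u x‖ₑ ^ 2 = ‖⟪w, u⟫_ℂ‖ₑ := by
    have hi : Integrable fun x => (φ x).toReal * ‖u x‖ ^ 2 := by
      refine (integrable_conj_mul w u).norm.congr ?_
      filter_upwards [hwe] with x hx
      rw [hx, norm_mul, RCLike.norm_conj, norm_mul, Complex.norm_real,
        Real.norm_of_nonneg ENNReal.toReal_nonneg]
      ring
    have e1 : ⟪w, u⟫_ℂ = ((∫ x, (φ x).toReal * ‖u x‖ ^ 2 : ℝ) : ℂ) := by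
      rw [← integral_complex_ofReal, L2.inner_def]
      refine integral_congr_ae ?_
      filter_upwards [hwe] with x hx
      rw [hx, RCLike.inner_apply, map_mul, Complex.conj_ofReal]
      push_cast
      rw [← Complex.conj_mul']
      ring
    rw [e1, ← ofReal_norm, Complex.norm_real, Real.norm_of_nonneg
      (integral_nonneg fun x => by positivity), ofReal_integral_eq_lintegral_ofReal hi
      (Eventually.of_forall fun x => by positivity)]
    refine lintegral_congr fun x => ?_
    rw [ENNReal.ofReal_mul ENNReal.toReal_nonneg, ENNReal.ofReal_toReal (hφtop x),
      ENNReal.ofReal_pow (norm_nonneg _), ofReal_norm]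
  have mw : Measurable fun x => ‖w x‖ₑ := (Lp.stronglyMeasurable w).measurable.enorm
  rw [h1, lintegral_smul_measure]
  refine (hb w).trans ?_
  rw [N4_lintegral_left mw mp mp mp, smul_eq_mul]
  refine mul_le_mul_right (lintegral_mono fun z => N4_mono_left_ae ?_) _
  have hqmp : Measure.QuasiMeasurePreserving (fun x : ℝ => x - z) volume volume :=
    (measurePreserving_sub_right volume z).quasiMeasurePreserving
  filter_upwards [hqmp.ae hwn] with x hx
  exact hx.le

/-! ### The Green function of the resolvent -/

theorem integrable_exp_neg_mul_abs {κ : ℝ} (hκ : 0 < κ) :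
    Integrable fun x : ℝ => Real.exp (-κ * |x|) := by
  rw [← integrableOn_univ, ← Iic_union_Ioi (a := (0 : ℝ))]
  refine IntegrableOn.union ?_ ?_
  · refine (integrableOn_exp_mul_Iic hκ 0).congr_fun (fun x hx => ?_) measurableSet_Iic
    simp only [abs_of_nonpos (show x ≤ 0 from hx)]
    congr 1; ring
  · refine (integrableOn_exp_mul_Ioi (neg_lt_zero.2 hκ) 0).congr_fun (fun x hx => ?_)
      measurableSet_Ioi
    simp only [abs_of_pos (show 0 < x from hx)]

theorem fourier_exp_neg_mul_abs {κ : ℝ} (hκ : 0 < κ) (k : ℝ) :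
    𝓕 (fun x : ℝ => ((Real.exp (-κ * |x|) : ℝ) : ℂ)) k =
      ((2 * κ / (κ ^ 2 + (2 * Real.pi * k) ^ 2) : ℝ) : ℂ) := by
  have hi : Integrable fun x : ℝ => Complex.exp ((-2 * Real.pi * (x * k) : ℝ) * Complex.I) *
      ((Real.exp (-κ * |x|) : ℝ) : ℂ) := by
    refine (integrable_exp_neg_mul_abs hκ).ofReal.bdd_mul (c := 1)
      (Measurable.aestronglyMeasurable (by fun_prop)) (Eventually.of_forall fun x => ?_)
    rw [Complex.norm_exp_ofReal_mul_I]
  set a : ℂ := κ - 2 * Real.pi * k * Complex.I with ha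
  set b : ℂ := -κ - 2 * Real.pi * k * Complex.I with hb
  have hare : a.re = κ := by simp [ha]
  have hbre : b.re = -κ := by simp [hb]
  have e : 𝓕 (fun x : ℝ => ((Real.exp (-κ * |x|) : ℝ) : ℂ)) k =
      ∫ x : ℝ, Complex.exp ((-2 * Real.pi * (x * k) : ℝ) * Complex.I) *
      ((Real.exp (-κ * |x|) : ℝ) : ℂ) := by
    rw [Real.fourier_eq']
    refine integral_congr_ae (Eventually.of_forall fun x => ?_)
    simp only [RCLike.inner_apply, conj_trivial, smul_eq_mul]
    rw [mul_comm k x]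
  rw [e, ← intervalIntegral.integral_Iic_add_Ioi (b := (0 : ℝ)) hi.integrableOn hi.integrableOn]
  have e1 : ∫ x : ℝ in Iic 0, Complex.exp ((-2 * Real.pi * (x * k) : ℝ) * Complex.I) *
      ((Real.exp (-κ * |x|) : ℝ) : ℂ) = ∫ x : ℝ in Iic 0, Complex.exp (a * x) := by
    refine setIntegral_congr_fun measurableSet_Iic fun x hx => ?_
    simp only [abs_of_nonpos (show x ≤ 0 from hx)]
    rw [Complex.ofReal_exp, ← Complex.exp_add]
    congr 1
    rw [ha]; push_cast; ring
  have e2 : ∫ x : ℝ in Ioi 0, Complex.exp ((-2 * Real.pi * (x * k) : ℝ) * Complex.I) *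
      ((Real.exp (-κ * |x|) : ℝ) : ℂ) = ∫ x : ℝ in Ioi 0, Complex.exp (b * x) := by
    refine setIntegral_congr_fun measurableSet_Ioi fun x hx => ?_
    simp only [abs_of_pos (show 0 < x from hx)]
    rw [Complex.ofReal_exp, ← Complex.exp_add]
    congr 1
    rw [hb]; push_cast; ring
  rw [e1, e2, integral_exp_mul_complex_Iic (by rw [hare]; exact hκ),
    integral_exp_mul_complex_Ioi (by rw [hbre]; linarith)]
  have ha0 : a ≠ 0 := fun h => by rw [h, Complex.zero_re] at hare; linarith
  have hb0 : b ≠ 0 := fun h => by rw [h, Complex.zero_re] at hbre; linarith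
  have hab : ((κ ^ 2 + (2 * Real.pi * k) ^ 2 : ℝ) : ℂ) = -(a * b) := by
    rw [ha, hb]; push_cast
    linear_combination (4 * Real.pi ^ 2 * k ^ 2 : ℂ) * Complex.I_sq
  rw [Complex.ofReal_div, hab]
  simp only [Complex.ofReal_zero, mul_zero, Complex.exp_zero]
  field_simp
  rw [ha, hb]; push_cast; ring

theorem L2_eq_of_fourier_ae_eq {f g : L2} (h : (𝓕 f : L2) =ᵐ[volume] (𝓕 g : L2)) : f = g :=
  (Lp.fourierTransformₗᵢ ℝ ℂ).injective (Lp.ext h)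

/-- The resolvent is convolution with a positive measure: the point mass 1/ω at 0 if d = 0, and the
density e^{-κ|x|}/(2κd) with κ² = ω/d if d > 0. Convolution is checked on nice functions; an almost
everywhere convergent subsequence gives the inequality on L². -/
theorem exists_resolvent_measure {d ω : ℝ} (hd : 0 ≤ d) (hω : 0 < ω) {R : L2 → L2}
    (hR : Continuous R) (hRm : ∀ h : L2, (𝓕 (R h) : L2) =ᵐ[volume]
      fun k => resolventSymbol d ω k * (𝓕 h : L2) k) :
    ∃ ν : Measure ℝ, SFinite ν ∧ (∃ μ₀ > 0, ∫⁻ z, ENNReal.ofReal (Real.exp (μ₀ * |z|)) ∂ν ≠ ⊤) ∧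
      ∀ h : L2, ∀ᵐ x, ‖R h x‖ₑ ≤ ∫⁻ z, ‖h (x - z)‖ₑ ∂ν := by
  rcases hd.eq_or_lt with rfl | hd
  · refine ⟨ENNReal.ofReal (1 / ω) • Measure.dirac 0, inferInstance, ⟨1, one_pos, ?_⟩, fun h => ?_⟩
    · rw [lintegral_smul_measure, lintegral_dirac]
      simp
    · have e : R h = ((1 / ω : ℝ) : ℂ) • h := by
        refine L2_eq_of_fourier_ae_eq ?_
        have e1 : (𝓕 (((1 / ω : ℝ) : ℂ) • h) : L2) = ((1 / ω : ℝ) : ℂ) • 𝓕 h :=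
          (Lp.fourierTransformₗᵢ ℝ ℂ).map_smul _ _
        rw [e1]
        filter_upwards [hRm h, Lp.coeFn_smul ((1 / ω : ℝ) : ℂ) (𝓕 h : L2)] with k h1 h2
        rw [h1, h2, Pi.smul_apply, smul_eq_mul, resolventSymbol, zero_mul, add_zero]
      rw [e]
      filter_upwards [Lp.coeFn_smul ((1 / ω : ℝ) : ℂ) h] with x hx
      rw [hx, lintegral_smul_measure, lintegral_dirac, sub_zero, Pi.smul_apply, smul_eq_mul,
        enorm_mul, smul_eq_mul, ← ofReal_norm ((1 / ω : ℝ) : ℂ), Complex.norm_real,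
        Real.norm_of_nonneg (by positivity)]
  set κ : ℝ := Real.sqrt (ω / d) with hκdef
  have hκ : 0 < κ := Real.sqrt_pos.2 (by positivity)
  have hκ2 : κ ^ 2 = ω / d := Real.sq_sqrt (by positivity)
  set G : ℝ → ℝ := fun x => 1 / (2 * κ * d) * Real.exp (-κ * |x|) with hG
  have hG0 : ∀ x, 0 ≤ G x := fun x => by positivity
  have hGm : Measurable G := by fun_prop
  have hGi : Integrable G := (integrable_exp_neg_mul_abs hκ).const_mul _
  have hGc : Integrable fun x => (G x : ℂ) := hGi.ofReal
  have hFG : ∀ k, 𝓕 (fun x => (G x : ℂ)) k = resolventSymbol d ω k := by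
    intro k
    have e1 : 𝓕 (fun x => (G x : ℂ)) k = ((1 / (2 * κ * d) : ℝ) : ℂ) *
        𝓕 (fun x : ℝ => ((Real.exp (-κ * |x|) : ℝ) : ℂ)) k := by
      rw [Real.fourier_eq', Real.fourier_eq', ← integral_const_mul]
      refine integral_congr_ae (Eventually.of_forall fun x => ?_)
      simp only [hG, smul_eq_mul]
      push_cast
      ring
    rw [e1, fourier_exp_neg_mul_abs hκ, ← Complex.ofReal_mul, resolventSymbol]
    congr 1
    rw [hκ2]
    have : 0 < ω / d + (2 * Real.pi * k) ^ 2 := by positivity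
    have : 0 < ω + d * (2 * Real.pi * k) ^ 2 := by positivity
    field_simp
  -- Half the decay rate of the Green function is spent on the weight, leaving the integrable
  -- e^{-κ|x|/2}.
  refine ⟨volume.withDensity fun x => ENNReal.ofReal (G x), inferInstance,
    ⟨κ / 2, by positivity, ?_⟩, ?_⟩
  · rw [lintegral_withDensity_eq_lintegral_mul _ (by fun_prop) (by fun_prop)]
    have : Integrable fun x : ℝ => 1 / (2 * κ * d) * Real.exp (-(κ / 2) * |x|) :=
      (integrable_exp_neg_mul_abs (half_pos hκ)).const_mul _
    refine ne_top_of_le_ne_top this.lintegral_lt_top.ne (lintegral_mono fun x => ?_)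
    simp only [Pi.mul_apply, hG]
    rw [← ENNReal.ofReal_mul (by positivity), mul_assoc, ← Real.exp_add]
    refine ENNReal.ofReal_le_ofReal (le_of_eq ?_)
    congr 2; ring
  have hint : ∀ g : ℝ → ℝ≥0∞, ∫⁻ z, g z ∂(volume.withDensity fun x => ENNReal.ofReal (G x)) =
      ∫⁻ z, ENNReal.ofReal (G z) * g z := fun g => by
    rw [lintegral_withDensity_eq_lintegral_mul_non_measurable _ (by fun_prop)
      (Eventually.of_forall fun x => ENNReal.ofReal_lt_top)]
    rfl
  have hnice : ∀ (v : ℝ → ℂ) (hv : BddSupp v), ∀ᵐ x, ‖R ((hv.memLp 2).toLp v) x‖ₑ ≤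
      ∫⁻ z, ‖v (x - z)‖ₑ ∂(volume.withDensity fun x => ENNReal.ofReal (G x)) := by
    intro v hv
    set w : ℝ → ℂ := fun x => ∫ z, (G z : ℂ) * v (x - z) with hw
    have hw1 : Integrable w :=
      Integrable.integrable_convolution (ContinuousLinearMap.mul ℂ ℂ) hGc hv.integrable
    have hFw : ∀ k, 𝓕 w k = resolventSymbol d ω k * 𝓕 v k := fun k => by
      rw [← hFG]; exact Real.fourier_mul_convolution_eq hGc hv.integrable k
    obtain ⟨M, hM0, hM, -⟩ := hv.exists_pos
    have hwb : ∀ x, ‖w x‖ ≤ ∫ z, G z * M := fun x => by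
      refine norm_integral_le_of_norm_le (hGi.mul_const M) (Eventually.of_forall fun z => ?_)
      rw [norm_mul, Complex.norm_real, Real.norm_of_nonneg (hG0 z)]
      exact mul_le_mul_of_nonneg_left (hM _) (hG0 z)
    have hw2 : MemLp w 2 := by
      rw [memLp_two_iff_integrable_sq_norm hw1.aestronglyMeasurable]
      refine (hw1.norm.const_mul (∫ z, G z * M)).mono' (hw1.aestronglyMeasurable.norm.pow 2)
        (Eventually.of_forall fun x => ?_)
      rw [Real.norm_of_nonneg (by positivity), sq]
      exact mul_le_mul_of_nonneg_right (hwb x) (norm_nonneg _)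
    have e : R ((hv.memLp 2).toLp v) = hw2.toLp w := by
      refine L2_eq_of_fourier_ae_eq ?_
      filter_upwards [hRm ((hv.memLp 2).toLp v), fourier_toLp_ae_eq hw1 hw2,
        fourier_toLp_ae_eq hv.integrable (hv.memLp 2)] with k h1 h2 h3
      rw [h1, h2, h3, hFw]
    rw [e]
    filter_upwards [hw2.coeFn_toLp] with x hx
    rw [hx, hint]
    refine (enorm_integral_le_lintegral_enorm _).trans_eq (lintegral_congr fun z => ?_)
    rw [enorm_mul, ← ofReal_norm (G z : ℂ), Complex.norm_real, Real.norm_of_nonneg (hG0 z)]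
  intro h
  obtain ⟨v, hv, hle, hlim⟩ := exists_bddSupp_tendsto h
  have hRlim := (hR.tendsto h).comp hlim
  obtain ⟨ns, hns, hae⟩ := (tendstoInMeasure_of_tendsto_Lp hRlim).exists_seq_tendsto_ae
  filter_upwards [hae, ae_all_iff.2 fun n => hnice (v n) (hv n)] with x h1 h2
  refine le_of_tendsto' ((continuous_enorm.tendsto _).comp h1) fun k => (h2 _).trans ?_
  exact lintegral_mono fun z => enorm_le_iff_norm_le.2 (hle _ _)

theorem IsWeakSolution.exists_exp_weight {L : ℝ} (hL : 0 < L) {d₀ : ℝ → ℝ}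
    (hd : IsPiecewiseW11 L d₀) (hd' : IsBoundedAwayFromZero L d₀) {dav ω : ℝ} (hω : 0 < ω) {f : L2}
    (hf : IsWeakSolution L d₀ dav ω f) :
    (∃ μ > 0, ∫⁻ x, ENNReal.ofReal (Real.exp (μ * |x|)) ^ 2 * ‖f x‖ₑ ^ 2 ≠ ⊤) ∧
    ∃ μ > 0, ∫⁻ x, ENNReal.ofReal (Real.exp (μ * |x|)) ^ 2 * ‖(𝓕 f : L2) x‖ₑ ^ 2 ≠ ⊤ := by
  obtain ⟨hQ, C, hC, hb⟩ := Q_bounds hL hd hd'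
  obtain ⟨R, hR, hRm⟩ := exists_resolvent hf.nonneg hω
  have heq := hf.inner_eq hω hQ hR hRm
  refine ⟨?_, ?_⟩
  · obtain ⟨ν, hν, ⟨μ₀, hμ₀, hmom⟩, hνb⟩ := exists_resolvent_measure hf.nonneg hω hR hRm
    refine exists_exp_weight_of_bound f hμ₀ hmom (C := C) fun w => ?_
    rw [heq]
    exact ((hb _ _ _ _).2).trans (mul_le_mul_right (N4_mono_left_ae (hνb w)) _)
  -- In frequency the resolvent is multiplication by a symbol of size at most 1/ω, which is
  -- dominated by convolution with a point mass at 0; no smoothing from d_av is needed.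
  · refine exists_exp_weight_of_bound (𝓕 f) (ν := ENNReal.ofReal (1 / ω) • Measure.dirac 0)
      (μ₀ := 1) one_pos ?_ (C := C) fun w => ?_
    · rw [lintegral_smul_measure, lintegral_dirac]
      simp
    · have e : ⟪w, (𝓕 f : L2)⟫_ℂ = ⟪(𝓕⁻ w : L2), f⟫_ℂ := by
        rw [← Lp.inner_fourier_eq (𝓕⁻ w : L2), FourierTransform.fourier_fourierInv_eq]
      rw [e, heq]
      refine ((hb _ _ _ _).1).trans (mul_le_mul_right (N4_mono_left_ae ?_) _)
      filter_upwards [hRm (𝓕⁻ w)] with x hx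
      rw [hx, FourierTransform.fourier_fourierInv_eq, lintegral_smul_measure, lintegral_dirac,
        sub_zero, enorm_mul, smul_eq_mul]
      gcongr
      rw [← ofReal_norm]
      exact ENNReal.ofReal_le_ofReal (norm_resolventSymbol_le hf.nonneg hω x)

end DispersionManagement

/-! ### From weighted integrals to pointwise exponential decay. -/

namespace DispersionManagement

open Filter Topology

/-- Cauchy–Schwarz against e^{-μ|x|/2}; half of the rate is lost. -/
theorem integrable_exp_mul_norm_of_weight {u : ℝ → ℂ} (hu : AEStronglyMeasurable u) {μ : ℝ}
    (hμ : 0 < μ) (h : ∫⁻ x, ENNReal.ofReal (Real.exp (μ * |x|)) ^ 2 * ‖u x‖ₑ ^ 2 ≠ ⊤) :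
    Integrable fun x => Real.exp (μ / 2 * |x|) * ‖u x‖ := by
  have m1 : MemLp (fun x => Real.exp (μ * |x|) * ‖u x‖) 2 := by
    have hm : AEStronglyMeasurable fun x => Real.exp (μ * |x|) * ‖u x‖ :=
      AEStronglyMeasurable.mul (Measurable.aestronglyMeasurable (by fun_prop)) hu.norm
    rw [memLp_two_iff_integrable_sq hm]
    refine ⟨hm.pow 2, ?_⟩
    rw [hasFiniteIntegral_iff_ofReal (Eventually.of_forall fun x => by positivity)]
    refine lt_top_iff_ne_top.2 (ne_of_eq_of_ne (lintegral_congr fun x => ?_) h)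
    rw [mul_pow, ENNReal.ofReal_mul (by positivity), ENNReal.ofReal_pow (by positivity),
      ENNReal.ofReal_pow (by positivity), ofReal_norm]
  have m2 : MemLp (fun x : ℝ => Real.exp (-(μ / 2) * |x|)) 2 := by
    rw [memLp_two_iff_integrable_sq (Measurable.aestronglyMeasurable (by fun_prop))]
    refine (integrable_exp_neg_mul_abs hμ).congr (Eventually.of_forall fun x => ?_)
    simp only
    rw [← Real.exp_nat_mul]
    congr 1; push_cast; ring
  refine (m2.integrable_mul m1).congr (Eventually.of_forall fun x => ?_)
  simp only [Pi.mul_apply]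
  rw [← mul_assoc, ← Real.exp_add]
  congr 2; ring

/-- A bounded Lipschitz function with an exponentially weighted integral decays exponentially. -/
theorem norm_le_exp_of_lipschitz {φ : ℝ → ℂ} {K ν : ℝ} (hK : 0 < K) (hν : 0 ≤ ν)
    (hb : ∀ x, ‖φ x‖ ≤ K) (hlip : ∀ x y, ‖φ x - φ y‖ ≤ K * |x - y|)
    (hi : Integrable fun x => Real.exp (ν * |x|) * ‖φ x‖) (x : ℝ) :
    ‖φ x‖ ≤ Real.sqrt (2 * K * Real.exp ν * ∫ x, Real.exp (ν * |x|) * ‖φ x‖) *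
      Real.exp (-(ν / 2) * |x|) := by
  set E : ℝ := ∫ x, Real.exp (ν * |x|) * ‖φ x‖ with hE
  have hE0 : 0 ≤ E := integral_nonneg fun x => by positivity
  set A : ℝ := ‖φ x‖ with hA
  have hA0 : 0 ≤ A := norm_nonneg _
  -- Within distance r of x the Lipschitz bound keeps the modulus above A/2, so the weighted
  -- integral is at least of order A² e^{ν|x|}. The bound r ≤ 1 limits the loss in the weight to
  -- e^{-ν}.
  set r : ℝ := A / (2 * K) with hr
  have hr0 : 0 ≤ r := by positivity
  have hr1 : r ≤ 1 := by
    rw [hr, div_le_one (by positivity)]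
    linarith [hb x]
  have hKr : K * r = A / 2 := by rw [hr]; field_simp
  have key : A ^ 2 ≤ 2 * K * Real.exp ν * E * Real.exp (-ν * |x|) := by
    have h1 : ∫ y in Icc (x - r) (x + r), Real.exp (ν * |x| - ν) * (A / 2) ≤ E := by
      refine (setIntegral_mono_on continuous_const.integrableOn_Icc hi.integrableOn measurableSet_Icc
        fun y hy => ?_).trans (setIntegral_le_integral hi
          (Eventually.of_forall fun y => by positivity))
      have hxy : |x - y| ≤ r := abs_le.2 ⟨by linarith [hy.2], by linarith [hy.1]⟩
      have h2 : A / 2 ≤ ‖φ y‖ := by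
        have h3 := hlip x y
        have h4 := norm_sub_norm_le (φ x) (φ y)
        have h5 : K * |x - y| ≤ A / 2 := by rw [← hKr]; gcongr
        linarith
      have h3 : |x| - 1 ≤ |y| := by
        have := abs_sub_abs_le_abs_sub x y
        linarith
      refine mul_le_mul (Real.exp_le_exp.2 ?_) h2 (by positivity) (by positivity)
      nlinarith
    rw [setIntegral_const, Measure.real, Real.volume_Icc, ENNReal.toReal_ofReal (by linarith),
      smul_eq_mul, Real.exp_sub] at h1
    have h2 : A ^ 2 * (Real.exp (ν * |x|) / Real.exp ν) ≤ 2 * K * E := by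
      calc A ^ 2 * (Real.exp (ν * |x|) / Real.exp ν)
          = 2 * K * ((x + r - (x - r)) * (Real.exp (ν * |x|) / Real.exp ν * (A / 2))) := by
            rw [hr]; field_simp; ring
        _ ≤ 2 * K * E := by gcongr
    rw [neg_mul, Real.exp_neg]
    have e1 := Real.exp_pos (ν * |x|)
    have e2 := Real.exp_pos ν
    rw [mul_div_assoc', div_le_iff₀ e2] at h2
    rw [← div_eq_mul_inv, le_div_iff₀ e1]
    linarith
  refine abs_le_of_sq_le_sq' ?_ (by positivity) |>.2
  rw [mul_pow, Real.sq_sqrt (by positivity), ← Real.exp_nat_mul]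
  refine key.trans_eq ?_
  congr 2; push_cast; ring

theorem abs_le_exp_mul {ν : ℝ} (hν : 0 < ν) (x : ℝ) : |x| ≤ 1 / ν * Real.exp (ν * |x|) := by
  rw [one_div, ← div_eq_inv_mul, le_div_iff₀ hν]
  linarith [Real.add_one_le_exp (ν * |x|)]

/-- If `v` and its Fourier transform have exponentially weighted integrals, then the Fourier
transform decays pointwise. -/
theorem exists_norm_fourier_le_exp {v : ℝ → ℂ} (hv : AEStronglyMeasurable v) {ν ν' : ℝ}
    (hν : 0 < ν) (hν' : 0 < ν') (h : Integrable fun x => Real.exp (ν * |x|) * ‖v x‖)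
    (h' : Integrable fun x => Real.exp (ν' * |x|) * ‖𝓕 v x‖) :
    ∃ μ C : ℝ, 0 < μ ∧ 0 < C ∧ ∀ k, ‖𝓕 v k‖ ≤ C * Real.exp (-μ * |k|) := by
  have h1 : Integrable v := h.mono hv (Eventually.of_forall fun x => by
    rw [norm_mul, norm_norm, Real.norm_of_nonneg (Real.exp_pos _).le]
    exact le_mul_of_one_le_left (norm_nonneg _) (Real.one_le_exp (by positivity)))
  have h2 : Integrable fun x => x • v x := by
    refine (h.const_mul (1 / ν)).mono' (continuous_id.aestronglyMeasurable.smul hv)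
      (Eventually.of_forall fun x => ?_)
    rw [norm_smul, Real.norm_eq_abs, ← mul_assoc]
    exact mul_le_mul_of_nonneg_right (abs_le_exp_mul hν x) (norm_nonneg _)
  have hd := fun k => Real.hasDerivAt_fourier h1 h2 k
  set B : ℝ := ∫ x : ℝ, ‖(-2 * Real.pi * Complex.I * x) • v x‖ with hB
  have hB0 : 0 ≤ B := integral_nonneg fun x => norm_nonneg _
  set B' : ℝ := ∫ x : ℝ, ‖v x‖ with hB'
  have hB'0 : 0 ≤ B' := integral_nonneg fun x => norm_nonneg _
  -- The single constant B + B' + 1 serves as Lipschitz and sup bound; the 1 makes it positive.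
  have hlip : ∀ x y, ‖𝓕 v x - 𝓕 v y‖ ≤ (B + B' + 1) * |x - y| := fun x y => by
    have := convex_univ.norm_image_sub_le_of_norm_hasDerivWithin_le (C := B)
      (fun k _ => (hd k).hasDerivWithinAt) (fun k _ =>
        VectorFourier.norm_fourierIntegral_le_integral_norm _ _ _ _ _) (mem_univ y) (mem_univ x)
    refine this.trans ?_
    rw [Real.norm_eq_abs]
    gcongr
    linarith
  have hbd : ∀ x, ‖𝓕 v x‖ ≤ B + B' + 1 := fun x => by
    have : ‖𝓕 v x‖ ≤ B' := VectorFourier.norm_fourierIntegral_le_integral_norm _ _ _ _ _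
    linarith
  refine ⟨ν' / 2, _, by positivity, add_pos_of_nonneg_of_pos (Real.sqrt_nonneg
    (2 * (B + B' + 1) * Real.exp ν' * ∫ x, Real.exp (ν' * |x|) * ‖𝓕 v x‖)) one_pos, fun k => ?_⟩
  refine (norm_le_exp_of_lipschitz (by positivity) hν'.le hbd hlip h' k).trans ?_
  gcongr
  linarith

theorem fourierHat_eq (f : ℝ → ℂ) (k : ℝ) :
    fourierHat f k = ((1 / Real.sqrt (2 * Real.pi) : ℝ) : ℂ) * 𝓕 f (-(k / (2 * Real.pi))) := by
  unfold fourierHat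
  congr 1
  rw [Real.fourier_eq']
  refine integral_congr_ae (Eventually.of_forall fun x => ?_)
  simp only [RCLike.inner_apply, conj_trivial, smul_eq_mul]
  congr 2
  push_cast
  field_simp

/-- Dispersion managed solitons decay exponentially in position and in frequency. -/
theorem IsWeakSolution.exists_exp_decay {L : ℝ} (hL : 0 < L) {d₀ : ℝ → ℝ}
    (hd₀ : IsPiecewiseW11 L d₀) (hd₀' : IsBoundedAwayFromZero L d₀) {dav ω : ℝ} (hω : 0 < ω)
    {f : L2} (hf : IsWeakSolution L d₀ dav ω f) :
    ∃ f₀ : ℝ → ℂ, Continuous f₀ ∧ f =ᵐ[volume] f₀ ∧ Integrable f₀ ∧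
      ∃ μ C : ℝ, 0 < μ ∧ 0 < C ∧ ∀ x k : ℝ,
        ‖f₀ x‖ ≤ C * Real.exp (-μ * |x|) ∧ ‖fourierHat f₀ k‖ ≤ C * Real.exp (-μ * |k|) := by
  obtain ⟨⟨μ₁, hμ₁, w₁⟩, μ₂, hμ₂, w₂⟩ := hf.exists_exp_weight hL hd₀ hd₀' hω
  set F : ℝ → ℂ := ((𝓕 f : L2) : ℝ → ℂ) with hF
  have i₁ := integrable_exp_mul_norm_of_weight (Lp.aestronglyMeasurable f) hμ₁ w₁
  have i₂ := integrable_exp_mul_norm_of_weight (Lp.aestronglyMeasurable (𝓕 f : L2)) hμ₂ w₂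
  have hint : ∀ {ν : ℝ} {v : ℝ → ℂ}, 0 < ν → AEStronglyMeasurable v →
      Integrable (fun x => Real.exp (ν / 2 * |x|) * ‖v x‖) → Integrable v := fun hν hv h =>
    h.mono hv (Eventually.of_forall fun x => by
      rw [norm_mul, norm_norm, Real.norm_of_nonneg (Real.exp_pos _).le]
      exact le_mul_of_one_le_left (norm_nonneg _) (Real.one_le_exp (by positivity)))
  have hFi : Integrable F := hint hμ₂ (Lp.aestronglyMeasurable _) i₂
  have hfe : f =ᵐ[volume] 𝓕⁻ F := by
    have h := fourierInv_toLp_ae_eq hFi (Lp.memLp (𝓕 f : L2))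
    rw [Lp.toLp_coeFn, FourierTransform.fourierInv_fourier_eq] at h
    exact h
  set f₀ : ℝ → ℂ := 𝓕⁻ F with hf₀
  have hc : Continuous f₀ := continuous_fourierInv hFi
  have i₁' : Integrable fun x => Real.exp (μ₁ / 2 * |x|) * ‖f₀ x‖ := i₁.congr (by
    filter_upwards [hfe] with x hx
    rw [hx])
  have hf₀i : Integrable f₀ := hint hμ₁ hc.aestronglyMeasurable i₁'
  have hf₀2 : MemLp f₀ 2 := (memLp_congr_ae hfe).1 (Lp.memLp f)
  have hFe : F =ᵐ[volume] 𝓕 f₀ := by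
    have h := fourier_toLp_ae_eq hf₀i hf₀2
    have e : hf₀2.toLp f₀ = f := Lp.ext (hf₀2.coeFn_toLp.trans hfe.symm)
    rw [e] at h
    exact h
  have hneg : ∀ x, 𝓕 F x = f₀ (-x) := fun x => by
    rw [hf₀, Real.fourierInv_eq_fourier_neg, neg_neg]
  -- Applied to F, whose transform is the reflection of f₀, this gives the decay of f₀. Applied next
  -- to f₀, whose transform is F almost everywhere, it gives the decay in frequency.
  obtain ⟨m₁, C₁, hm₁, hC₁, b₁⟩ := exists_norm_fourier_le_exp (Lp.aestronglyMeasurable (𝓕 f : L2))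
    (half_pos hμ₂) (half_pos hμ₁) i₂ (by
      have := i₁'.comp_neg
      simp only [abs_neg, ← hneg] at this
      exact this)
  obtain ⟨m₂, C₂, hm₂, hC₂, b₂⟩ := exists_norm_fourier_le_exp hc.aestronglyMeasurable
    (half_pos hμ₁) (half_pos hμ₂) i₁' (i₂.congr (by
      filter_upwards [hFe] with x hx
      rw [← hx]))
  have hpi : 0 < 2 * Real.pi := by positivity
  -- The division by 2π accounts for the different normalization of the frequency in `fourierHat`.
  refine ⟨f₀, hc, hfe, hf₀i, min m₁ (m₂ / (2 * Real.pi)), max C₁ C₂, by positivity, by positivity,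
    fun x k => ⟨?_, ?_⟩⟩
  · have h := b₁ (-x)
    rw [hneg, neg_neg, abs_neg] at h
    refine h.trans ?_
    gcongr
    · exact le_max_left _ _
    · exact min_le_left _ _
  · rw [fourierHat_eq, norm_mul, Complex.norm_real, Real.norm_of_nonneg (by positivity)]
    have h1 : 1 / Real.sqrt (2 * Real.pi) ≤ 1 := by
      rw [div_le_one (by positivity), Real.one_le_sqrt]
      linarith [Real.pi_gt_three]
    refine (mul_le_of_le_one_left (norm_nonneg _) h1).trans ((b₂ _).trans ?_)
    rw [abs_neg, abs_div, abs_of_pos hpi]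
    gcongr ?_ * Real.exp ?_
    · exact le_max_right _ _
    · rw [neg_mul, neg_mul, neg_le_neg_iff]
      calc _ ≤ m₂ / (2 * Real.pi) * |k| := by gcongr; exact min_le_right _ _
        _ = _ := by ring

end DispersionManagement

theorem mainTheorem1 (L : ℝ) (hL : 0 < L) (d₀ : ℝ → ℝ)
    (hd₀ : DispersionManagement.IsPiecewiseW11 L d₀)
    (hd₀' : DispersionManagement.IsBoundedAwayFromZero L d₀)
    (dav ω : ℝ) (hω : 0 < ω) (f : DispersionManagement.L2)
    (hf : DispersionManagement.IsWeakSolution L d₀ dav ω f) :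
    ∃ f₀ : ℝ → ℂ, Continuous f₀ ∧ f =ᵐ[volume] f₀ ∧ Integrable f₀ ∧
      ∃ μ C : ℝ, 0 < μ ∧ 0 < C ∧ ∀ x k : ℝ,
        ‖f₀ x‖ ≤ C * Real.exp (-μ * |x|) ∧
        ‖DispersionManagement.fourierHat f₀ k‖ ≤ C * Real.exp (-μ * |k|) :=
  hf.exists_exp_decay hL hd₀ hd₀' hω
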